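/- **Notation.** Let $N\ge 1$. For $V\subset\mathbb R^N$ and $\delta>0$ put $V_\delta=\{x\in V: d(x,\partial V)>\delta\}$ and $V^\delta=\{x\in\mathbb R^N: d(x,V)<\delta\}$. A cuboid is an isometric image of a set $\prod_{i=1}^N\,]a_i,b_i[$. An *atlas* $\mathcal A=(\rho,s,s',\{V_j\}_{j=1}^s,\{r_j\}_{j=1}^s)$ in $\mathbb R^N$ consists of $\rho>0$, natural numbers $s'\le s$, bounded open cuboids $V_j$ and isometries $r_j$ of $\mathbb R^N$. The class $C(\mathcal A)$ consists of the open sets $\Omega\subset\mathbb R^N$ such that (i) $\Omega\subset\bigcup_{j=1}^s (V_j)_\rho$ and $(V_j)_\rho\cap\Omega\neq\emptyset$ for all $j$; (ii) $V_j\cap\partial\Omega\ne\emptyset$ for $j\le s'$ and $V_j\cap\partial\Omega=\emptyset$ for $s'<j\le s$; (iii) for all $j$, $r_j(V_j)=\{x: a_{ij}<x_i<b_{ij},\ i=1,\dots,N\}$ and $r_j(\Omega\cap V_j)=\{x: a_{Nj}<x_N<g_j(\bar x),\ \bar x\in W_j\}$, where $\bar x=(x_1,\dots,x_{N-1})$,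 $W_j=\{\bar x: a_{ij}<x_i<b_{ij},\ i=1,\dots,N-1\}$ and $g_j$ is continuous on $\overline W_j$, with $a_{Nj}+\rho\le g_j\le b_{Nj}-\rho$ on $\overline W_j$ if $j\le s'$, and $g_j\equiv b_{Nj}$ if $j>s'$. Let $\omega:[0,\infty[\to[0,\infty[$ be a modulus of continuity, i.e. continuous, non-decreasing, with $\omega(0)=0$ and, for some $\kappa>0$, $\omega(\tau)\ge\kappa\tau$ for all $0\le\tau\le1$. For $M>0$ let $C_M^{\omega(\cdot)}(\mathcal A)$ be the set of all $\Omega\in C(\mathcal A)$ such that $|g_j(\bar x)-g_j(\bar y)|\le M\,\omega(|\bar x-\bar y|)$ for all $j$ and all $\bar x,\bar y\in\overline W_j$. For an open set $\Omega$ of finite measure and $t,\lambda,\mu,k>0$, let $\mathcal V(\Omega)=(H^1_0(\Omega))^N\times H^1_0(\Omega)$, where $H^1_0(\Omega)$ is the closure of $C_c^\infty(\Omega)$ in $H^1(\Omega)$. Let $\gamma_{n,t}[\Omega]$, $n=1,2,\dots$, be the eigenvalues, in non-decreasing order and repeated according to multiplicity, of the Reissner–Mindlin problem: find $(\beta,w)\in\mathcal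 V(\Omega)\setminus\{0\}$ and $\gamma\in\mathbb R$ with $$\frac{\mu}{12}\int_\Omega\nabla\beta:\nabla\eta\,dx+\frac{\mu+\lambda}{12}\int_\Omega\operatorname{div}\beta\,\operatorname{div}\eta\,dx+\frac{\mu k}{t^2}\int_\Omega(\nabla w-\beta)\cdot(\nabla v-\eta)\,dx=\gamma\int_\Omega\Bigl(wv+\frac{t^2}{12}\beta\cdot\eta\Bigr)dx$$ for all $(\eta,v)\in\mathcal V(\Omega)$. **Statement.** Let $\mathcal A$ be an atlas in $\mathbb R^N$, $\omega$ a modulus of continuity as above, and $M,\lambda,\mu>0$. Then there exists $c>0$, depending only on $\mathcal A,\omega,\lambda,\mu,M$, such that $$|\gamma_{n,t}[\Omega_1]-\gamma_{n,t}[\Omega_2]|\le c\,\max\{\gamma_{n,t}[\Omega_1],\gamma_{n,t}[\Omega_2]\}\,\omega(\epsilon)$$ for all $k>0$, all integers $n\ge1$, all $t>0$, all $\epsilon\in\,]0,c^{-1}[$ and all $\Omega_1,\Omega_2\in C_M^{\omega(\cdot)}(\mathcal A)$ such that $$(\Omega_1)_\epsilon\subset\Omega_2\subset(\Omega_1)^\epsilon\quad\text{or}\quad(\Omega_2)_\epsilon\subset\Omega_1\subset(\Omega_2)^\epsilon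 .$$ -/

import Mathlib

open MeasureTheory Set TopologicalSpace
open scoped ENNReal Distributions

noncomputable section

namespace ReissnerMindlin

/-! ## Sobolev spaces on open subsets of `ℝ^N` -/

/-- The Euclidean space `ℝ^N`. -/
abbrev E (N : ℕ) : Type := EuclideanSpace ℝ (Fin N)

/-- The real Hilbert space `L²(Ω)` (functions modulo equality almost everywhere in `Ω`). -/
abbrev L2 {N : ℕ} (Ω : Opens (E N)) : Type :=
  Lp ℝ 2 ((volume : Measure (E N)).restrict (Ω : Set (E N)))

/-- The space `L²(Ω) × L²(Ω)^N`, whose elements are pairs `(u, p)`; a function `u` of class `H¹`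
is represented in it by the pair `(u, ∇u)`. The product topology, restricted to the graph of the
weak gradient, is the topology of the `H¹`-norm. -/
abbrev GradPair {N : ℕ} (Ω : Opens (E N)) : Type := L2 Ω × (Fin N → L2 Ω)

/-- The classical partial derivative `∂f/∂x_i`. -/
def partialD {N : ℕ} (i : Fin N) (f : E N → ℝ) (x : E N) : ℝ :=
  fderiv ℝ f x (EuclideanSpace.single i 1)

section TestFunctions

variable {N : ℕ} {Ω : Opens (E N)}

theorem partialD_add (i : Fin N) (φ ψ : 𝓓(Ω, ℝ)) (x : E N) :
    partialD i (⇑(φ + ψ)) x = partialD i φ x + partialD i ψ x := by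
  have h1 : DifferentiableAt ℝ (⇑φ) x := φ.contDiff.differentiable (by simp) x
  have h2 : DifferentiableAt ℝ (⇑ψ) x := ψ.contDiff.differentiable (by simp) x
  simp only [partialD, FunLike.coe_add]
  rw [fderiv_add h1 h2]
  rfl

theorem partialD_smul (i : Fin N) (c : ℝ) (φ : 𝓓(Ω, ℝ)) (x : E N) :
    partialD i (⇑(c • φ)) x = c * partialD i φ x := by
  have h1 : DifferentiableAt ℝ (⇑φ) x := φ.contDiff.differentiable (by simp) x
  simp only [partialD, FunLike.coe_smul]
  rw [fderiv_const_smul h1]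
  rfl

theorem memLp_testFunction (φ : 𝓓(Ω, ℝ)) :
    MemLp (⇑φ) 2 ((volume : Measure (E N)).restrict (Ω : Set (E N))) :=
  (φ.contDiff.continuous.memLp_of_hasCompactSupport φ.hasCompactSupport).restrict _

theorem memLp_partialD (φ : 𝓓(Ω, ℝ)) (i : Fin N) :
    MemLp (partialD i φ) 2 ((volume : Measure (E N)).restrict (Ω : Set (E N))) := by
  have hc : Continuous (partialD i (⇑φ)) :=
    (φ.contDiff.continuous_fderiv (by simp)).clm_apply continuous_const
  have hs : HasCompactSupport (partialD i (⇑φ)) :=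
    φ.hasCompactSupport.fderiv_apply ℝ (EuclideanSpace.single i 1)
  exact (hc.memLp_of_hasCompactSupport hs).restrict _

theorem integrable_mul_testFunction (u : L2 Ω) (φ : 𝓓(Ω, ℝ)) :
    IntegrableOn (fun x => u x * φ x) (Ω : Set (E N)) :=
  (Lp.memLp u).integrable_mul (memLp_testFunction φ)

theorem integrable_mul_partialD (u : L2 Ω) (φ : 𝓓(Ω, ℝ)) (i : Fin N) :
    IntegrableOn (fun x => u x * partialD i φ x) (Ω : Set (E N)) :=
  (Lp.memLp u).integrable_mul (memLp_partialD φ i)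

end TestFunctions

/-- `p` is the weak gradient of `u` in `Ω`. -/
def IsWeakGradient {N : ℕ} {Ω : Opens (E N)} (u : L2 Ω) (p : Fin N → L2 Ω) : Prop :=
  ∀ (φ : 𝓓(Ω, ℝ)) (i : Fin N),
    ∫ x in (Ω : Set (E N)), u x * partialD i φ x = -∫ x in (Ω : Set (E N)), p i x * φ x

/-- The Sobolev space `H¹(Ω)`, as the space of all pairs `(u, ∇u)` with `u ∈ L²(Ω)` having a weak
gradient `∇u ∈ L²(Ω)^N`. -/
def H1 {N : ℕ} (Ω : Opens (E N)) : Submodule ℝ (GradPair Ω) where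
  carrier := {U | IsWeakGradient U.1 U.2}
  zero_mem' := by
    intro φ i
    have h : ∀ f : E N → ℝ, ∫ x in (Ω : Set (E N)), (0 : L2 Ω) x * f x = 0 := by
      intro f
      rw [integral_eq_zero_of_ae]
      filter_upwards [Lp.coeFn_zero ℝ 2 ((volume : Measure (E N)).restrict (Ω : Set (E N)))]
        with x hx
      rw [hx]
      exact zero_mul _
    simp only [Prod.fst_zero, Prod.snd_zero, Pi.zero_apply]
    rw [h, h, neg_zero]
  add_mem' := by
    intro U W hU hW φ i
    have h1 : ∫ x in (Ω : Set (E N)), (U.1 + W.1) x * partialD i φ x =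
        (∫ x in (Ω : Set (E N)), U.1 x * partialD i φ x)
          + ∫ x in (Ω : Set (E N)), W.1 x * partialD i φ x := by
      rw [← integral_add (integrable_mul_partialD U.1 φ i) (integrable_mul_partialD W.1 φ i)]
      refine integral_congr_ae ?_
      filter_upwards [Lp.coeFn_add U.1 W.1] with x hx
      rw [hx, Pi.add_apply, add_mul]
    have h2 : ∫ x in (Ω : Set (E N)), (U.2 i + W.2 i) x * φ x =
        (∫ x in (Ω : Set (E N)), U.2 i x * φ x) + ∫ x in (Ω : Set (E N)), W.2 i x * φ x := by
      rw [← integral_add (integrable_mul_testFunction (U.2 i) φ)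
        (integrable_mul_testFunction (W.2 i) φ)]
      refine integral_congr_ae ?_
      filter_upwards [Lp.coeFn_add (U.2 i) (W.2 i)] with x hx
      rw [hx, Pi.add_apply, add_mul]
    simp only [Prod.fst_add, Prod.snd_add, Pi.add_apply]
    rw [h1, h2, hU φ i, hW φ i, neg_add]
  smul_mem' := by
    intro c U hU φ i
    have h : ∀ (u : L2 Ω) (f : E N → ℝ), ∫ x in (Ω : Set (E N)), (c • u) x * f x =
        c * ∫ x in (Ω : Set (E N)), u x * f x := by
      intro u f
      rw [← integral_const_mul]
      refine integral_congr_ae ?_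
      filter_upwards [Lp.coeFn_smul c u] with x hx
      rw [hx, Pi.smul_apply, smul_eq_mul, mul_assoc]
    simp only [Prod.smul_fst, Prod.smul_snd, Pi.smul_apply]
    rw [h, h, hU φ i, mul_neg]

/-- The space of all pairs `(φ, ∇φ)` with `φ ∈ C_c^∞(Ω)`. -/
def testPairs {N : ℕ} (Ω : Opens (E N)) : Submodule ℝ (GradPair Ω) where
  carrier := {U | ∃ φ : 𝓓(Ω, ℝ),
    U.1 =ᵐ[volume.restrict (Ω : Set (E N))] φ ∧
      ∀ i, U.2 i =ᵐ[volume.restrict (Ω : Set (E N))] partialD i φ}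
  zero_mem' := by
    refine ⟨0, ?_, fun i => ?_⟩
    · filter_upwards [Lp.coeFn_zero ℝ 2 ((volume : Measure (E N)).restrict (Ω : Set (E N)))]
        with x hx
      exact hx
    · filter_upwards [Lp.coeFn_zero ℝ 2 ((volume : Measure (E N)).restrict (Ω : Set (E N)))]
        with x hx
      have h : partialD i (⇑(0 : 𝓓(Ω, ℝ))) x = 0 := by
        have := partialD_smul i 0 (0 : 𝓓(Ω, ℝ)) x
        rwa [zero_smul, zero_mul] at this
      rw [h]
      exact hx
  add_mem' := by
    rintro U W ⟨φ, h1, h2⟩ ⟨ψ, h3, h4⟩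
    refine ⟨φ + ψ, ?_, fun i => ?_⟩
    · filter_upwards [Lp.coeFn_add U.1 W.1, h1, h3] with x hx h1 h3
      rw [FunLike.coe_add, Pi.add_apply, ← h1, ← h3]
      exact hx
    · filter_upwards [Lp.coeFn_add (U.2 i) (W.2 i), h2 i, h4 i] with x hx h2 h4
      rw [partialD_add, ← h2, ← h4]
      exact hx
  smul_mem' := by
    rintro c U ⟨φ, h1, h2⟩
    refine ⟨c • φ, ?_, fun i => ?_⟩
    · filter_upwards [Lp.coeFn_smul c U.1, h1] with x hx h1
      rw [FunLike.coe_smul, Pi.smul_apply, ← h1]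
      exact hx
    · filter_upwards [Lp.coeFn_smul c (U.2 i), h2 i] with x hx h2
      rw [partialD_smul, ← h2]
      exact hx

/-- `H¹₀(Ω)`: the closure of `C_c^∞(Ω)` in `H¹(Ω)`. -/
def H10 {N : ℕ} (Ω : Opens (E N)) : Submodule ℝ (GradPair Ω) :=
  H1 Ω ⊓ (testPairs Ω).topologicalClosure

/-! ## The Reissner-Mindlin eigenvalue problem -/

/-- Pairs `(β, w)`, where `β = (β_1, …, β_N)` and each of `β_1, …, β_N, w` comes with a gradient. -/
abbrev State {N : ℕ} (Ω : Opens (E N)) : Type := (Fin N → GradPair Ω) × GradPair Ω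

/-- The energy space `𝒱(Ω) = H¹₀(Ω)^N × H¹₀(Ω)`. -/
def energySpace {N : ℕ} (Ω : Opens (E N)) : Submodule ℝ (State Ω) :=
  (Submodule.pi univ fun _ => H10 Ω).prod (H10 Ω)

section Forms

variable {N : ℕ} {Ω : Opens (E N)}

/-- The component `β_i`. -/
def rot (U : State Ω) (i : Fin N) : L2 Ω := (U.1 i).1

/-- The derivative `∂β_i/∂x_j`. -/
def dRot (U : State Ω) (i j : Fin N) : L2 Ω := (U.1 i).2 j

/-- The component `w`. -/
def defl (U : State Ω) : L2 Ω := U.2.1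

/-- The derivative `∂w/∂x_i`. -/
def dDefl (U : State Ω) (i : Fin N) : L2 Ω := U.2.2 i

/-- The divergence of `β`. -/
def divRot (U : State Ω) : L2 Ω := ∑ i, dRot U i i

/-- The bilinear form `Q_{Ω,t}`, that is
`μ/12 ∫ ∇β : ∇η + (μ+λ)/12 ∫ div β div η + μk/t² ∫ (∇w - β) · (∇v - η)`,
where `inner ℝ f g = ∫_Ω f g dx` is the scalar product of `L²(Ω)`. -/
def formQ (lam mu k t : ℝ) (U Z : State Ω) : ℝ :=
  mu / 12 * ∑ i, ∑ j, inner ℝ (dRot U i j) (dRot Z i j)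
    + (mu + lam) / 12 * inner ℝ (divRot U) (divRot Z)
    + mu * k / t ^ 2 * ∑ i, inner ℝ (dDefl U i - rot U i) (dDefl Z i - rot Z i)

/-- The scalar product of `ℒ²_t(Ω)`, that is `∫ (w v + t²/12 β · η)`. -/
def formM (t : ℝ) (U Z : State Ω) : ℝ :=
  inner ℝ (defl U) (defl Z) + t ^ 2 / 12 * ∑ i, inner ℝ (rot U i) (rot Z i)

theorem formQ_add (lam mu k t : ℝ) (U U' Z : State Ω) :
    formQ lam mu k t (U + U') Z = formQ lam mu k t U Z + formQ lam mu k t U' Z := by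
  simp only [formQ, divRot, dRot, dDefl, rot, Prod.fst_add, Prod.snd_add, Pi.add_apply,
    add_sub_add_comm, inner_add_left, Finset.sum_add_distrib]
  ring

theorem formQ_smul (lam mu k t c : ℝ) (U Z : State Ω) :
    formQ lam mu k t (c • U) Z = c * formQ lam mu k t U Z := by
  simp only [formQ, divRot, dRot, dDefl, rot, Prod.smul_fst, Prod.smul_snd, Pi.smul_apply,
    ← smul_sub, ← Finset.smul_sum, real_inner_smul_left, ← Finset.mul_sum]
  ring

theorem formM_add (t : ℝ) (U U' Z : State Ω) :
    formM t (U + U') Z = formM t U Z + formM t U' Z := by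
  simp only [formM, defl, rot, Prod.fst_add, Prod.snd_add, Pi.add_apply, inner_add_left,
    Finset.sum_add_distrib]
  ring

theorem formM_smul (t c : ℝ) (U Z : State Ω) :
    formM t (c • U) Z = c * formM t U Z := by
  simp only [formM, defl, rot, Prod.smul_fst, Prod.smul_snd, Pi.smul_apply,
    real_inner_smul_left, ← Finset.mul_sum]
  ring

end Forms

/-- The space of all `(β, w) ∈ 𝒱(Ω)` solving the weak Reissner-Mindlin problem
`Q_{Ω,t}((β, w), (η, v)) = γ ⟨(β, w), (η, v)⟩_{Ω,t}` for all `(η, v) ∈ 𝒱(Ω)`; it is nonzero if and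
only if `γ` is an eigenvalue. -/
def eigenspace (lam mu k t : ℝ) {N : ℕ} (Ω : Opens (E N)) (γ : ℝ) : Submodule ℝ (State Ω) where
  carrier := {U | U ∈ energySpace Ω ∧
    ∀ Z ∈ energySpace Ω, formQ lam mu k t U Z = γ * formM t U Z}
  zero_mem' := by
    refine ⟨Submodule.zero_mem _, fun Z _ => ?_⟩
    rw [← zero_smul ℝ (0 : State Ω), formQ_smul, formM_smul]
    ring
  add_mem' := by
    rintro U W ⟨hU, hU'⟩ ⟨hW, hW'⟩
    refine ⟨Submodule.add_mem _ hU hW, fun Z hZ => ?_⟩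
    rw [formQ_add, formM_add, hU' Z hZ, hW' Z hZ, mul_add]
  smul_mem' := by
    rintro c U ⟨hU, hU'⟩
    refine ⟨Submodule.smul_mem _ c hU, fun Z hZ => ?_⟩
    rw [formQ_smul, formM_smul, hU' Z hZ]
    ring

/-- The eigenvalue `γ_{n,t}[Ω]`, `n = 1, 2, …`: the `n`-th eigenvalue in nondecreasing order,
each eigenvalue being repeated as many times as its multiplicity. It is the least `γ` such that
the eigenvalues `γ' ≤ γ` have total multiplicity at least `n`. -/
def eigenvalue (lam mu k t : ℝ) {N : ℕ} (Ω : Opens (E N)) (n : ℕ) : ℝ :=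
  sInf {γ : ℝ | (n : Cardinal) ≤
    Module.rank ℝ ↥(⨆ (γ' : ℝ) (_ : γ' ≤ γ), eigenspace lam mu k t Ω γ')}

/-! ## Neighbourhoods, atlases and atlas classes in `ℝ^N`, `N = d + 1` -/

/-- The inner neighbourhood `V_δ = {x ∈ V : d(x, ∂V) > δ}`, where `d(x, ∅) = ∞`. The outer
neighbourhood `V^δ = {x : d(x, V) < δ}` is `Metric.thickening δ V`. -/
def innerNhd {N : ℕ} (δ : ℝ) (V : Set (E N)) : Set (E N) :=
  {x ∈ V | ENNReal.ofReal δ < Metric.infEDist x (frontier V)}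

/-- The open box `∏ ]a_i, b_i[`. -/
def openBox {N : ℕ} (a b : Fin N → ℝ) : Set (E N) := {x | ∀ i, a i < x i ∧ x i < b i}

/-- A bounded open cuboid: an isometric image of a box `∏ ]a_i, b_i[`. -/
def IsCuboid {N : ℕ} (V : Set (E N)) : Prop :=
  ∃ (e : E N ≃ᵢ E N) (a b : Fin N → ℝ), (∀ i, a i < b i) ∧ V = e '' openBox a b

/-- `x̄ = (x_1, …, x_{N-1})`. -/
def xbar {d : ℕ} (x : E (d + 1)) : E d := WithLp.toLp 2 fun i => x i.castSucc

/-- An atlas `(ρ, s, s', {V_j}, {r_j})` in `ℝ^(d+1)`. The indices `1, …, s` are `0, …, s - 1`. -/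
structure Atlas (d : ℕ) where
  ρ : ℝ
  s : ℕ
  s' : ℕ
  V : Fin s → Set (E (d + 1))
  r : Fin s → E (d + 1) ≃ᵢ E (d + 1)
  ρ_pos : 0 < ρ
  s'_le : s' ≤ s
  cuboid : ∀ j, IsCuboid (V j)

/-- The open set `Ω` satisfies the conditions (i), (ii), (iii) of the atlas class, where `a j`, `b j`
are the corners of the box `r_j(V_j)` and the boundary of `Ω` in `V_j` is described by the
function `g j` on the closure of the box `W_j`. -/
structure Atlas.Describes {d : ℕ} (A : Atlas d) (Ω : Opens (E (d + 1)))
    (a b : Fin A.s → Fin (d + 1) → ℝ) (g : Fin A.s → E d → ℝ) : Prop where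
  subset_iUnion : (Ω : Set (E (d + 1))) ⊆ ⋃ j, innerNhd A.ρ (A.V j)
  inner_inter_nonempty : ∀ j, (innerNhd A.ρ (A.V j) ∩ (Ω : Set (E (d + 1)))).Nonempty
  frontier_inter_nonempty : ∀ j, j.val < A.s' →
    (A.V j ∩ frontier (Ω : Set (E (d + 1)))).Nonempty
  frontier_inter_empty : ∀ j, A.s' ≤ j.val → A.V j ∩ frontier (Ω : Set (E (d + 1))) = ∅
  image_V : ∀ j, A.r j '' A.V j = openBox (a j) (b j)
  image_inter : ∀ j, A.r j '' ((Ω : Set (E (d + 1))) ∩ A.V j) =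
    {x | (a j (Fin.last d) < x (Fin.last d) ∧ x (Fin.last d) < g j (xbar x)) ∧
      xbar x ∈ openBox (fun i : Fin d => a j i.castSucc) (fun i : Fin d => b j i.castSucc)}
  continuousOn : ∀ j, ContinuousOn (g j)
    (closure (openBox (fun i : Fin d => a j i.castSucc) (fun i : Fin d => b j i.castSucc)))
  eq_of_le : ∀ j, A.s' ≤ j.val →
    ∀ y ∈ closure (openBox (fun i : Fin d => a j i.castSucc) (fun i : Fin d => b j i.castSucc)),
      g j y = b j (Fin.last d)
  bounds : ∀ j, j.val < A.s' →
    ∀ y ∈ closure (openBox (fun i : Fin d => a j i.castSucc) (fun i : Fin d => b j i.castSucc)),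
      a j (Fin.last d) + A.ρ ≤ g j y ∧ g j y ≤ b j (Fin.last d) - A.ρ

/-- A modulus of continuity `ω : [0, ∞[ → [0, ∞[` (only the values on `[0, ∞[` matter). -/
structure IsModulus (ω : ℝ → ℝ) : Prop where
  continuousOn : ContinuousOn ω (Ici 0)
  monotoneOn : MonotoneOn ω (Ici 0)
  map_zero : ω 0 = 0
  linear_le : ∃ κ > 0, ∀ τ ∈ Icc (0 : ℝ) 1, κ * τ ≤ ω τ

/-- The class `C_M^ω(𝒜)`: open sets of class `C(𝒜)` all of whose boundary functions satisfy
`|g_j(x̄) - g_j(ȳ)| ≤ M ω(|x̄ - ȳ|)`. -/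
def Atlas.omegaClass {d : ℕ} (A : Atlas d) (ω : ℝ → ℝ) (M : ℝ) : Set (Opens (E (d + 1))) :=
  {Ω | ∃ (a b : Fin A.s → Fin (d + 1) → ℝ) (g : Fin A.s → E d → ℝ), A.Describes Ω a b g ∧
    ∀ j,
      ∀ x ∈ closure (openBox (fun i : Fin d => a j i.castSucc) (fun i : Fin d => b j i.castSucc)),
      ∀ y ∈ closure (openBox (fun i : Fin d => a j i.castSucc) (fun i : Fin d => b j i.castSucc)),
        |g j x - g j y| ≤ M * ω (dist x y)}

end ReissnerMindlin

end

/-!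
The eigenvalues are compared by transplanting trial functions from one open set to the other.

**The vector field.** In every chart `V_j` of the atlas there is a unit vector pointing out of the
sets of the class, the preimage `e_j` of the last coordinate vector. Gluing these vectors by
smooth cut-off functions gives one smooth compactly supported field `X = ∑ ψ_j e_j` depending on
the atlas only. If `x ∈ Ω`, `|v| ≤ ε` and `h ≥ M ω(ε) + ε`, with `ε` and `h` small, then moving
from `x` by `v` and then by `-h X` does not leave `Ω`: in a chart where the cut-off equals `1`,
the boundary drops by at most `M ω(ε)` under the displacement `v`, and the moves along the other
`-e_j` go downwards in their own charts (`Atlas.exists_field`). Since `ε ≤ ω(ε) / κ` for `ε ≤ 1`,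
one may take `h = (M + 1/κ) ω(ε)`, and then the perturbation of the identity `Ψ(z) = z + h X(z)`
satisfies `Ψ⁻¹(Ω₁) ⊆ Ω₂` and `Ψ⁻¹(Ω₂) ⊆ Ω₁`.

**Transplantation.** A test state `(β, w)` on `Ω₁` is sent to `((DΨ)ᵀ (β ∘ Ψ), w ∘ Ψ)` on `Ω₂`.
Pulling `β` back as a covector field makes `∇w - β` transform into `(DΨ)ᵀ ((∇w - β) ∘ Ψ)`, so that
the term with the factor `k / t²` is multiplied by `1 + O(h)` with no additional terms; this is
why the constant does not depend on `k` and `t`. The derivatives of `β` produce errors that are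
controlled by `∇β` and, through the Poincaré inequality, by the energy. The change of variables
needs no Jacobian: `Ψ` and its inverse are Lipschitz with constants `1 + O(h)`, which controls
Lebesgue measure as a multiple of Hausdorff measure. Hence `Q` grows by at most a factor `1 +
O(h)` and `M` shrinks by at most a factor `1 - O(h)` (`exists_form_pullBack_bounds`); both
inequalities extend to the energy spaces by density (`hasTrialSpace_of_graph`).

**The min-max principle.** The eigenvalue is defined by counting multiplicities of eigenspaces, so
the Rayleigh quotients have to be related to it. The form `Q` is coercive on the energy space,
which makes it a Hilbert space, and its embedding in `ℒ²_t` is compact: up to the finitely many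
averages over the cells of a fine grid, the `L²`-norm of an `H¹₀`-function on a bounded set is a
small multiple of the norm of its gradient (`exists_functionals_norm_fst_sq_le`). The spectral
theory of compact self-adjoint operators then shows that an `n`-dimensional space on which `Q ≤ γ
M` forces at least `n` eigenvalues below any `γ' > γ` (`natCast_le_rank_iSup_eigenspace`); the
converse is elementary. Combined with the transplantation this gives `γ_n[Ω₂] ≤ (1 + O(ω(ε)))
γ_n[Ω₁]` and the same with the sets exchanged.
-/

noncomputable section

namespace ReissnerMindlin

/-! ### Rayleigh quotients and eigenvalues of a compact embedding -/

section Spectral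

open Module ContinuousLinearMap
open scoped InnerProduct

variable {H P : Type*} [NormedAddCommGroup H] [InnerProductSpace ℝ H] [CompleteSpace H]
  [NormedAddCommGroup P] [InnerProductSpace ℝ P] [CompleteSpace P]

/-- A bounded operator on a Hilbert space is compact if, up to finitely many functionals, its norm
is arbitrarily small. -/
theorem isCompactOperator_of_forall_functionals {κ : Type*} (J : H →L[ℝ] P)
    (hJ : ∀ δ > 0, ∃ (s : Finset κ) (l : κ → H →L[ℝ] ℝ), ∀ u,
      ‖J u‖ ^ 2 ≤ δ ^ 2 * ‖u‖ ^ 2 + ∑ i ∈ s, (l i u) ^ 2) : IsCompactOperator J := by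
  have hcl : IsClosed {f : H →L[ℝ] P | IsCompactOperator f} := isClosed_setOfPred_isCompactOperator
  have hmem : J ∈ closure {f : H →L[ℝ] P | IsCompactOperator f} := by
    rw [Metric.mem_closure_iff]
    intro δ hδ
    obtain ⟨s, l, hl⟩ := hJ (δ / 2) (by positivity)
    let W : Submodule ℝ H :=
      Submodule.span ℝ ((fun i => (InnerProductSpace.toDual ℝ H).symm (l i)) '' s)
    have : FiniteDimensional ℝ W :=
      FiniteDimensional.span_of_finite ℝ (s.finite_toSet.image _)
    let Pr : H →L[ℝ] H := W.subtypeL.comp W.orthogonalProjectionOnto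
    have hPr : IsCompactOperator (J.comp Pr) := by
      have h1 : IsCompactOperator (W.orthogonalProjectionOnto : H →L[ℝ] W) :=
        isCompactOperator_of_locallyCompactSpace_dom _
      exact h1.clm_comp (J.comp W.subtypeL)
    -- `J ∘ Pr` has finite rank, and all functionals vanish on `u - Pr u`.
    refine ⟨J.comp Pr, hPr, ?_⟩
    rw [dist_eq_norm]
    refine lt_of_le_of_lt (ContinuousLinearMap.opNorm_le_bound _ (M := δ / 2) (by positivity)
      fun u => ?_) (half_lt_self hδ)
    have hu : u - Pr u ∈ Wᗮ := W.sub_starProjection_mem_orthogonal u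
    have hl0 : ∀ i ∈ s, l i (u - Pr u) ^ 2 = 0 := by
      intro i hi
      rw [sq_eq_zero_iff]
      have := hu _ (Submodule.subset_span (mem_image_of_mem _ hi))
      rwa [InnerProductSpace.toDual_symm_apply] at this
    have h2 := hl (u - Pr u)
    rw [Finset.sum_eq_zero hl0] at h2
    have h3 : ‖u - Pr u‖ ≤ ‖u‖ := by
      have h4 := norm_sub_sq_real u (Pr u)
      have h5 : inner ℝ u (Pr u) = ‖Pr u‖ ^ 2 := by
        have h6 : inner ℝ (Pr u) (u - Pr u) = (0 : ℝ) :=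
          hu (Pr u) (W.orthogonalProjectionOnto u).2
        rw [inner_sub_right, real_inner_self_eq_norm_sq, real_inner_comm] at h6
        linarith
      rw [h5] at h4
      refine le_of_sq_le_sq ?_ (norm_nonneg _)
      nlinarith [sq_nonneg ‖Pr u‖]
    have h7 : (J - J.comp Pr) u = J (u - Pr u) := by simp
    rw [h7]
    refine le_of_sq_le_sq ?_ (by positivity)
    have h8 : ‖u - Pr u‖ ^ 2 ≤ ‖u‖ ^ 2 := by gcongr
    have h9 : (δ / 2) ^ 2 * ‖u - Pr u‖ ^ 2 ≤ (δ / 2) ^ 2 * ‖u‖ ^ 2 := by gcongr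
    rw [mul_pow]
    linarith
  rwa [hcl.closure_eq] at hmem

/-- The solutions `u` of `⟨u, v⟩ = γ ⟨J u, J v⟩` for all `v`, in the form `u = γ J* J u`. -/
def embEigenspace (J : H →L[ℝ] P) (γ : ℝ) : Submodule ℝ H :=
  LinearMap.ker (LinearMap.id - γ • (J.adjoint ∘L J : H →L[ℝ] H).toLinearMap)

theorem mem_embEigenspace {J : H →L[ℝ] P} {γ : ℝ} {u : H} :
    u ∈ embEigenspace J γ ↔ ∀ v, inner ℝ u v = γ * inner ℝ (J u) (J v) := by
  have h1 : u ∈ embEigenspace J γ ↔ u - γ • J.adjoint (J u) = 0 := Iff.rfl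
  rw [h1]
  constructor
  · intro h v
    rw [sub_eq_zero] at h
    nth_rewrite 1 [h]
    rw [real_inner_smul_left, adjoint_inner_left]
  · intro h
    refine ext_inner_right ℝ fun v => ?_
    rw [inner_sub_left, h, real_inner_smul_left, adjoint_inner_left, inner_zero_left, sub_self]

/-- On the orthogonal complement of the eigenspaces with eigenvalue at most `γ`, the Rayleigh
quotient `‖u‖² / ‖J u‖²` is at least `γ`. -/
theorem mul_norm_sq_le_of_mem_orthogonal {J : H →L[ℝ] P} (hJ : IsCompactOperator J) {γ : ℝ}
    (hγ : 0 < γ) {u : H} (hu : u ∈ (⨆ (μ : ℝ) (_ : μ ≤ γ), embEigenspace J μ)ᗮ) :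
    γ * ‖J u‖ ^ 2 ≤ ‖u‖ ^ 2 := by
  set F : Submodule ℝ H := ⨆ (μ : ℝ) (_ : μ ≤ γ), embEigenspace J μ with hF
  let B : H →L[ℝ] H := J.adjoint ∘L J
  have hB : IsCompactOperator B := hJ.clm_comp J.adjoint
  have hBin : ∀ x y, inner ℝ (B x) y = (inner ℝ (J x) (J y) : ℝ) := fun x y =>
    adjoint_inner_left J y (J x)
  have hBsymm : B.IsSymmetric := by
    intro x y
    have h1 := hBin x y
    have h2 := hBin y x
    change inner ℝ (B x) y = inner ℝ x (B y)
    rw [h1, real_inner_comm (B y), h2, real_inner_comm]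
  have hinv : ∀ x ∈ Fᗮ, B x ∈ Fᗮ := by
    intro x hx
    have hFx : F ≤ (ℝ ∙ B x)ᗮ := by
      refine iSup₂_le fun μ hμ y hy => ?_
      rw [Submodule.mem_orthogonal_singleton_iff_inner_right, hBin]
      rcases eq_or_ne μ 0 with rfl | h0
      · have : y = 0 := by
          have := mem_embEigenspace.1 hy y
          rwa [zero_mul, inner_self_eq_zero] at this
        rw [this, map_zero, inner_zero_right]
      · have h1 := mem_embEigenspace.1 hy x
        have h2 : inner ℝ y x = (0 : ℝ) :=
          hx y ((le_iSup₂_of_le μ hμ le_rfl : embEigenspace J μ ≤ F) hy)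
        rw [h2, zero_eq_mul, or_iff_right h0] at h1
        rw [real_inner_comm, h1]
    intro y hy
    have := hFx hy
    rwa [Submodule.mem_orthogonal_singleton_iff_inner_right, real_inner_comm] at this
  -- The norm of the self-adjoint operator `S` is its spectral radius, and an eigenvalue `θ > γ⁻¹`
  -- would give an eigenvector in `F`.
  let S : Fᗮ →L[ℝ] Fᗮ := B.restrict hinv
  have hSc : IsCompactOperator S := hB.restrict' hinv
  have hSs : S.IsSymmetric := hBsymm.restrict_invariant hinv
  have hSn : ‖S‖ ≤ γ⁻¹ := by
    have hrad : spectralRadius ℝ S ≤ ENNReal.ofReal γ⁻¹ := by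
      refine iSup₂_le fun θ hθ => ?_
      rcases eq_or_ne θ 0 with rfl | h0
      · simp
      have hev := (hSc.hasEigenvalue_iff_mem_spectrum h0).2 hθ
      obtain ⟨x, hx⟩ := hev.exists_hasEigenvector
      have hx0 : (x : H) ≠ 0 := fun h => hx.2 (Subtype.ext h)
      have hBx : B x = θ • (x : H) := congrArg Subtype.val hx.apply_eq_smul
      have hpos : 0 < ‖(x : H)‖ ^ 2 := by have := norm_pos_iff.2 hx0; positivity
      have h1 : θ * ‖(x : H)‖ ^ 2 = ‖J x‖ ^ 2 := by
        have := hBin x x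
        rwa [hBx, real_inner_smul_left, real_inner_self_eq_norm_sq,
          real_inner_self_eq_norm_sq] at this
      have hθ0 : 0 < θ := by
        refine lt_of_le_of_ne ?_ h0.symm
        by_contra! hneg
        nlinarith [sq_nonneg ‖J x‖]
      have hle : θ ≤ γ⁻¹ := by
        by_contra! hlt
        refine hx0 ?_
        have hθγ : θ⁻¹ ≤ γ := (inv_lt_of_inv_lt₀ hγ hlt).le
        have hxE : (x : H) ∈ embEigenspace J θ⁻¹ := by
          rw [mem_embEigenspace]
          intro v
          rw [← hBin, hBx, real_inner_smul_left]
          field_simp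
        have hxF : (x : H) ∈ F := (le_iSup₂_of_le θ⁻¹ hθγ le_rfl : embEigenspace J θ⁻¹ ≤ F) hxE
        exact inner_self_eq_zero.1 (x.2 x hxF)
      rw [← enorm_eq_nnnorm, Real.enorm_of_nonneg hθ0.le]
      exact ENNReal.ofReal_le_ofReal hle
    rw [S.spectralRadius_eq_nnnorm hSs.isSelfAdjoint] at hrad
    rw [← enorm_eq_nnnorm, ← ofReal_norm] at hrad
    exact (ENNReal.ofReal_le_ofReal_iff (by positivity)).1 hrad
  have h1 : ‖J u‖ ^ 2 = inner ℝ (B u) u := by rw [hBin, real_inner_self_eq_norm_sq]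
  have h2 : ‖B u‖ ≤ γ⁻¹ * ‖u‖ := by
    have h3 := S.le_opNorm ⟨u, hu⟩
    have h4 : ‖S ⟨u, hu⟩‖ = ‖B u‖ := rfl
    have h5 : ‖(⟨u, hu⟩ : Fᗮ)‖ = ‖u‖ := rfl
    rw [h4, h5] at h3
    exact h3.trans (by gcongr)
  have h6 : ‖J u‖ ^ 2 ≤ γ⁻¹ * ‖u‖ * ‖u‖ := by
    rw [h1]
    exact (real_inner_le_norm _ _).trans (by gcongr)
  calc γ * ‖J u‖ ^ 2 ≤ γ * (γ⁻¹ * ‖u‖ * ‖u‖) := by gcongr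
    _ = ‖u‖ ^ 2 := by field_simp

/-- The min-max inequality: if the Rayleigh quotient is at most `γ` on an `n`-dimensional space,
then at least `n` eigenvalues are at most `γ'`, for every `γ' > γ`. -/
theorem natCast_le_rank_iSup_embEigenspace {J : H →L[ℝ] P} (hJ : IsCompactOperator J) {n : ℕ}
    (L : (Fin n → ℝ) →ₗ[ℝ] H) (hL : Function.Injective L) {γ γ' : ℝ} (hγ : γ < γ')
    (h : ∀ c, ‖L c‖ ^ 2 ≤ γ * ‖J (L c)‖ ^ 2) :
    (n : Cardinal) ≤ Module.rank ℝ ↥(⨆ (μ : ℝ) (_ : μ ≤ γ'), embEigenspace J μ) := by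
  by_contra! hlt
  set F : Submodule ℝ H := ⨆ (μ : ℝ) (_ : μ ≤ γ'), embEigenspace J μ with hF
  have : FiniteDimensional ℝ F :=
    Module.rank_lt_aleph0_iff.1 (hlt.trans (Cardinal.natCast_lt_aleph0))
  have hfr : finrank ℝ F < finrank ℝ (Fin n → ℝ) := by
    rw [Module.finrank_fin_fun]
    rw [← Module.finrank_eq_rank] at hlt
    exact_mod_cast hlt
  -- For dimensional reasons some `L c ≠ 0` is orthogonal to `F`.
  have hker := LinearMap.ker_ne_bot_of_finrank_lt
    (f := F.orthogonalProjectionOnto.toLinearMap ∘ₗ L) hfr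
  obtain ⟨c, hc, hc0⟩ := Submodule.exists_mem_ne_zero_of_ne_bot hker
  have hcF : L c ∈ Fᗮ := by
    rw [← F.ker_orthogonalProjectionOnto]
    exact hc
  have hLc : 0 < ‖L c‖ := norm_pos_iff.2 fun h0 => hc0 (hL (h0.trans (map_zero L).symm))
  have h1 := h c
  have hJ0 : 0 ≤ ‖J (L c)‖ ^ 2 := by positivity
  have hLc2 : 0 < ‖L c‖ ^ 2 := by positivity
  have hγ0 : 0 < γ := by
    by_contra! hneg
    nlinarith
  have h2 := mul_norm_sq_le_of_mem_orthogonal hJ (hγ0.trans hγ) hcF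
  nlinarith

end Spectral

/-- On a sum of eigenspaces of the pencil `(Q, M)` with eigenvalues at most `γ`, the Rayleigh
quotient `Q / M` is at most `γ`: eigenvectors of different eigenvalues are orthogonal. -/
theorem form_le_of_mem_iSup {X : Type*} [AddCommGroup X] [Module ℝ X]
    (Q M : X →ₗ[ℝ] X →ₗ[ℝ] ℝ) (hQ : ∀ u v, Q u v = Q v u) (hM : ∀ u v, M u v = M v u)
    (hM0 : ∀ u, 0 ≤ M u u) (V : Submodule ℝ X) (Eig : ℝ → Submodule ℝ X)
    (hEig : ∀ μ, ∀ u ∈ Eig μ, u ∈ V ∧ ∀ z ∈ V, Q u z = μ * M u z) {γ : ℝ} {u : X}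
    (hu : u ∈ ⨆ (μ : ℝ) (_ : μ ≤ γ), Eig μ) : u ∈ V ∧ Q u u ≤ γ * M u u := by
  rw [iSup_subtype', Submodule.mem_iSup_iff_exists_finsupp] at hu
  obtain ⟨f, hf, rfl⟩ := hu
  have hV : ∀ i, f i ∈ V := fun i => (hEig _ _ (hf i)).1
  have horth : ∀ i j, i ≠ j → M (f i) (f j) = 0 := by
    intro i j hij
    have h1 := (hEig _ _ (hf i)).2 _ (hV j)
    have h2 := (hEig _ _ (hf j)).2 _ (hV i)
    rw [hQ, h2, hM] at h1
    have h3 : ((j : ℝ) - i) * M (f i) (f j) = 0 := by linarith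
    rcases mul_eq_zero.1 h3 with h | h
    · exact absurd (Subtype.ext (sub_eq_zero.1 h)).symm hij
    · exact h
  have hsum : ∀ i ∈ f.support, ∑ j ∈ f.support, M (f i) (f j) = M (f i) (f i) := fun i hi =>
    Finset.sum_eq_single i (fun j _ hj => horth i j hj.symm) (fun h => absurd hi h)
  refine ⟨Submodule.sum_mem _ fun i _ => hV i, ?_⟩
  rw [Finsupp.sum]
  simp only [map_sum, LinearMap.sum_apply]
  rw [Finset.sum_comm, Finset.sum_comm (f := fun i j => M (f j) (f i)), Finset.mul_sum]
  refine Finset.sum_le_sum fun i hi => ?_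
  rw [hsum i hi, Finset.sum_congr rfl fun j _ => (hEig _ _ (hf i)).2 _ (hV j), ← Finset.mul_sum,
    hsum i hi]
  exact mul_le_mul_of_nonneg_right i.2 (hM0 _)

/-! ### Calculus of compactly supported functions -/

section Calculus

variable {N : ℕ} {f g : E N → ℝ}

theorem continuous_partialD (hf : ContDiff ℝ 1 f) (i : Fin N) : Continuous (partialD i f) :=
  (hf.continuous_fderiv one_ne_zero).clm_apply continuous_const

theorem hasCompactSupport_partialD (hf : HasCompactSupport f) (i : Fin N) :
    HasCompactSupport (partialD i f) :=
  hf.fderiv_apply ℝ (EuclideanSpace.single i 1)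

theorem contDiff_partialD {n m : WithTop ℕ∞} (hf : ContDiff ℝ n f) (hmn : m + 1 ≤ n) (i : Fin N) :
    ContDiff ℝ m (partialD i f) :=
  (hf.fderiv_right hmn).clm_apply contDiff_const

theorem partialD_eq_zero_of_notMem_tsupport {x : E N} (hx : x ∉ tsupport f) (i : Fin N) :
    partialD i f x = 0 := by
  rw [partialD, fderiv_of_notMem_tsupport ℝ hx]
  rfl

theorem fderiv_apply_eq_sum_partialD (x v : E N) :
    fderiv ℝ f x v = ∑ i, v i * partialD i f x := by
  have hv : v = ∑ i, v i • EuclideanSpace.single i (1 : ℝ) := by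
    ext j
    simp [Finset.sum_apply, Pi.single_apply]
  conv_lhs => rw [hv]
  rw [map_sum]
  simp only [map_smul, smul_eq_mul, partialD]

theorem sq_fderiv_apply_le (x v : E N) :
    (fderiv ℝ f x v) ^ 2 ≤ ‖v‖ ^ 2 * ∑ i, (partialD i f x) ^ 2 := by
  rw [fderiv_apply_eq_sum_partialD, EuclideanSpace.real_norm_sq_eq]
  exact Finset.sum_mul_sq_le_sq_mul_sq _ _ _

theorem partialD_mul (hf : ContDiff ℝ 1 f) (hg : ContDiff ℝ 1 g) (i : Fin N) (x : E N) :
    partialD i (fun y => f y * g y) x = partialD i f x * g x + f x * partialD i g x := by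
  have h1 : DifferentiableAt ℝ f x := hf.differentiable one_ne_zero x
  have h2 : DifferentiableAt ℝ g x := hg.differentiable one_ne_zero x
  simp only [partialD]
  rw [fderiv_fun_mul h1 h2]
  simp only [add_apply, smul_apply, smul_eq_mul]
  ring

theorem integral_mul_partialD_eq_neg (hf : ContDiff ℝ 1 f) (hg : ContDiff ℝ 1 g)
    (hgs : HasCompactSupport g) (i : Fin N) :
    ∫ x, f x * partialD i g x = -∫ x, partialD i f x * g x := by
  refine integral_mul_fderiv_eq_neg_fderiv_mul_of_integrable ?_ ?_ ?_
    (fun x _ => hf.differentiable one_ne_zero x) (fun x _ => hg.differentiable one_ne_zero x)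
  · exact ((continuous_partialD hf i).mul hg.continuous).integrable_of_hasCompactSupport
      (hgs.mul_left)
  · exact (hf.continuous.mul (continuous_partialD hg i)).integrable_of_hasCompactSupport
      (hasCompactSupport_partialD hgs i).mul_left
  · exact (hf.continuous.mul hg.continuous).integrable_of_hasCompactSupport hgs.mul_left

theorem integrable_mul_of_hasCompactSupport (hf : Continuous f) (hg : Continuous g)
    (hgs : HasCompactSupport g) : Integrable (fun x => f x * g x) :=
  (hf.mul hg).integrable_of_hasCompactSupport hgs.mul_left

theorem integrable_sq_of_hasCompactSupport (hf : Continuous f) (hfs : HasCompactSupport f) :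
    Integrable (fun x => f x ^ 2) := by
  simpa only [sq] using integrable_mul_of_hasCompactSupport hf hf hfs

/-- The Poincaré inequality, from `∫ f² = ∫ f² ∂_i x_i = -2 ∫ x_i f ∂_i f`. -/
theorem integral_sq_le_integral_sq_partialD (hf : ContDiff ℝ 1 f) (hfs : HasCompactSupport f)
    {R : ℝ} (i : Fin N) (hR : ∀ x, f x ≠ 0 → |x i| ≤ R) :
    ∫ x, f x ^ 2 ≤ 4 * R ^ 2 * ∫ x, partialD i f x ^ 2 := by
  have hX : ContDiff ℝ 1 (fun x : E N => x i) :=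
    (EuclideanSpace.proj i : E N →L[ℝ] ℝ).contDiff
  have hX1 : ∀ x, partialD i (fun x : E N => x i) x = 1 := by
    intro x
    have h : (fun x : E N => x i) = (EuclideanSpace.proj i : E N →L[ℝ] ℝ) := rfl
    rw [partialD, h, ContinuousLinearMap.fderiv]
    simp
  have hf2 : ContDiff ℝ 1 (fun x => f x * f x) := hf.mul hf
  have hD := continuous_partialD hf i
  have h1 : ∫ x, f x ^ 2 = -∫ x, x i * (2 * f x * partialD i f x) := by
    have h := integral_mul_partialD_eq_neg hX hf2 hfs.mul_left i
    rw [← neg_eq_iff_eq_neg] at h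
    rw [show (fun x => f x ^ 2) = fun x => partialD i (fun x : E N => x i) x * (f x * f x) from
      funext fun x => by rw [hX1]; ring, ← h]
    congr 1
    refine integral_congr_ae (Filter.Eventually.of_forall fun x => ?_)
    simp only
    rw [partialD_mul hf hf]
    ring
  have hi1 := integrable_sq_of_hasCompactSupport hf.continuous hfs
  have hi2 := integrable_sq_of_hasCompactSupport hD (hasCompactSupport_partialD hfs i)
  -- `|2 x_i f ∂_i f| ≤ f² / 2 + 2 R² (∂_i f)²`
  have h2 : ∫ x, f x ^ 2 ≤ ∫ x, ((1 / 2) * f x ^ 2 + 2 * R ^ 2 * partialD i f x ^ 2) := by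
    rw [h1, ← integral_neg]
    refine integral_mono ?_ ((hi1.const_mul _).add (hi2.const_mul _)) fun x => ?_
    · refine Integrable.neg ?_
      refine Continuous.integrable_of_hasCompactSupport ?_ ?_
      · exact hX.continuous.mul ((continuous_const.mul hf.continuous).mul hD)
      · exact ((hasCompactSupport_partialD hfs i).mul_left).mul_left
    · simp only
      by_cases h0 : f x = 0
      · rw [h0]
        have : 0 ≤ 2 * R ^ 2 * partialD i f x ^ 2 := by positivity
        simpa using this
      · have h3 : x i ^ 2 ≤ R ^ 2 := sq_le_sq' (by linarith [neg_abs_le (x i), hR x h0])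
          ((le_abs_self _).trans (hR x h0))
        nlinarith [sq_nonneg (f x + 2 * (x i * partialD i f x)), sq_nonneg (partialD i f x),
          mul_le_mul_of_nonneg_right h3 (sq_nonneg (partialD i f x))]
  rw [integral_add (hi1.const_mul _) (hi2.const_mul _), integral_const_mul,
    integral_const_mul] at h2
  linarith

theorem sq_intervalIntegral_le {φ : ℝ → ℝ} (hφ : Continuous φ) :
    (∫ s in (0 : ℝ)..1, φ s) ^ 2 ≤ ∫ s in (0 : ℝ)..1, φ s ^ 2 := by
  set c := ∫ s in (0 : ℝ)..1, φ s with hc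
  have h1 : 0 ≤ ∫ s in (0 : ℝ)..1, (φ s - c) ^ 2 :=
    intervalIntegral.integral_nonneg zero_le_one fun s _ => sq_nonneg _
  have h2 : ∫ s in (0 : ℝ)..1, (φ s - c) ^ 2 =
      (∫ s in (0 : ℝ)..1, φ s ^ 2) - 2 * c * c + c ^ 2 := by
    have h3 : ∀ s, (φ s - c) ^ 2 = φ s ^ 2 - 2 * c * φ s + c ^ 2 := fun s => by ring
    simp_rw [h3]
    rw [intervalIntegral.integral_add, intervalIntegral.integral_sub,
      intervalIntegral.integral_const_mul, ← hc]
    · simp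
    all_goals exact Continuous.intervalIntegrable (by fun_prop) _ _
  nlinarith

/-- The `L²`-modulus of continuity of `f` is bounded by its gradient. -/
theorem lintegral_sq_sub_translate_le (hf : ContDiff ℝ 1 f) (v : E N) :
    ∫⁻ x, ENNReal.ofReal ((f (x + v) - f x) ^ 2) ≤
      ENNReal.ofReal (‖v‖ ^ 2) * ∫⁻ x, ENNReal.ofReal (∑ i, partialD i f x ^ 2) := by
  set G : E N → ℝ := fun x => ∑ i, partialD i f x ^ 2 with hG
  have hGc : Continuous G := continuous_finsetSum _ fun i _ => (continuous_partialD hf i).pow 2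
  have hG0 : ∀ x, 0 ≤ G x := fun x => Finset.sum_nonneg fun i _ => sq_nonneg _
  have hpt : ∀ x, ENNReal.ofReal ((f (x + v) - f x) ^ 2) ≤
      ∫⁻ s in Ioc (0 : ℝ) 1, ENNReal.ofReal (‖v‖ ^ 2 * G (x + s • v)) := by
    intro x
    have hline : Continuous fun s : ℝ => x + s • v := by fun_prop
    have hder : ∀ s : ℝ, HasDerivAt (fun s : ℝ => f (x + s • v)) (fderiv ℝ f (x + s • v) v) s := by
      intro s
      have h1 : HasDerivAt (fun s : ℝ => x + s • v) v s := by
        simpa using ((hasDerivAt_id s).smul_const v).const_add x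
      exact (hf.differentiable one_ne_zero _).hasFDerivAt.comp_hasDerivAt s h1
    have hcD : Continuous fun s : ℝ => fderiv ℝ f (x + s • v) v :=
      ((hf.continuous_fderiv one_ne_zero).comp hline).clm_apply continuous_const
    have hftc := intervalIntegral.integral_eq_sub_of_hasDerivAt (fun s _ => hder s)
      (hcD.intervalIntegrable 0 1)
    have h2 : (f (x + v) - f x) ^ 2 ≤ ∫ s in (0 : ℝ)..1, ‖v‖ ^ 2 * G (x + s • v) := by
      have h3 : f (x + v) - f x = ∫ s in (0 : ℝ)..1, fderiv ℝ f (x + s • v) v := by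
        rw [hftc]; simp
      rw [h3]
      refine (sq_intervalIntegral_le hcD).trans ?_
      refine intervalIntegral.integral_mono_on zero_le_one ((hcD.pow 2).intervalIntegrable _ _)
        ((continuous_const.mul (hGc.comp hline)).intervalIntegrable _ _) fun s _ => ?_
      exact sq_fderiv_apply_le _ _
    refine (ENNReal.ofReal_le_ofReal h2).trans_eq ?_
    rw [intervalIntegral.integral_of_le zero_le_one]
    refine ofReal_integral_eq_lintegral_ofReal ?_ (Filter.Eventually.of_forall fun s => ?_)
    · exact ((continuous_const.mul (hGc.comp hline)).intervalIntegrable 0 1).1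
    · exact mul_nonneg (sq_nonneg _) (hG0 _)
  calc ∫⁻ x, ENNReal.ofReal ((f (x + v) - f x) ^ 2)
      ≤ ∫⁻ x, ∫⁻ s in Ioc (0 : ℝ) 1, ENNReal.ofReal (‖v‖ ^ 2 * G (x + s • v)) :=
        lintegral_mono hpt
    _ = ∫⁻ s in Ioc (0 : ℝ) 1, ∫⁻ x, ENNReal.ofReal (‖v‖ ^ 2 * G (x + s • v)) := by
        refine lintegral_lintegral_swap ?_
        refine Measurable.aemeasurable ?_
        refine Continuous.measurable ?_
        refine ENNReal.continuous_ofReal.comp ?_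
        change Continuous fun p : E N × ℝ => ‖v‖ ^ 2 * G (p.1 + p.2 • v)
        exact continuous_const.mul (hGc.comp (by fun_prop))
    _ = ∫⁻ _ in Ioc (0 : ℝ) 1, ENNReal.ofReal (‖v‖ ^ 2) * ∫⁻ x, ENNReal.ofReal (G x) := by
        refine lintegral_congr fun s => ?_
        rw [lintegral_add_right_eq_self (fun x => ENNReal.ofReal (‖v‖ ^ 2 * G x)) (s • v)]
        simp_rw [ENNReal.ofReal_mul (sq_nonneg ‖v‖)]
        exact lintegral_const_mul _ (by fun_prop)
    _ = _ := by simp [hG]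

end Calculus

/-! ### Approximation by averages over the cells of a grid -/

section Grid

variable {N : ℕ}

/-- The cell `∏ [h m_i, h (m_i + 1)[` of the grid of mesh `h`. -/
def gridCell (h : ℝ) (m : Fin N → ℤ) : Set (E N) :=
  WithLp.ofLp ⁻¹' univ.pi fun i => Ico (h * m i) (h * (m i + 1))

theorem measurableSet_gridCell (h : ℝ) (m : Fin N → ℤ) : MeasurableSet (gridCell h m) :=
  (PiLp.volume_preserving_ofLp (Fin N)).measurable
    (MeasurableSet.univ_pi fun _ => measurableSet_Ico)

theorem volume_gridCell (h : ℝ) (m : Fin N → ℤ) :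
    volume (gridCell h m) = ENNReal.ofReal h ^ N := by
  rw [gridCell, (PiLp.volume_preserving_ofLp (Fin N)).measure_preimage
    (MeasurableSet.univ_pi fun _ => measurableSet_Ico).nullMeasurableSet, Real.volume_pi_Ico]
  simp [mul_add]

theorem mem_gridCell {h : ℝ} {m : Fin N → ℤ} {x : E N} :
    x ∈ gridCell h m ↔ ∀ i, h * m i ≤ x i ∧ x i < h * (m i + 1) := by
  simp [gridCell, mem_preimage]

theorem mem_gridCell_iff_floor {h : ℝ} (hh : 0 < h) {m : Fin N → ℤ} {x : E N} :
    x ∈ gridCell h m ↔ (fun i => ⌊x i / h⌋) = m := by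
  rw [mem_gridCell, funext_iff]
  refine forall_congr' fun i => ?_
  rw [Int.floor_eq_iff, le_div_iff₀ hh, div_lt_iff₀ hh, mul_comm h, mul_comm h]

theorem pairwise_disjoint_gridCell {h : ℝ} (hh : 0 < h) :
    Pairwise (Function.onFun Disjoint (gridCell (N := N) h)) := by
  intro m m' hmm
  rw [Function.onFun, Set.disjoint_left]
  intro x hx hx'
  exact hmm (((mem_gridCell_iff_floor hh).1 hx).symm.trans ((mem_gridCell_iff_floor hh).1 hx'))

/-- The open cube of all differences of two points of a cell of the grid of mesh `h`. -/
def diffCube (N : ℕ) (h : ℝ) : Set (E N) :=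
  WithLp.ofLp ⁻¹' univ.pi fun _ => Ioo (-h) h

theorem measurableSet_diffCube (h : ℝ) : MeasurableSet (diffCube N h) :=
  (PiLp.volume_preserving_ofLp (Fin N)).measurable
    (MeasurableSet.univ_pi fun _ => measurableSet_Ioo)

theorem volume_diffCube (h : ℝ) : volume (diffCube N h) = ENNReal.ofReal (2 * h) ^ N := by
  rw [diffCube, (PiLp.volume_preserving_ofLp (Fin N)).measure_preimage
    (MeasurableSet.univ_pi fun _ => measurableSet_Ioo).nullMeasurableSet, Real.volume_pi_Ioo]
  simp [two_mul]

theorem sub_mem_diffCube {h : ℝ} {m : Fin N → ℤ} {x y : E N} (hx : x ∈ gridCell h m)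
    (hy : y ∈ gridCell h m) : y - x ∈ diffCube N h := by
  rw [mem_gridCell] at hx hy
  simp only [diffCube, mem_preimage, mem_univ_pi, mem_Ioo, PiLp.sub_apply]
  intro i
  have h1 := hx i
  have h2 := hy i
  rw [mul_add, mul_one] at h1 h2
  constructor <;> linarith

theorem norm_sq_le_of_mem_diffCube {h : ℝ} {z : E N} (hz : z ∈ diffCube N h) :
    ‖z‖ ^ 2 ≤ N * h ^ 2 := by
  simp only [diffCube, mem_preimage, mem_univ_pi, mem_Ioo] at hz
  rw [EuclideanSpace.real_norm_sq_eq]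
  calc ∑ i, z i ^ 2 ≤ ∑ _i : Fin N, h ^ 2 :=
        Finset.sum_le_sum fun i _ => sq_le_sq' (hz i).1.le (hz i).2.le
    _ = N * h ^ 2 := by simp

/-- The variance of a function on a set `C` as a double integral over `C × C`. -/
theorem measure_mul_integral_sq {μ : Measure (E N)} [IsFiniteMeasure μ] {f : E N → ℝ}
    (hf : Continuous f) (hfs : HasCompactSupport f) :
    μ.real univ * ∫ x, f x ^ 2 ∂μ = (∫ x, f x ∂μ) ^ 2 +
      (1 / 2) * (∫⁻ x, ∫⁻ y, ENNReal.ofReal ((f y - f x) ^ 2) ∂μ ∂μ).toReal := by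
  have hf1 : Integrable f μ := hf.integrable_of_hasCompactSupport hfs
  have hf2 : Integrable (fun x => f x ^ 2) μ :=
    (hf.pow 2).integrable_of_hasCompactSupport (by simpa only [sq] using! hfs.mul_left (f := f))
  set I := ∫ x, f x ∂μ with hI
  set S := ∫ x, f x ^ 2 ∂μ with hS
  set v := μ.real univ with hv
  have hsub : ∀ x, Integrable (fun y => f y ^ 2 - 2 * f x * f y) μ := fun x =>
    hf2.sub (hf1.const_mul _)
  have h1 : ∀ x y, (f y - f x) ^ 2 = f y ^ 2 - 2 * f x * f y + f x ^ 2 := fun x y => by ring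
  have hint : ∀ x, Integrable (fun y => (f y - f x) ^ 2) μ := by
    intro x
    simp_rw [h1]
    exact (hsub x).add (integrable_const _)
  have hinner : ∀ x, ∫ y, (f y - f x) ^ 2 ∂μ = S - 2 * f x * I + v * f x ^ 2 := by
    intro x
    simp_rw [h1]
    rw [integral_add (hsub x) (integrable_const _), integral_sub hf2 (hf1.const_mul _),
      integral_const_mul, integral_const, smul_eq_mul]
  have hin : ∀ x, ∫⁻ y, ENNReal.ofReal ((f y - f x) ^ 2) ∂μ =
      ENNReal.ofReal (S - 2 * f x * I + v * f x ^ 2) := by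
    intro x
    rw [← ofReal_integral_eq_lintegral_ofReal (hint x)
      (Filter.Eventually.of_forall fun y => sq_nonneg _), hinner]
  have hnn : ∀ x, 0 ≤ S - 2 * f x * I + v * f x ^ 2 := fun x => by
    rw [← hinner]
    exact integral_nonneg fun y => sq_nonneg _
  have hlin : Integrable (fun x => 2 * f x * I) μ := (hf1.const_mul 2).mul_const I
  have hsub' : Integrable (fun x => S - 2 * f x * I) μ := (integrable_const _).sub hlin
  have hquad : Integrable (fun x => S - 2 * f x * I + v * f x ^ 2) μ :=
    hsub'.add (hf2.const_mul _)
  simp_rw [hin]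
  rw [← ofReal_integral_eq_lintegral_ofReal hquad (Filter.Eventually.of_forall hnn),
    ENNReal.toReal_ofReal (integral_nonneg hnn), integral_add hsub' (hf2.const_mul _),
    integral_sub (integrable_const _) hlin, integral_mul_const, integral_const_mul,
    integral_const_mul, integral_const, smul_eq_mul, ← hv]
  ring

/-- The oscillation of `f` on the cells of a grid of mesh `h` is controlled by its gradient. -/
theorem sum_lintegral_gridCell_le {h : ℝ} (hh : 0 < h) {f : E N → ℝ} (hf : ContDiff ℝ 1 f)
    (T : Finset (Fin N → ℤ)) :
    ∑ m ∈ T, ∫⁻ x in gridCell h m, ∫⁻ y in gridCell h m, ENNReal.ofReal ((f y - f x) ^ 2) ≤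
      ENNReal.ofReal (2 * h) ^ N * (ENNReal.ofReal (N * h ^ 2) *
        ∫⁻ x, ENNReal.ofReal (∑ i, partialD i f x ^ 2)) := by
  have hfc := hf.continuous
  have hcell : ∀ m : Fin N → ℤ, ∀ x ∈ gridCell h m,
      ∫⁻ y in gridCell h m, ENNReal.ofReal ((f y - f x) ^ 2) ≤
        ∫⁻ z in diffCube N h, ENNReal.ofReal ((f (x + z) - f x) ^ 2) := by
    intro m x hx
    rw [← lintegral_indicator (measurableSet_gridCell h m),
      ← lintegral_indicator (measurableSet_diffCube h), ← lintegral_add_left_eq_self _ x]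
    refine lintegral_mono fun z => ?_
    by_cases hz : x + z ∈ gridCell h m
    · have hz' : z ∈ diffCube N h := by simpa using sub_mem_diffCube hx hz
      rw [indicator_of_mem hz, indicator_of_mem hz']
    · rw [indicator_of_notMem hz]
      exact zero_le
  calc ∑ m ∈ T, ∫⁻ x in gridCell h m, ∫⁻ y in gridCell h m, ENNReal.ofReal ((f y - f x) ^ 2)
      ≤ ∑ m ∈ T, ∫⁻ x in gridCell h m,
          ∫⁻ z in diffCube N h, ENNReal.ofReal ((f (x + z) - f x) ^ 2) :=
        Finset.sum_le_sum fun m _ => setLIntegral_mono' (measurableSet_gridCell h m) (hcell m)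
    _ = ∫⁻ x in ⋃ m ∈ T, gridCell h m,
          ∫⁻ z in diffCube N h, ENNReal.ofReal ((f (x + z) - f x) ^ 2) :=
        (lintegral_biUnion_finset (fun m _ m' _ hmm => pairwise_disjoint_gridCell hh hmm)
          (fun m _ => measurableSet_gridCell h m) _).symm
    _ ≤ ∫⁻ x, ∫⁻ z in diffCube N h, ENNReal.ofReal ((f (x + z) - f x) ^ 2) :=
        setLIntegral_le_lintegral _ _
    _ = ∫⁻ z in diffCube N h, ∫⁻ x, ENNReal.ofReal ((f (x + z) - f x) ^ 2) := by
        refine lintegral_lintegral_swap (Continuous.measurable ?_).aemeasurable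
        change Continuous fun p : E N × E N => ENNReal.ofReal ((f (p.1 + p.2) - f p.1) ^ 2)
        exact ENNReal.continuous_ofReal.comp (by fun_prop)
    _ ≤ ∫⁻ _ in diffCube N h, ENNReal.ofReal (N * h ^ 2) *
          ∫⁻ x, ENNReal.ofReal (∑ i, partialD i f x ^ 2) := by
        refine setLIntegral_mono' (measurableSet_diffCube h) fun z hz => ?_
        refine (lintegral_sq_sub_translate_le hf z).trans ?_
        gcongr
        exact norm_sq_le_of_mem_diffCube hz
    _ = _ := by rw [setLIntegral_const, volume_diffCube, mul_comm]

/-- Up to finitely many functionals, the `L²`-norm of a function supported in a fixed ball is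
arbitrarily small compared with that of its gradient. -/
theorem exists_functionals_integral_sq_le (N : ℕ) (R : ℝ) {δ : ℝ} (hδ : 0 < δ) :
    ∃ (T : Finset (Fin N → ℤ)) (a : (Fin N → ℤ) → E N → ℝ), (∀ m, MemLp (a m) 2 volume) ∧
      ∀ f : E N → ℝ, ContDiff ℝ 1 f → HasCompactSupport f → (∀ x, f x ≠ 0 → ‖x‖ ≤ R) →
        ∫ x, f x ^ 2 ≤ δ * ∑ i, (∫ x, partialD i f x ^ 2) + ∑ m ∈ T, (∫ x, a m x * f x) ^ 2 := by
  obtain ⟨h, hh, hhδ⟩ : ∃ h : ℝ, 0 < h ∧ (1 / 2) * 2 ^ N * (N * h ^ 2) ≤ δ := by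
    have h1 : Filter.Tendsto (fun h : ℝ => (1 / 2) * 2 ^ N * (N * h ^ 2)) (nhds 0) (nhds 0) := by
      have : Continuous (fun h : ℝ => (1 / 2) * 2 ^ N * (N * h ^ 2)) := by fun_prop
      simpa using this.tendsto 0
    obtain ⟨h, h3, h2⟩ := ((h1.eventually (gt_mem_nhds hδ)).filter_mono
      nhdsWithin_le_nhds |>.and self_mem_nhdsWithin : ∀ᶠ h in nhdsWithin (0 : ℝ) (Ioi 0), _).exists
    exact ⟨h, h2, h3.le⟩
  -- The cells with index in `T` cover the ball of radius `R`; the functionals are the integrals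
  -- over these cells, divided by the square root of the volume of a cell.
  set K : ℤ := ⌈R / h⌉ with hK
  set T : Finset (Fin N → ℤ) := Fintype.piFinset fun _ => Finset.Icc (-K) K with hT
  set v : ℝ := h ^ N with hv
  have hv0 : 0 < v := by positivity
  refine ⟨T, fun m => (gridCell h m).indicator fun _ => (Real.sqrt v)⁻¹, fun m => ?_, ?_⟩
  · refine memLp_indicator_const 2 (measurableSet_gridCell h m) _ (Or.inr ?_)
    rw [volume_gridCell]
    exact ENNReal.pow_ne_top ENNReal.ofReal_ne_top
  intro f hf hfs hfR
  have hvol : ∀ m : Fin N → ℤ, (volume.restrict (gridCell h m)).real univ = v := by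
    intro m
    rw [measureReal_restrict_apply_univ, measureReal_def, volume_gridCell, ENNReal.toReal_pow,
      ENNReal.toReal_ofReal hh.le]
  have hfin : ∀ m : Fin N → ℤ,
      IsFiniteMeasure ((volume : Measure (E N)).restrict (gridCell h m)) := by
    intro m
    refine ⟨?_⟩
    rw [Measure.restrict_apply_univ, volume_gridCell]
    exact ENNReal.pow_lt_top ENNReal.ofReal_lt_top
  set A : (Fin N → ℤ) → ℝ≥0∞ := fun m =>
    ∫⁻ x in gridCell h m, ∫⁻ y in gridCell h m, ENNReal.ofReal ((f y - f x) ^ 2) with hA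
  have hD : ∀ i, Integrable (fun x => partialD i f x ^ 2) := fun i =>
    integrable_sq_of_hasCompactSupport (continuous_partialD hf i) (hasCompactSupport_partialD hfs i)
  have hDlin : ∫⁻ x, ENNReal.ofReal (∑ i, partialD i f x ^ 2) =
      ENNReal.ofReal (∑ i, ∫ x, partialD i f x ^ 2) := by
    rw [← integral_finsetSum _ fun i _ => hD i]
    exact (ofReal_integral_eq_lintegral_ofReal (integrable_finsetSum _ fun i _ => hD i)
      (Filter.Eventually.of_forall fun x => Finset.sum_nonneg fun i _ => sq_nonneg _)).symm
  have hAle := sum_lintegral_gridCell_le hh hf T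
  rw [hDlin, ← ENNReal.ofReal_pow (by positivity), ← ENNReal.ofReal_mul (by positivity),
    ← ENNReal.ofReal_mul (by positivity)] at hAle
  have hAsum : ∑ m ∈ T, (A m).toReal ≤
      (2 * h) ^ N * (N * h ^ 2 * ∑ i, ∫ x, partialD i f x ^ 2) := by
    have hD0 : 0 ≤ ∑ i, ∫ x, partialD i f x ^ 2 :=
      Finset.sum_nonneg fun i _ => integral_nonneg fun x => sq_nonneg _
    have hne : ∀ m ∈ T, A m ≠ ∞ := fun m hm =>
      ((Finset.single_le_sum (fun _ _ => zero_le) hm).trans_lt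
        (hAle.trans_lt ENNReal.ofReal_lt_top)).ne
    rw [← ENNReal.toReal_sum hne, ← ENNReal.toReal_ofReal (r := (2 * h) ^ N * _) (by positivity)]
    exact ENNReal.toReal_mono ENNReal.ofReal_ne_top hAle
  have hsupp : ∀ x, x ∉ ⋃ m ∈ T, gridCell h m → f x ^ 2 = 0 := by
    intro x hx
    by_contra hne
    have hfx : f x ≠ 0 := fun h0 => hne (by rw [h0]; simp)
    refine hx (mem_biUnion (x := fun i => ⌊x i / h⌋) ?_ ((mem_gridCell_iff_floor hh).2 rfl))
    rw [hT, Finset.mem_coe, Fintype.mem_piFinset]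
    intro i
    have hxi : |x i| ≤ R := (PiLp.norm_apply_le x i).trans (hfR x hfx)
    rw [abs_le] at hxi
    have h1 : x i / h ≤ R / h := by gcongr; exact hxi.2
    have h2 : -(R / h) ≤ x i / h := by rw [← neg_div]; gcongr; exact hxi.1
    have h3 : R / h ≤ K := Int.le_ceil _
    rw [Finset.mem_Icc]
    refine ⟨Int.le_floor.2 (by push_cast; linarith), ?_⟩
    exact Int.cast_le.1 ((Int.floor_le (x i / h)).trans (h1.trans h3))
  have hf2 := integrable_sq_of_hasCompactSupport hf.continuous hfs
  have hsplit : ∫ x, f x ^ 2 = ∑ m ∈ T, ∫ x in gridCell h m, f x ^ 2 := by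
    rw [← setIntegral_eq_integral_of_forall_compl_eq_zero hsupp]
    exact integral_biUnion_finset T (fun m _ => measurableSet_gridCell h m)
      (fun m _ m' _ hmm => pairwise_disjoint_gridCell hh hmm) fun m _ => hf2.integrableOn
  have hcell : ∀ m, ∫ x in gridCell h m, f x ^ 2 =
      (∫ x, (gridCell h m).indicator (fun _ => (Real.sqrt v)⁻¹) x * f x) ^ 2 +
        (1 / (2 * v)) * (A m).toReal := by
    intro m
    have := hfin m
    have h1 := measure_mul_integral_sq (μ := volume.restrict (gridCell h m)) hf.continuous hfs
    rw [hvol m] at h1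
    have h2 : ∫ x, (gridCell h m).indicator (fun _ => (Real.sqrt v)⁻¹) x * f x =
        (Real.sqrt v)⁻¹ * ∫ x in gridCell h m, f x := by
      rw [← integral_const_mul, ← integral_indicator (measurableSet_gridCell h m)]
      refine integral_congr_ae (Filter.Eventually.of_forall fun x => ?_)
      by_cases hx : x ∈ gridCell h m <;> simp [hx]
    rw [h2, mul_pow, inv_pow, Real.sq_sqrt hv0.le]
    have h3 : (A m).toReal = 2 * (v * (∫ x in gridCell h m, f x ^ 2) -
        (∫ x in gridCell h m, f x) ^ 2) := by linarith
    rw [h3]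
    field_simp
    ring
  rw [hsplit, Finset.sum_congr rfl fun m _ => hcell m, Finset.sum_add_distrib, ← Finset.mul_sum,
    add_comm]
  refine add_le_add_left ?_ _
  have hD0 : 0 ≤ ∑ i, ∫ x, partialD i f x ^ 2 :=
    Finset.sum_nonneg fun i _ => integral_nonneg fun x => sq_nonneg _
  calc 1 / (2 * v) * ∑ m ∈ T, (A m).toReal
      ≤ 1 / (2 * v) * ((2 * h) ^ N * (N * h ^ 2 * ∑ i, ∫ x, partialD i f x ^ 2)) := by gcongr
    _ = ((1 / 2) * 2 ^ N * (N * h ^ 2)) * ∑ i, ∫ x, partialD i f x ^ 2 := by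
        rw [hv, mul_pow]
        field_simp
    _ ≤ _ := by gcongr

end Grid

/-! ### The spaces `H¹₀` -/

section Sobolev

variable {N : ℕ} {Ω : Opens (E N)}

theorem contDiff_testFunction (φ : 𝓓(Ω, ℝ)) (n : ℕ) : ContDiff ℝ n φ :=
  φ.contDiff.of_le (by exact_mod_cast le_top)

/-- The pair `(φ, ∇φ)` of a test function `φ`. -/
def testPair (φ : 𝓓(Ω, ℝ)) : GradPair Ω :=
  ((memLp_testFunction φ).toLp, fun i => (memLp_partialD φ i).toLp)

theorem testPair_mem (φ : 𝓓(Ω, ℝ)) : testPair φ ∈ testPairs Ω :=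
  ⟨φ, (memLp_testFunction φ).coeFn_toLp, fun i => (memLp_partialD φ i).coeFn_toLp⟩

theorem exists_eq_testPair {U : GradPair Ω} (hU : U ∈ testPairs Ω) :
    ∃ φ : 𝓓(Ω, ℝ), U = testPair φ := by
  obtain ⟨φ, h1, h2⟩ := hU
  refine ⟨φ, Prod.ext ?_ (funext fun i => ?_)⟩
  · exact Lp.ext (h1.trans (memLp_testFunction φ).coeFn_toLp.symm)
  · exact Lp.ext ((h2 i).trans (memLp_partialD φ i).coeFn_toLp.symm)

theorem inner_L2_eq_integral (u v : L2 Ω) :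
    inner ℝ u v = ∫ x in (Ω : Set (E N)), u x * v x := by
  rw [L2.inner_def]
  refine integral_congr_ae (Filter.Eventually.of_forall fun x => ?_)
  simp [mul_comm]

theorem inner_toLp_eq_integral {f g : E N → ℝ}
    (hf : MemLp f 2 ((volume : Measure (E N)).restrict (Ω : Set (E N))))
    (hg : MemLp g 2 ((volume : Measure (E N)).restrict (Ω : Set (E N)))) :
    inner ℝ (hf.toLp f) (hg.toLp g) = ∫ x in (Ω : Set (E N)), f x * g x := by
  rw [inner_L2_eq_integral]
  refine integral_congr_ae ?_
  filter_upwards [hf.coeFn_toLp, hg.coeFn_toLp] with x h1 h2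
  rw [h1, h2]

/-- The norm in `L²(Ω)` of a function vanishing outside `Ω`. -/
theorem norm_toLp_sq {f : E N → ℝ}
    (hf : MemLp f 2 ((volume : Measure (E N)).restrict (Ω : Set (E N))))
    (h0 : ∀ x, x ∉ (Ω : Set (E N)) → f x = 0) : ‖hf.toLp f‖ ^ 2 = ∫ x, f x ^ 2 := by
  rw [← real_inner_self_eq_norm_sq, inner_toLp_eq_integral]
  simp_rw [← sq]
  exact setIntegral_eq_integral_of_forall_compl_eq_zero fun x hx => by rw [h0 x hx]; simp

theorem testFunction_eq_zero (φ : 𝓓(Ω, ℝ)) {x : E N} (hx : x ∉ (Ω : Set (E N))) : φ x = 0 :=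
  image_eq_zero_of_notMem_tsupport fun h => hx (φ.tsupport_subset h)

theorem partialD_testFunction_eq_zero (φ : 𝓓(Ω, ℝ)) (i : Fin N) {x : E N}
    (hx : x ∉ (Ω : Set (E N))) : partialD i φ x = 0 :=
  partialD_eq_zero_of_notMem_tsupport (fun h => hx (φ.tsupport_subset h)) i

theorem testPairs_le_H1 : testPairs Ω ≤ H1 Ω := by
  intro U hU
  obtain ⟨φ, rfl⟩ := exists_eq_testPair hU
  intro ψ i
  have h1 := integral_mul_partialD_eq_neg (contDiff_testFunction φ 1) (contDiff_testFunction ψ 1)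
    ψ.hasCompactSupport i
  have h2 : ∫ x in (Ω : Set (E N)), (testPair φ).1 x * partialD i ψ x =
      ∫ x, φ x * partialD i ψ x := by
    rw [← setIntegral_eq_integral_of_forall_compl_eq_zero (s := (Ω : Set (E N)))
      (f := fun x => φ x * partialD i ψ x)
      fun x hx => by rw [testFunction_eq_zero φ hx, zero_mul]]
    refine integral_congr_ae ?_
    filter_upwards [(memLp_testFunction φ).coeFn_toLp] with x hx
    rw [testPair, hx]
  have h3 : ∫ x in (Ω : Set (E N)), (testPair φ).2 i x * ψ x = ∫ x, partialD i φ x * ψ x := by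
    rw [← setIntegral_eq_integral_of_forall_compl_eq_zero (s := (Ω : Set (E N)))
      (f := fun x => partialD i φ x * ψ x)
      fun x hx => by rw [testFunction_eq_zero ψ hx, mul_zero]]
    refine integral_congr_ae ?_
    filter_upwards [(memLp_partialD φ i).coeFn_toLp] with x hx
    rw [testPair, hx]
  rw [h2, h3, h1]

theorem isClosed_H1 : IsClosed (H1 Ω : Set (GradPair Ω)) := by
  have h1 : (H1 Ω : Set (GradPair Ω)) = ⋂ (φ : 𝓓(Ω, ℝ)) (i : Fin N),
      {U | inner ℝ U.1 (memLp_partialD φ i).toLp =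
        -inner ℝ (U.2 i) (memLp_testFunction φ).toLp} := by
    ext U
    simp only [mem_iInter, mem_ofPred_eq]
    refine forall_congr' fun φ => forall_congr' fun i => ?_
    rw [inner_L2_eq_integral, inner_L2_eq_integral]
    have h2 : ∫ x in (Ω : Set (E N)), U.1 x * (memLp_partialD φ i).toLp _ x =
        ∫ x in (Ω : Set (E N)), U.1 x * partialD i φ x := by
      refine integral_congr_ae ?_
      filter_upwards [(memLp_partialD φ i).coeFn_toLp] with x hx
      rw [hx]
    have h3 : ∫ x in (Ω : Set (E N)), U.2 i x * (memLp_testFunction φ).toLp _ x =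
        ∫ x in (Ω : Set (E N)), U.2 i x * φ x := by
      refine integral_congr_ae ?_
      filter_upwards [(memLp_testFunction φ).coeFn_toLp] with x hx
      rw [hx]
    rw [h2, h3]
  rw [h1]
  refine isClosed_iInter fun φ => isClosed_iInter fun i => isClosed_eq ?_ ?_
  · exact continuous_fst.inner continuous_const
  · exact (((continuous_apply i).comp continuous_snd).inner continuous_const).neg

theorem H10_eq_topologicalClosure : H10 Ω = (testPairs Ω).topologicalClosure :=
  inf_eq_right.2 ((testPairs Ω).topologicalClosure_minimal testPairs_le_H1 isClosed_H1)

theorem isClosed_H10 : IsClosed (H10 Ω : Set (GradPair Ω)) := by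
  rw [H10_eq_topologicalClosure]
  exact (testPairs Ω).isClosed_topologicalClosure

theorem mem_closure_range_testPair {U : GradPair Ω} (hU : U ∈ H10 Ω) :
    U ∈ closure (range (testPair (Ω := Ω))) := by
  rw [H10_eq_topologicalClosure, ← SetLike.mem_coe, Submodule.topologicalClosure_coe] at hU
  refine closure_mono ?_ hU
  intro W hW
  obtain ⟨φ, rfl⟩ := exists_eq_testPair hW
  exact mem_range_self φ

theorem testPair_mem_H10 (φ : 𝓓(Ω, ℝ)) : testPair φ ∈ H10 Ω := by
  rw [H10_eq_topologicalClosure]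
  exact (testPairs Ω).le_topologicalClosure (testPair_mem φ)

/-- A closed condition that holds for all test functions holds in `H¹₀(Ω)`. -/
theorem H10_induction {p : GradPair Ω → Prop} (hp : IsClosed {U | p U})
    (h : ∀ φ : 𝓓(Ω, ℝ), p (testPair φ)) {U : GradPair Ω} (hU : U ∈ H10 Ω) : p U := by
  refine closure_minimal ?_ hp (mem_closure_range_testPair hU)
  rintro _ ⟨φ, rfl⟩
  exact h φ

theorem norm_testPair_fst_sq (φ : 𝓓(Ω, ℝ)) : ‖(testPair φ).1‖ ^ 2 = ∫ x, φ x ^ 2 :=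
  norm_toLp_sq (memLp_testFunction φ) fun _ hx => testFunction_eq_zero φ hx

theorem norm_testPair_snd_sq (φ : 𝓓(Ω, ℝ)) (i : Fin N) :
    ‖(testPair φ).2 i‖ ^ 2 = ∫ x, partialD i φ x ^ 2 :=
  norm_toLp_sq (memLp_partialD φ i) fun _ hx => partialD_testFunction_eq_zero φ i hx

theorem norm_le_of_testFunction_ne_zero {R : ℝ} (hR : (Ω : Set (E N)) ⊆ Metric.closedBall 0 R)
    (φ : 𝓓(Ω, ℝ)) {x : E N} (hx : φ x ≠ 0) : ‖x‖ ≤ R :=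
  mem_closedBall_zero_iff.1 (hR (by_contra fun h => hx (testFunction_eq_zero φ h)))

/-- The Poincaré inequality in `H¹₀(Ω)`. -/
theorem norm_fst_sq_le {R : ℝ} (hR : (Ω : Set (E N)) ⊆ Metric.closedBall 0 R) {U : GradPair Ω}
    (hU : U ∈ H10 Ω) (i : Fin N) : ‖U.1‖ ^ 2 ≤ 4 * R ^ 2 * ‖U.2 i‖ ^ 2 := by
  refine H10_induction (p := fun U => ‖U.1‖ ^ 2 ≤ 4 * R ^ 2 * ‖U.2 i‖ ^ 2)
    (isClosed_le (by fun_prop) (by fun_prop)) (fun φ => ?_) hU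
  rw [norm_testPair_fst_sq, norm_testPair_snd_sq]
  exact integral_sq_le_integral_sq_partialD (contDiff_testFunction φ 1) φ.hasCompactSupport i
    fun x hx => (PiLp.norm_apply_le x i).trans (norm_le_of_testFunction_ne_zero hR φ hx)

/-- The quantitative form of Rellich's theorem in `H¹₀(Ω)`: up to finitely many functionals, the
norm of `u` in `L²(Ω)` is arbitrarily small compared with that of `∇u`. -/
theorem exists_functionals_norm_fst_sq_le {R : ℝ} (hR : (Ω : Set (E N)) ⊆ Metric.closedBall 0 R)
    {δ : ℝ} (hδ : 0 < δ) :
    ∃ (T : Finset (Fin N → ℤ)) (a : (Fin N → ℤ) → L2 Ω), ∀ U ∈ H10 Ω,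
      ‖U.1‖ ^ 2 ≤ δ * ∑ i, ‖U.2 i‖ ^ 2 + ∑ m ∈ T, (inner ℝ (a m) U.1) ^ 2 := by
  obtain ⟨T, a, ha, h⟩ := exists_functionals_integral_sq_le N R hδ
  refine ⟨T, fun m => ((ha m).restrict (Ω : Set (E N))).toLp, fun U hU => ?_⟩
  refine H10_induction (p := fun U => ‖U.1‖ ^ 2 ≤ δ * ∑ i, ‖U.2 i‖ ^ 2 +
    ∑ m ∈ T, (inner ℝ (((ha m).restrict (Ω : Set (E N))).toLp (a m)) U.1) ^ 2)
    (isClosed_le (by fun_prop) ?_) (fun φ => ?_) hU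
  · refine Continuous.add (by fun_prop) (continuous_finsetSum _ fun m _ => ?_)
    exact (continuous_const.inner continuous_fst).pow 2
  · have h1 := h φ (contDiff_testFunction φ 1) φ.hasCompactSupport
      fun x hx => norm_le_of_testFunction_ne_zero hR φ hx
    rw [norm_testPair_fst_sq]
    simp_rw [norm_testPair_snd_sq]
    refine h1.trans_eq ?_
    congr 1
    refine Finset.sum_congr rfl fun m _ => ?_
    rw [testPair, inner_toLp_eq_integral]
    congr 1
    exact (setIntegral_eq_integral_of_forall_compl_eq_zero
      fun x hx => by rw [testFunction_eq_zero φ hx, mul_zero]).symm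

end Sobolev

/-! ### The energy space and its forms -/

section Energy

variable {N : ℕ} {Ω : Opens (E N)}

theorem mem_energySpace {U : State Ω} :
    U ∈ energySpace Ω ↔ (∀ i, U.1 i ∈ H10 Ω) ∧ U.2 ∈ H10 Ω := by
  simp [energySpace, Submodule.mem_prod, Submodule.mem_pi]

theorem isClosed_energySpace : IsClosed (energySpace Ω : Set (State Ω)) := by
  have h : (energySpace Ω : Set (State Ω)) =
      (⋂ i, {U : State Ω | U.1 i ∈ H10 Ω}) ∩ {U : State Ω | U.2 ∈ H10 Ω} := by
    ext U
    simp only [SetLike.mem_coe, mem_energySpace, mem_inter_iff, mem_iInter, mem_ofPred_eq]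
  rw [h]
  refine (isClosed_iInter fun i => ?_).inter (isClosed_H10.preimage continuous_snd)
  have h1 : Continuous fun U : State Ω => U.1 i := (continuous_apply i).comp continuous_fst
  exact isClosed_H10.preimage h1

theorem formQ_comm (lam mu k t : ℝ) (U Z : State Ω) :
    formQ lam mu k t U Z = formQ lam mu k t Z U := by
  simp only [formQ, real_inner_comm]

theorem formM_comm (t : ℝ) (U Z : State Ω) : formM t U Z = formM t Z U := by
  simp only [formM, real_inner_comm]

/-- The form `Q` as a bilinear map. -/
def bilinQ (lam mu k t : ℝ) (Ω : Opens (E N)) : State Ω →ₗ[ℝ] State Ω →ₗ[ℝ] ℝ :=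
  LinearMap.mk₂ ℝ (formQ lam mu k t) (formQ_add lam mu k t) (formQ_smul lam mu k t)
    (fun U Z Z' => by rw [formQ_comm, formQ_add, formQ_comm, formQ_comm _ _ _ _ Z'])
    (fun c U Z => by rw [formQ_comm, formQ_smul, formQ_comm, smul_eq_mul])

/-- The scalar product of `ℒ²_t(Ω)` as a bilinear map. -/
def bilinM (t : ℝ) (Ω : Opens (E N)) : State Ω →ₗ[ℝ] State Ω →ₗ[ℝ] ℝ :=
  LinearMap.mk₂ ℝ (formM t) (formM_add t) (formM_smul t)
    (fun U Z Z' => by rw [formM_comm, formM_add, formM_comm, formM_comm _ Z'])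
    (fun c U Z => by rw [formM_comm, formM_smul, formM_comm, smul_eq_mul])

theorem formQ_self (lam mu k t : ℝ) (U : State Ω) :
    formQ lam mu k t U U = mu / 12 * ∑ i, ∑ j, ‖dRot U i j‖ ^ 2 +
      (mu + lam) / 12 * ‖divRot U‖ ^ 2 + mu * k / t ^ 2 * ∑ i, ‖dDefl U i - rot U i‖ ^ 2 := by
  simp only [formQ, real_inner_self_eq_norm_sq]

theorem formM_self (t : ℝ) (U : State Ω) :
    formM t U U = ‖defl U‖ ^ 2 + t ^ 2 / 12 * ∑ i, ‖rot U i‖ ^ 2 := by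
  simp only [formM, real_inner_self_eq_norm_sq]

theorem formM_self_nonneg (t : ℝ) (U : State Ω) : 0 ≤ formM t U U := by
  rw [formM_self]
  positivity

theorem continuous_formQ_self (lam mu k t : ℝ) :
    Continuous fun U : State Ω => formQ lam mu k t U U := by
  simp only [formQ_self, divRot, dRot, dDefl, rot]
  fun_prop

theorem continuous_formM_self (t : ℝ) : Continuous fun U : State Ω => formM t U U := by
  simp only [formM_self, defl, rot]
  fun_prop

/-- The sum of the squares of the `L²`-norms of all components of a state. -/
def sobolevSq (U : State Ω) : ℝ :=
  ∑ i, ‖rot U i‖ ^ 2 + ∑ i, ∑ j, ‖dRot U i j‖ ^ 2 + ‖defl U‖ ^ 2 + ∑ i, ‖dDefl U i‖ ^ 2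

theorem sq_le_sum_sq {ι : Type*} [Fintype ι] (r : ι → ℝ) (i : ι) : r i ^ 2 ≤ ∑ i, r i ^ 2 :=
  Finset.single_le_sum (f := fun i => r i ^ 2) (fun _ _ => sq_nonneg _) (Finset.mem_univ i)

theorem sum_sq_nonneg {ι : Type*} [Fintype ι] (r : ι → ℝ) : 0 ≤ ∑ i, r i ^ 2 :=
  Finset.sum_nonneg fun _ _ => sq_nonneg _

theorem sum_sum_sq_nonneg {ι κ : Type*} [Fintype ι] [Fintype κ] (r : ι → κ → ℝ) :
    0 ≤ ∑ i, ∑ j, r i j ^ 2 :=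
  Finset.sum_nonneg fun i _ => sum_sq_nonneg (r i)

theorem sq_le_sum_sum_sq {ι κ : Type*} [Fintype ι] [Fintype κ] (r : ι → κ → ℝ) (i : ι) (j : κ) :
    r i j ^ 2 ≤ ∑ i, ∑ j, r i j ^ 2 :=
  (sq_le_sum_sq (r i) j).trans (Finset.single_le_sum (f := fun i => ∑ j, r i j ^ 2)
    (fun i _ => sum_sq_nonneg (r i)) (Finset.mem_univ i))

theorem norm_sq_le_sobolevSq (U : State Ω) : ‖U‖ ^ 2 ≤ sobolevSq U := by
  have hdef : sobolevSq U = ∑ i, ‖rot U i‖ ^ 2 + ∑ i, ∑ j, ‖dRot U i j‖ ^ 2 + ‖defl U‖ ^ 2 +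
    ∑ i, ‖dDefl U i‖ ^ 2 := rfl
  have p1 := sum_sq_nonneg fun i => ‖rot U i‖
  have p2 := sum_sum_sq_nonneg fun i j => ‖dRot U i j‖
  have p3 := sq_nonneg ‖defl U‖
  have p4 := sum_sq_nonneg fun i => ‖dDefl U i‖
  have h1 := sq_le_sum_sq fun i => ‖rot U i‖
  have h2 := sq_le_sum_sum_sq fun i j => ‖dRot U i j‖
  have h4 := sq_le_sum_sq fun i => ‖dDefl U i‖
  have hle : ‖U‖ ≤ Real.sqrt (sobolevSq U) := by
    refine norm_prod_le_iff.2 ⟨(pi_norm_le_iff_of_nonneg (Real.sqrt_nonneg _)).2 fun i =>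
      norm_prod_le_iff.2 ⟨?_, (pi_norm_le_iff_of_nonneg (Real.sqrt_nonneg _)).2 fun j => ?_⟩,
      norm_prod_le_iff.2 ⟨?_, (pi_norm_le_iff_of_nonneg (Real.sqrt_nonneg _)).2 fun j => ?_⟩⟩
    · have h : ‖rot U i‖ ^ 2 ≤ sobolevSq U := by linarith [h1 i]
      exact Real.le_sqrt_of_sq_le h
    · have h : ‖dRot U i j‖ ^ 2 ≤ sobolevSq U := by linarith [h2 i j]
      exact Real.le_sqrt_of_sq_le h
    · have h : ‖defl U‖ ^ 2 ≤ sobolevSq U := by linarith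
      exact Real.le_sqrt_of_sq_le h
    · have h : ‖dDefl U j‖ ^ 2 ≤ sobolevSq U := by linarith [h4 j]
      exact Real.le_sqrt_of_sq_le h
  have h0 : 0 ≤ sobolevSq U := by linarith
  calc ‖U‖ ^ 2 ≤ Real.sqrt (sobolevSq U) ^ 2 := by gcongr
    _ = sobolevSq U := Real.sq_sqrt h0

/-- The form `Q` is coercive on the energy space of a bounded open set: it controls `∇β`, hence `β`
by the Poincaré inequality, hence `∇w = (∇w - β) + β`, hence `w`. -/
theorem exists_sobolevSq_le_formQ {d : ℕ} {Ω : Opens (E (d + 1))} {R : ℝ}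
    (hR : (Ω : Set (E (d + 1))) ⊆ Metric.closedBall 0 R) {lam mu k t : ℝ} (hlam : 0 < lam)
    (hmu : 0 < mu) (hk : 0 < k) (ht : 0 < t) :
    ∃ C, 0 < C ∧ ∀ U ∈ energySpace Ω, sobolevSq U ≤ C * formQ lam mu k t U U := by
  obtain ⟨a, ha⟩ : ∃ a, a = 12 / mu := ⟨_, rfl⟩
  obtain ⟨b, hb⟩ : ∃ b, b = t ^ 2 / (mu * k) := ⟨_, rfl⟩
  have ha0 : 0 < a := by rw [ha]; positivity
  have hb0 : 0 < b := by rw [hb]; positivity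
  obtain ⟨P, hP⟩ : ∃ P, P = 4 * R ^ 2 := ⟨_, rfl⟩
  have hP0 : 0 ≤ P := by rw [hP]; positivity
  refine ⟨P * a + a + P * (2 * b + 2 * (P * a)) + (2 * b + 2 * (P * a)), by positivity,
    fun U hU => ?_⟩
  rw [mem_energySpace] at hU
  have hw : ‖defl U‖ ^ 2 ≤ P * ‖dDefl U 0‖ ^ 2 := hP ▸ norm_fst_sq_le hR hU.2 0
  have hrot : ∀ i, ‖rot U i‖ ^ 2 ≤ P * ‖dRot U i 0‖ ^ 2 := fun i =>
    hP ▸ norm_fst_sq_le hR (hU.1 i) 0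
  have hd : ∀ i, ‖dDefl U i‖ ≤ ‖dDefl U i - rot U i‖ + ‖rot U i‖ := fun i =>
    norm_le_norm_sub_add _ _
  have hq := formQ_self lam mu k t U
  rw [sobolevSq]
  generalize formQ lam mu k t U U = q at hq ⊢
  generalize ‖divRot U‖ = dv at hq
  have hs0 : ∀ i, 0 ≤ ‖dDefl U i - rot U i‖ := fun i => norm_nonneg _
  have hr0 : ∀ i, 0 ≤ ‖rot U i‖ := fun i => norm_nonneg _
  have hd0 : ∀ i, 0 ≤ ‖dDefl U i‖ := fun i => norm_nonneg _
  generalize ‖defl U‖ = w at hw ⊢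
  obtain ⟨s, hs⟩ : ∃ s : Fin (d + 1) → ℝ, s = fun i => ‖dDefl U i - rot U i‖ := ⟨_, rfl⟩
  obtain ⟨r, hr⟩ : ∃ r : Fin (d + 1) → ℝ, r = fun i => ‖rot U i‖ := ⟨_, rfl⟩
  obtain ⟨p, hp⟩ : ∃ p : Fin (d + 1) → ℝ, p = fun i => ‖dDefl U i‖ := ⟨_, rfl⟩
  obtain ⟨g, hg⟩ : ∃ g : Fin (d + 1) → Fin (d + 1) → ℝ, g = fun i j => ‖dRot U i j‖ := ⟨_, rfl⟩
  simp only [← congrFun hs, ← congrFun hr, ← congrFun hp, ← congrFun (congrFun hg _)] at *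
  clear hs hr hp hg hU
  have hG0 := sum_sum_sq_nonneg g
  have hS0 := sum_sq_nonneg s
  have hGq : ∑ i, ∑ j, g i j ^ 2 ≤ a * q := by
    have h1 : mu / 12 * ∑ i, ∑ j, g i j ^ 2 ≤ q := by
      have : 0 ≤ (mu + lam) / 12 * dv ^ 2 := by positivity
      have : 0 ≤ mu * k / t ^ 2 * ∑ i, s i ^ 2 := by positivity
      linarith
    rw [ha, div_mul_eq_mul_div, le_div_iff₀ hmu]
    linarith
  have hSq : ∑ i, s i ^ 2 ≤ b * q := by
    have h1 : mu * k / t ^ 2 * ∑ i, s i ^ 2 ≤ q := by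
      have : 0 ≤ (mu + lam) / 12 * dv ^ 2 := by positivity
      have : 0 ≤ mu / 12 * ∑ i, ∑ j, g i j ^ 2 := by positivity
      linarith
    calc ∑ i, s i ^ 2 = b * (mu * k / t ^ 2 * ∑ i, s i ^ 2) := by rw [hb]; field_simp
      _ ≤ b * q := by gcongr
  have hrs : ∑ i, r i ^ 2 ≤ P * ∑ i, ∑ j, g i j ^ 2 := by
    rw [Finset.mul_sum]
    exact Finset.sum_le_sum fun i _ => (hrot i).trans
      (mul_le_mul_of_nonneg_left (sq_le_sum_sq (g i) 0) hP0)
  have hps : ∑ i, p i ^ 2 ≤ 2 * ∑ i, s i ^ 2 + 2 * ∑ i, r i ^ 2 := by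
    rw [Finset.mul_sum, Finset.mul_sum, ← Finset.sum_add_distrib]
    refine Finset.sum_le_sum fun i _ => ?_
    calc p i ^ 2 ≤ (s i + r i) ^ 2 := pow_le_pow_left₀ (hd0 i) (hd i) 2
      _ ≤ _ := by nlinarith [sq_nonneg (s i - r i)]
  have hws : w ^ 2 ≤ P * ∑ i, p i ^ 2 :=
    hw.trans (mul_le_mul_of_nonneg_left (sq_le_sum_sq p 0) hP0)
  have e1 : ∑ i, r i ^ 2 ≤ P * a * q := by
    refine hrs.trans ?_
    rw [mul_assoc]
    gcongr
  have e2 : ∑ i, p i ^ 2 ≤ (2 * b + 2 * (P * a)) * q := by linarith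
  have e3 : w ^ 2 ≤ P * (2 * b + 2 * (P * a)) * q := by
    refine hws.trans ?_
    rw [mul_assoc]
    gcongr
  linarith

end Energy

/-! ### The min-max principle for the Reissner-Mindlin eigenvalues -/

section MinMax

/-- The energy space, to be equipped with the scalar product `Q` instead of the norm it inherits
from the ambient space of states. -/
def EnergyHilbert {N : ℕ} (Ω : Opens (E N)) : Type := ↥(energySpace Ω)

instance {N : ℕ} (Ω : Opens (E N)) : AddCommGroup (EnergyHilbert Ω) :=
  inferInstanceAs (AddCommGroup ↥(energySpace Ω))

instance {N : ℕ} (Ω : Opens (E N)) : Module ℝ (EnergyHilbert Ω) :=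
  inferInstanceAs (Module ℝ ↥(energySpace Ω))

/-- The inclusion of the energy space in the space of states. -/
def EnergyHilbert.val {N : ℕ} (Ω : Opens (E N)) : EnergyHilbert Ω →ₗ[ℝ] State Ω :=
  (energySpace Ω).subtype

theorem EnergyHilbert.val_injective {N : ℕ} (Ω : Opens (E N)) :
    Function.Injective (EnergyHilbert.val Ω) := Subtype.val_injective

theorem EnergyHilbert.val_mem {N : ℕ} {Ω : Opens (E N)} (u : EnergyHilbert Ω) :
    EnergyHilbert.val Ω u ∈ energySpace Ω := Subtype.property u

theorem EnergyHilbert.exists_val_eq {N : ℕ} {Ω : Opens (E N)} {U : State Ω}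
    (hU : U ∈ energySpace Ω) : ∃ u, EnergyHilbert.val Ω u = U := ⟨⟨U, hU⟩, rfl⟩

open EnergyHilbert

theorem sobolevSq_nonneg {N : ℕ} {Ω : Opens (E N)} (U : State Ω) : 0 ≤ sobolevSq U :=
  (sq_nonneg ‖U‖).trans (norm_sq_le_sobolevSq U)

variable {d : ℕ} {Ω : Opens (E (d + 1))} {R lam mu k t : ℝ}

theorem formQ_self_nonneg (hR : (Ω : Set (E (d + 1))) ⊆ Metric.closedBall 0 R) (hlam : 0 < lam)
    (hmu : 0 < mu) (hk : 0 < k) (ht : 0 < t) {U : State Ω} (hU : U ∈ energySpace Ω) :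
    0 ≤ formQ lam mu k t U U := by
  obtain ⟨C, hC, h⟩ := exists_sobolevSq_le_formQ hR hlam hmu hk ht
  exact nonneg_of_mul_nonneg_right ((sobolevSq_nonneg U).trans (h U hU)) hC

theorem eq_zero_of_formQ_self_nonpos (hR : (Ω : Set (E (d + 1))) ⊆ Metric.closedBall 0 R)
    (hlam : 0 < lam) (hmu : 0 < mu) (hk : 0 < k) (ht : 0 < t) {U : State Ω}
    (hU : U ∈ energySpace Ω) (h0 : formQ lam mu k t U U ≤ 0) : U = 0 := by
  obtain ⟨C, hC, h⟩ := exists_sobolevSq_le_formQ hR hlam hmu hk ht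
  have h1 := (norm_sq_le_sobolevSq U).trans (h U hU)
  have h2 : C * formQ lam mu k t U U ≤ 0 := mul_nonpos_of_nonneg_of_nonpos hC.le h0
  have h3 : ‖U‖ ^ 2 = 0 := le_antisymm (h1.trans h2) (sq_nonneg _)
  exact norm_eq_zero.1 (pow_eq_zero_iff two_ne_zero |>.1 h3)

/-- The scalar product `Q` on the energy space. -/
abbrev energyCore (hR : (Ω : Set (E (d + 1))) ⊆ Metric.closedBall 0 R) (hlam : 0 < lam)
    (hmu : 0 < mu) (hk : 0 < k) (ht : 0 < t) : InnerProductSpace.Core ℝ (EnergyHilbert Ω) where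
  inner u v := formQ lam mu k t (val Ω u) (val Ω v)
  conj_inner_symm u v := formQ_comm _ _ _ _ _ _
  re_inner_nonneg u := formQ_self_nonneg hR hlam hmu hk ht u.val_mem
  add_left u v w := by rw [map_add, formQ_add]
  smul_left u v c := by rw [map_smul, formQ_smul]; rfl
  definite u h := val_injective Ω ((eq_zero_of_formQ_self_nonpos hR hlam hmu hk ht u.val_mem
    h.le).trans (map_zero _).symm)

/-- The components of a state that enter the scalar product of `ℒ²_t(Ω)`, with their weights. -/
def pivotMap (t : ℝ) (Ω : Opens (E (d + 1))) :
    State Ω →ₗ[ℝ] PiLp 2 (fun _ : Option (Fin (d + 1)) => L2 Ω) where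
  toFun U := WithLp.toLp 2 fun o => o.elim (defl U) fun i => (t / Real.sqrt 12) • rot U i
  map_add' U V := by
    ext1 o
    cases o
    · rfl
    · exact smul_add _ _ _
  map_smul' c U := by
    ext1 o
    cases o
    · rfl
    · exact smul_comm _ _ _

theorem inner_pivotMap (t : ℝ) (U Z : State Ω) :
    inner ℝ (pivotMap t Ω U) (pivotMap t Ω Z) = formM t U Z := by
  have h1 : ∀ i, inner ℝ ((t / Real.sqrt 12) • rot U i) ((t / Real.sqrt 12) • rot Z i) =
      t ^ 2 / 12 * inner ℝ (rot U i) (rot Z i) := by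
    intro i
    rw [real_inner_smul_left, real_inner_smul_right, ← mul_assoc, ← sq, div_pow,
      Real.sq_sqrt (by norm_num)]
  rw [PiLp.inner_apply, Fintype.sum_option, formM, Finset.mul_sum]
  exact congrArg₂ (· + ·) rfl (Finset.sum_congr rfl fun i _ => h1 i)

/-- The min-max inequality: if `Q ≤ γ M` on an `n`-dimensional subspace of the energy space, then
at least `n` eigenvalues are at most `γ'`, for every `γ' > γ`. -/
theorem natCast_le_rank_iSup_eigenspace (hR : (Ω : Set (E (d + 1))) ⊆ Metric.closedBall 0 R)
    (hlam : 0 < lam) (hmu : 0 < mu) (hk : 0 < k) (ht : 0 < t) {n : ℕ}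
    (L : (Fin n → ℝ) →ₗ[ℝ] State Ω) (hL : Function.Injective L) (hLV : ∀ c, L c ∈ energySpace Ω)
    {γ γ' : ℝ} (hγ : γ < γ') (h : ∀ c, formQ lam mu k t (L c) (L c) ≤ γ * formM t (L c) (L c)) :
    (n : Cardinal) ≤
      Module.rank ℝ ↥(⨆ (μ : ℝ) (_ : μ ≤ γ'), eigenspace lam mu k t Ω μ) := by
  obtain ⟨C, hC, hcoer⟩ := exists_sobolevSq_le_formQ hR hlam hmu hk ht
  let core := energyCore hR hlam hmu hk ht
  let _ : NormedAddCommGroup (EnergyHilbert Ω) := core.toNormedAddCommGroup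
  let _ : InnerProductSpace ℝ (EnergyHilbert Ω) := InnerProductSpace.ofCore core.toCore
  have hin : ∀ u v : EnergyHilbert Ω, inner ℝ u v = formQ lam mu k t (val Ω u) (val Ω v) :=
    fun _ _ => rfl
  have hnorm : ∀ u : EnergyHilbert Ω, ‖u‖ ^ 2 = formQ lam mu k t (val Ω u) (val Ω u) := fun u => by
    rw [← hin, real_inner_self_eq_norm_sq]
  have hS : ∀ u : EnergyHilbert Ω, sobolevSq (val Ω u) ≤ C * ‖u‖ ^ 2 := fun u => by
    rw [hnorm]
    exact hcoer _ u.val_mem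
  have hval : ∀ u : EnergyHilbert Ω, ‖val Ω u‖ ≤ Real.sqrt C * ‖u‖ := fun u => by
    refine le_of_sq_le_sq ?_ (by positivity)
    rw [mul_pow, Real.sq_sqrt hC.le]
    exact (norm_sq_le_sobolevSq _).trans (hS u)
  have hcomplete : CompleteSpace (EnergyHilbert Ω) := by
    refine Metric.complete_of_cauchySeq_tendsto fun u hu => ?_
    let valL : EnergyHilbert Ω →L[ℝ] State Ω := (val Ω).mkContinuous _ hval
    have h1 : CauchySeq fun n => valL (u n) := hu.map valL.uniformContinuous
    obtain ⟨U, hU⟩ := cauchySeq_tendsto_of_complete h1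
    have hUV : U ∈ energySpace Ω :=
      isClosed_energySpace.mem_of_tendsto hU (Filter.Eventually.of_forall fun n => (u n).val_mem)
    obtain ⟨u₀, rfl⟩ := exists_val_eq hUV
    refine ⟨u₀, tendsto_iff_norm_sub_tendsto_zero.2 ?_⟩
    have h2 : Filter.Tendsto (fun n => val Ω (u n) - val Ω u₀) Filter.atTop (nhds 0) := by
      simpa using! hU.sub_const (val Ω u₀)
    have h3 := ((continuous_formQ_self (Ω := Ω) lam mu k t).tendsto 0).comp h2
    have h4 : formQ lam mu k t (0 : State Ω) 0 = 0 := by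
      have := formQ_smul lam mu k t 0 (0 : State Ω) 0
      rwa [zero_smul, zero_mul] at this
    rw [h4] at h3
    have h5 : Filter.Tendsto (fun n => ‖u n - u₀‖ ^ 2) Filter.atTop (nhds 0) := by
      refine h3.congr fun n => ?_
      rw [hnorm, map_sub]
      rfl
    have h6 := h5.sqrt
    simpa [Real.sqrt_sq (norm_nonneg _)] using h6
  -- The embedding `J` in `ℒ²_t(Ω)` is bounded and compact.
  have hSum : ∀ U : State Ω, (∀ i, ‖rot U i‖ ^ 2 ≤ sobolevSq U) ∧ ‖defl U‖ ^ 2 ≤ sobolevSq U ∧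
      (∀ i, ∑ j, ‖dRot U i j‖ ^ 2 ≤ sobolevSq U) ∧ ∑ i, ‖dDefl U i‖ ^ 2 ≤ sobolevSq U := by
    intro U
    have hdef : sobolevSq U = ∑ i, ‖rot U i‖ ^ 2 + ∑ i, ∑ j, ‖dRot U i j‖ ^ 2 + ‖defl U‖ ^ 2 +
      ∑ i, ‖dDefl U i‖ ^ 2 := rfl
    have p1 := sum_sq_nonneg fun i => ‖rot U i‖
    have p2 := sum_sum_sq_nonneg fun i j => ‖dRot U i j‖
    have p3 := sq_nonneg ‖defl U‖
    have p4 := sum_sq_nonneg fun i => ‖dDefl U i‖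
    have h1 := sq_le_sum_sq fun i => ‖rot U i‖
    have h2 : ∀ i, ∑ j, ‖dRot U i j‖ ^ 2 ≤ ∑ i, ∑ j, ‖dRot U i j‖ ^ 2 := fun i =>
      Finset.single_le_sum (f := fun i => ∑ j, ‖dRot U i j‖ ^ 2)
        (fun i _ => sum_sq_nonneg fun j => ‖dRot U i j‖) (Finset.mem_univ i)
    exact ⟨fun i => by linarith [h1 i], by linarith, fun i => by linarith [h2 i], by linarith⟩
  have hMn : ∀ u : EnergyHilbert Ω,
      ‖pivotMap t Ω (val Ω u)‖ ≤ Real.sqrt (C * (1 + t ^ 2 / 12 * (d + 1))) * ‖u‖ := by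
    intro u
    refine le_of_sq_le_sq ?_ (by positivity)
    rw [mul_pow, Real.sq_sqrt (by positivity), ← real_inner_self_eq_norm_sq, inner_pivotMap,
      formM_self]
    obtain ⟨q1, q2, -, -⟩ := hSum (val Ω u)
    have q3 : ∑ i, ‖rot (val Ω u) i‖ ^ 2 ≤ (d + 1) * sobolevSq (val Ω u) := by
      refine (Finset.sum_le_sum fun i _ => q1 i).trans_eq ?_
      simp
    calc ‖defl (val Ω u)‖ ^ 2 + t ^ 2 / 12 * ∑ i, ‖rot (val Ω u) i‖ ^ 2
        ≤ sobolevSq (val Ω u) + t ^ 2 / 12 * ((d + 1) * sobolevSq (val Ω u)) := by gcongr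
      _ = (1 + t ^ 2 / 12 * (d + 1)) * sobolevSq (val Ω u) := by ring
      _ ≤ (1 + t ^ 2 / 12 * (d + 1)) * (C * ‖u‖ ^ 2) := by gcongr; exact hS u
      _ = _ := by ring
  let J : EnergyHilbert Ω →L[ℝ] PiLp 2 (fun _ : Option (Fin (d + 1)) => L2 Ω) :=
    ((pivotMap t Ω).comp (val Ω)).mkContinuous _ hMn
  have hJ : ∀ u v, inner ℝ (J u) (J v) = formM t (val Ω u) (val Ω v) := fun u v =>
    inner_pivotMap t _ _
  have hJc : IsCompactOperator J := by
    refine isCompactOperator_of_forall_functionals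
      (κ := (Fin (d + 1) → ℤ) × Option (Fin (d + 1))) J fun δ hδ => ?_
    -- the weight makes the sum over all components at most `δ² ‖u‖²`
    obtain ⟨η, hη, hηδ⟩ : ∃ η, 0 < η ∧ η * (C * (1 + t ^ 2 / 12 * (d + 1))) ≤ δ ^ 2 := by
      refine ⟨δ ^ 2 / (C * (1 + t ^ 2 / 12 * (d + 1))), by positivity, ?_⟩
      rw [div_mul_cancel₀]
      positivity
    obtain ⟨T, a, ha⟩ := exists_functionals_norm_fst_sq_le hR hη
    refine ⟨T ×ˢ Finset.univ, fun κ => (innerSL ℝ (a κ.1)).comp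
      ((PiLp.proj 2 (fun _ : Option (Fin (d + 1)) => L2 Ω) κ.2 : _ →L[ℝ] L2 Ω).comp J),
      fun u => ?_⟩
    have hu := mem_energySpace.1 u.val_mem
    obtain ⟨-, -, q1, q2⟩ := hSum (val Ω u)
    have e0 : ‖defl (val Ω u)‖ ^ 2 ≤ η * sobolevSq (val Ω u) +
        ∑ m ∈ T, (inner ℝ (a m) (defl (val Ω u))) ^ 2 := by
      exact (ha _ hu.2).trans (add_le_add_left (mul_le_mul_of_nonneg_left q2 hη.le) _)
    have e1 : ∀ i, t ^ 2 / 12 * ‖rot (val Ω u) i‖ ^ 2 ≤ t ^ 2 / 12 * (η * sobolevSq (val Ω u)) +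
        ∑ m ∈ T, (inner ℝ (a m) ((t / Real.sqrt 12) • rot (val Ω u) i)) ^ 2 := by
      intro i
      have h1 : ∑ m ∈ T, (inner ℝ (a m) ((t / Real.sqrt 12) • rot (val Ω u) i)) ^ 2 =
          t ^ 2 / 12 * ∑ m ∈ T, (inner ℝ (a m) (rot (val Ω u) i)) ^ 2 := by
        rw [Finset.mul_sum]
        refine Finset.sum_congr rfl fun m _ => ?_
        rw [real_inner_smul_right, mul_pow, div_pow, Real.sq_sqrt (by norm_num)]
      rw [h1, ← mul_add]
      exact mul_le_mul_of_nonneg_left ((ha _ (hu.1 i)).trans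
        (add_le_add_left (mul_le_mul_of_nonneg_left (q1 i) hη.le) _)) (by positivity)
    have e2 : ‖J u‖ ^ 2 = ‖defl (val Ω u)‖ ^ 2 + ∑ i, t ^ 2 / 12 * ‖rot (val Ω u) i‖ ^ 2 := by
      rw [← real_inner_self_eq_norm_sq, hJ, formM_self, Finset.mul_sum]
    have e3 : ∑ κ ∈ T ×ˢ Finset.univ, ((innerSL ℝ (a κ.1)).comp
        ((PiLp.proj 2 (fun _ : Option (Fin (d + 1)) => L2 Ω) κ.2 : _ →L[ℝ] L2 Ω).comp J) u) ^ 2 =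
        ∑ m ∈ T, (inner ℝ (a m) (defl (val Ω u))) ^ 2 +
          ∑ i, ∑ m ∈ T, (inner ℝ (a m) ((t / Real.sqrt 12) • rot (val Ω u) i)) ^ 2 := by
      rw [Finset.sum_product_right, Fintype.sum_option]
      rfl
    rw [e2, e3]
    have e4 := Finset.sum_le_sum fun i (_ : i ∈ Finset.univ) => e1 i
    rw [Finset.sum_add_distrib, Finset.sum_const, Finset.card_univ, Fintype.card_fin,
      nsmul_eq_mul] at e4
    push_cast at e4
    have e5 : η * sobolevSq (val Ω u) + (d + 1) * (t ^ 2 / 12 * (η * sobolevSq (val Ω u))) ≤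
        δ ^ 2 * ‖u‖ ^ 2 := by
      calc _ = η * (1 + t ^ 2 / 12 * (d + 1)) * sobolevSq (val Ω u) := by ring
        _ ≤ η * (1 + t ^ 2 / 12 * (d + 1)) * (C * ‖u‖ ^ 2) := by gcongr; exact hS u
        _ = η * (C * (1 + t ^ 2 / 12 * (d + 1))) * ‖u‖ ^ 2 := by ring
        _ ≤ _ := by gcongr
    linarith
  let L' : (Fin n → ℝ) →ₗ[ℝ] EnergyHilbert Ω := L.codRestrict (energySpace Ω) hLV
  have hL' : ∀ c, val Ω (L' c) = L c := fun _ => rfl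
  have hL'inj : Function.Injective L' := fun c c' hc => hL (congrArg (val Ω) hc)
  have hmain := natCast_le_rank_iSup_embEigenspace hJc L' hL'inj hγ fun c => by
    rw [hnorm, ← real_inner_self_eq_norm_sq (J _), hJ, hL']
    exact h c
  refine hmain.trans ?_
  rw [← rank_map_eq (val_injective Ω)]
  refine Submodule.rank_mono ?_
  simp only [Submodule.map_iSup]
  refine iSup₂_mono fun μ _ => ?_
  rintro _ ⟨u, hu, rfl⟩
  refine ⟨u.val_mem, fun Z hZ => ?_⟩
  obtain ⟨z, rfl⟩ := exists_val_eq hZ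
  have := mem_embEigenspace.1 hu z
  rwa [hin, hJ] at this

end MinMax

section Trial

/-- The Rayleigh quotient `Q / M` is at most `γ` on some `n`-dimensional subspace of the energy
space. -/
def HasTrialSpace (lam mu k t : ℝ) {N : ℕ} (Ω : Opens (E N)) (n : ℕ) (γ : ℝ) : Prop :=
  ∃ L : (Fin n → ℝ) →ₗ[ℝ] State Ω, Function.Injective L ∧ (∀ c, L c ∈ energySpace Ω) ∧
    ∀ c, formQ lam mu k t (L c) (L c) ≤ γ * formM t (L c) (L c)

variable {d : ℕ} {Ω : Opens (E (d + 1))} {R lam mu k t : ℝ} {n : ℕ} {γ : ℝ}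

theorem hasTrialSpace_of_le_rank
    (h : (n : Cardinal) ≤ Module.rank ℝ ↥(⨆ (μ : ℝ) (_ : μ ≤ γ), eigenspace lam mu k t Ω μ)) :
    HasTrialSpace lam mu k t Ω n γ := by
  obtain ⟨f, hf⟩ := Module.le_rank_iff_exists_linearMap.1 h
  have hmem : ∀ u ∈ ⨆ (μ : ℝ) (_ : μ ≤ γ), eigenspace lam mu k t Ω μ,
      u ∈ energySpace Ω ∧ formQ lam mu k t u u ≤ γ * formM t u u := fun u hu =>
    form_le_of_mem_iSup (bilinQ lam mu k t Ω) (bilinM t Ω) (formQ_comm lam mu k t) (formM_comm t)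
      (formM_self_nonneg t) (energySpace Ω) (eigenspace lam mu k t Ω) (fun _ _ hu => hu) hu
  exact ⟨(Submodule.subtype _).comp f, Subtype.val_injective.comp hf,
    fun c => (hmem _ (f c).2).1, fun c => (hmem _ (f c).2).2⟩

theorem nonneg_of_natCast_le_rank (hR : (Ω : Set (E (d + 1))) ⊆ Metric.closedBall 0 R)
    (hlam : 0 < lam) (hmu : 0 < mu) (hk : 0 < k) (ht : 0 < t) (hn : 1 ≤ n)
    (h : (n : Cardinal) ≤ Module.rank ℝ ↥(⨆ (μ : ℝ) (_ : μ ≤ γ), eigenspace lam mu k t Ω μ)) :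
    0 ≤ γ := by
  obtain ⟨L, hL, hLV, hQ⟩ := hasTrialSpace_of_le_rank h
  by_contra! hneg
  have h1 : L (Pi.single ⟨0, hn⟩ 1) = 0 := by
    refine eq_zero_of_formQ_self_nonpos hR hlam hmu hk ht (hLV _) ((hQ _).trans ?_)
    exact mul_nonpos_of_nonpos_of_nonneg hneg.le (formM_self_nonneg _ _)
  have h2 := hL (h1.trans (map_zero L).symm)
  have h3 := congrFun h2 ⟨0, hn⟩
  simp at h3

theorem eigenvalue_nonneg (hR : (Ω : Set (E (d + 1))) ⊆ Metric.closedBall 0 R)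
    (hlam : 0 < lam) (hmu : 0 < mu) (hk : 0 < k) (ht : 0 < t) (hn : 1 ≤ n) :
    0 ≤ eigenvalue lam mu k t Ω n :=
  Real.sInf_nonneg fun _ h => nonneg_of_natCast_le_rank hR hlam hmu hk ht hn h

theorem eigenvalue_le_of_hasTrialSpace (hR : (Ω : Set (E (d + 1))) ⊆ Metric.closedBall 0 R)
    (hlam : 0 < lam) (hmu : 0 < mu) (hk : 0 < k) (ht : 0 < t) (hn : 1 ≤ n)
    (h : HasTrialSpace lam mu k t Ω n γ) : eigenvalue lam mu k t Ω n ≤ γ := by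
  obtain ⟨L, hL, hLV, hQ⟩ := h
  refine le_of_forall_gt_imp_ge_of_dense fun γ' hγ' => ?_
  exact csInf_le ⟨0, fun _ h => nonneg_of_natCast_le_rank hR hlam hmu hk ht hn h⟩
    (natCast_le_rank_iSup_eigenspace hR hlam hmu hk ht L hL hLV hγ' hQ)

/-- A nonempty open set carries any number of nonzero test functions with disjoint supports. -/
theorem exists_testFunctions_disjoint (hΩ : (Ω : Set (E (d + 1))).Nonempty) (n : ℕ) :
    ∃ φ : Fin n → 𝓓(Ω, ℝ), (∀ i, ∃ x, φ i x ≠ 0) ∧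
      ∀ i j, i ≠ j → Disjoint (tsupport (φ i)) (tsupport (φ j)) := by
  obtain ⟨x, hx⟩ := hΩ
  have hinf : (Ω : Set (E (d + 1))).Infinite := infinite_of_mem_nhds x (Ω.isOpen.mem_nhds hx)
  obtain ⟨s, hsΩ, hs⟩ := hinf.exists_subset_card_eq n
  obtain ⟨U, hU, hdisj⟩ := s.finite_toSet.t2_separation
  let e : Fin n ≃ s := (s.equivFinOfCardEq hs).symm
  have hφ : ∀ i : Fin n, ∃ φ : 𝓓(Ω, ℝ), φ (e i) ≠ 0 ∧ tsupport φ ⊆ U (e i) := by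
    intro i
    obtain ⟨f, h1, h2, h3, -, h4⟩ := exists_contDiff_tsupport_subset (n := ⊤)
      (((hU (e i)).2.inter Ω.isOpen).mem_nhds ⟨(hU (e i)).1, hsΩ (e i).2⟩)
    refine ⟨⟨f, h3, h2, h1.trans inter_subset_right⟩, ?_, h1.trans inter_subset_left⟩
    change f (e i) ≠ 0
    rw [h4]
    exact one_ne_zero
  choose φ h1 h2 using hφ
  refine ⟨φ, fun i => ⟨_, h1 i⟩, fun i j hij => ?_⟩
  refine (hdisj (e i).2 (e j).2 ?_).mono (h2 i) (h2 j)
  exact fun h => hij (e.injective (Subtype.ext h))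

/-- On the span of vectors that are orthogonal for two forms `Q` and `M`, the Rayleigh quotient
`Q / M` is bounded. -/
theorem exists_form_le_of_orthogonal {X : Type*} [AddCommGroup X] [Module ℝ X]
    (Q M : X →ₗ[ℝ] X →ₗ[ℝ] ℝ) (u : Fin n → X) (hQ : ∀ i j, i ≠ j → Q (u i) (u j) = 0)
    (hM : ∀ i j, i ≠ j → M (u i) (u j) = 0) (hQ0 : ∀ i, 0 ≤ Q (u i) (u i))
    (hMpos : ∀ i, 0 < M (u i) (u i)) :
    ∃ (L : (Fin n → ℝ) →ₗ[ℝ] X) (γ : ℝ), Function.Injective L ∧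
      (∀ V : Submodule ℝ X, (∀ i, u i ∈ V) → ∀ c, L c ∈ V) ∧
        ∀ c, Q (L c) (L c) ≤ γ * M (L c) (L c) := by
  have hdiag : ∀ B : X →ₗ[ℝ] X →ₗ[ℝ] ℝ, (∀ i j, i ≠ j → B (u i) (u j) = 0) →
      ∀ c : Fin n → ℝ, B (Fintype.linearCombination ℝ u c) (Fintype.linearCombination ℝ u c) =
        ∑ i, c i ^ 2 * B (u i) (u i) := by
    intro B hB c
    simp only [Fintype.linearCombination_apply, map_sum, LinearMap.sum_apply, map_smul,
      LinearMap.smul_apply, smul_eq_mul]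
    refine Finset.sum_congr rfl fun i _ => ?_
    rw [Finset.sum_eq_single i (fun j _ hj => by rw [hB _ _ hj]; ring)
      (fun h => absurd (Finset.mem_univ i) h)]
    ring
  have hMd := hdiag M hM
  have hQd := hdiag Q hQ
  refine ⟨Fintype.linearCombination ℝ u, ∑ i, Q (u i) (u i) / M (u i) (u i), ?_, fun V hV c => ?_,
    fun c => ?_⟩
  · rw [← LinearMap.ker_eq_bot, LinearMap.ker_eq_bot']
    intro c hc
    have h1 := hMd c
    rw [hc, map_zero] at h1
    have h2 := (Finset.sum_eq_zero_iff_of_nonneg fun i _ =>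
      mul_nonneg (sq_nonneg (c i)) (hMpos i).le).1 h1.symm
    ext i
    have h4 := (mul_eq_zero.1 (h2 i (Finset.mem_univ i))).resolve_right (hMpos i).ne'
    simpa using h4
  · rw [Fintype.linearCombination_apply]
    exact Submodule.sum_mem _ fun i _ => Submodule.smul_mem _ _ (hV i)
  · rw [hMd, hQd, Finset.mul_sum]
    refine Finset.sum_le_sum fun i _ => ?_
    have h1 : Q (u i) (u i) / M (u i) (u i) ≤ ∑ i, Q (u i) (u i) / M (u i) (u i) :=
      Finset.single_le_sum (f := fun i => Q (u i) (u i) / M (u i) (u i))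
        (fun i _ => div_nonneg (hQ0 i) (hMpos i).le) (Finset.mem_univ i)
    rw [div_le_iff₀ (hMpos i)] at h1
    exact (mul_le_mul_of_nonneg_left h1 (sq_nonneg (c i))).trans_eq (by ring)

/-- Trial spaces of every dimension exist: the states `(0, φ_i)` with test functions `φ_i` of
disjoint supports are orthogonal for both forms. -/
theorem exists_hasTrialSpace (hR : (Ω : Set (E (d + 1))) ⊆ Metric.closedBall 0 R)
    (hΩ : (Ω : Set (E (d + 1))).Nonempty)
    (hlam : 0 < lam) (hmu : 0 < mu) (hk : 0 < k) (ht : 0 < t) (n : ℕ) :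
    ∃ γ, HasTrialSpace lam mu k t Ω n γ := by
  obtain ⟨φ, hφ0, hφd⟩ := exists_testFunctions_disjoint hΩ n
  let u : Fin n → State Ω := fun i => (0, testPair (φ i))
  have hu : ∀ i, u i ∈ energySpace Ω := fun i =>
    mem_energySpace.2 ⟨fun _ => Submodule.zero_mem _, testPair_mem_H10 _⟩
  have hzero : ∀ (f g : E (d + 1) → ℝ), (∀ x, f x * g x = 0) →
      ∫ x in (Ω : Set (E (d + 1))), f x * g x = 0 := fun f g h => by simp [h]
  have hM : ∀ i j, i ≠ j → formM t (u i) (u j) = 0 := by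
    intro i j hij
    have h1 : inner ℝ (defl (u i)) (defl (u j)) = (0 : ℝ) := by
      refine (inner_toLp_eq_integral (memLp_testFunction (φ i)) (memLp_testFunction (φ j))).trans
        (hzero _ _ fun x => ?_)
      by_cases hx : x ∈ tsupport (φ i)
      · rw [image_eq_zero_of_notMem_tsupport ((hφd i j hij).notMem_of_mem_left hx), mul_zero]
      · rw [image_eq_zero_of_notMem_tsupport hx, zero_mul]
    have h2 : ∀ l, inner ℝ (rot (u i) l) (rot (u j) l) = (0 : ℝ) := fun l =>
      inner_zero_left (0 : L2 Ω)
    rw [formM, h1, Finset.sum_eq_zero fun l _ => h2 l, mul_zero, add_zero]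
  have hQ : ∀ i j, i ≠ j → formQ lam mu k t (u i) (u j) = 0 := by
    intro i j hij
    have h1 : ∀ l, inner ℝ (dDefl (u i) l - rot (u i) l) (dDefl (u j) l - rot (u j) l) =
        (0 : ℝ) := by
      intro l
      have h2 : ∀ i, dDefl (u i) l - rot (u i) l = (memLp_partialD (φ i) l).toLp := fun i =>
        sub_zero _
      rw [h2, h2]
      refine (inner_toLp_eq_integral _ _).trans (hzero _ _ fun x => ?_)
      by_cases hx : x ∈ tsupport (φ i)
      · rw [partialD_eq_zero_of_notMem_tsupport ((hφd i j hij).notMem_of_mem_left hx), mul_zero]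
      · rw [partialD_eq_zero_of_notMem_tsupport hx, zero_mul]
    have h3 : ∀ l m, inner ℝ (dRot (u i) l m) (dRot (u j) l m) = (0 : ℝ) := fun l m =>
      inner_zero_left (0 : L2 Ω)
    have h4 : divRot (u i) = 0 := Finset.sum_eq_zero fun l _ => rfl
    rw [formQ, Finset.sum_eq_zero fun l _ => Finset.sum_eq_zero fun m _ => h3 l m, h4,
      inner_zero_left, Finset.sum_eq_zero fun l _ => h1 l]
    simp only [mul_zero, add_zero]
  have hMpos : ∀ i, 0 < formM t (u i) (u i) := by
    intro i
    obtain ⟨x, hx⟩ := hφ0 i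
    have h1 : 0 < ∫ x, φ i x ^ 2 :=
      (((φ i).continuous.pow 2).integral_pos_of_hasCompactSupport_nonneg_nonzero
        (by simpa only [sq] using! (φ i).hasCompactSupport.mul_left (f := φ i))
        (fun _ => sq_nonneg _) (x := x) (by positivity))
    rw [formM_self]
    have h2 : ‖defl (u i)‖ ^ 2 = ∫ x, φ i x ^ 2 := norm_testPair_fst_sq (φ i)
    have h3 : 0 ≤ t ^ 2 / 12 := by positivity
    refine add_pos_of_pos_of_nonneg (h2 ▸ h1) (mul_nonneg h3 ?_)
    exact sum_sq_nonneg fun j => ‖rot (u i) j‖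
  have hQ0 : ∀ i, 0 ≤ formQ lam mu k t (u i) (u i) := fun i =>
    formQ_self_nonneg hR hlam hmu hk ht (hu i)
  obtain ⟨L, γ, hL, hLu, hLQ⟩ := exists_form_le_of_orthogonal (bilinQ lam mu k t Ω)
    (bilinM t Ω) u hQ hM hQ0 hMpos
  exact ⟨γ, L, hL, fun c => hLu _ hu c, hLQ⟩

/-- Every number larger than the `n`-th eigenvalue bounds the Rayleigh quotient on some
`n`-dimensional space. -/
theorem hasTrialSpace_of_eigenvalue_lt (hR : (Ω : Set (E (d + 1))) ⊆ Metric.closedBall 0 R)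
    (hΩ : (Ω : Set (E (d + 1))).Nonempty)
    (hlam : 0 < lam) (hmu : 0 < mu) (hk : 0 < k) (ht : 0 < t)
    (h : eigenvalue lam mu k t Ω n < γ) : HasTrialSpace lam mu k t Ω n γ := by
  have hne : {γ : ℝ | (n : Cardinal) ≤
      Module.rank ℝ ↥(⨆ (γ' : ℝ) (_ : γ' ≤ γ), eigenspace lam mu k t Ω γ')}.Nonempty := by
    obtain ⟨γ₀, L, hL, hLV, hQ⟩ := exists_hasTrialSpace hR hΩ hlam hmu hk ht n
    exact ⟨γ₀ + 1,
      natCast_le_rank_iSup_eigenspace hR hlam hmu hk ht L hL hLV (lt_add_one γ₀) hQ⟩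
  obtain ⟨γ₁, h1, h2⟩ := exists_lt_of_csInf_lt hne h
  refine hasTrialSpace_of_le_rank (h1.trans (Submodule.rank_mono ?_))
  exact iSup₂_mono' fun μ hμ => ⟨μ, hμ.trans h2.le, le_rfl⟩

end Trial

/-! ### Perturbations of the identity -/

section Shift

open scoped NNReal

variable {N : ℕ}

/-- The perturbation `z ↦ z + h X(z)` of the identity. -/
def shift (X : E N → E N) (h : ℝ) (z : E N) : E N := z + h • X z

variable {X : E N → E N} {K : ℝ≥0} {h : ℝ}

theorem lipschitzWith_smul_field (hX : LipschitzWith K X) (hh : 0 ≤ h) :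
    LipschitzWith (h.toNNReal * K) fun z => h • X z := by
  have h1 : ‖h‖₊ = h.toNNReal := by
    ext
    simp [hh, abs_of_nonneg hh]
  exact h1 ▸ (lipschitzWith_smul h).comp hX

theorem lipschitzWith_shift (hX : LipschitzWith K X) (hh : 0 ≤ h) :
    LipschitzWith (1 + h.toNNReal * K) (shift X h) :=
  LipschitzWith.id.add (lipschitzWith_smul_field hX hh)

theorem antilipschitzWith_shift (hX : LipschitzWith K X) (hh : 0 ≤ h)
    (hK : h.toNNReal * K < 1) : AntilipschitzWith (1 - h.toNNReal * K)⁻¹ (shift X h) := by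
  have h1 := AntilipschitzWith.id.add_lipschitzWith (lipschitzWith_smul_field hX hh)
    (by simpa using hK)
  rw [inv_one] at h1
  exact h1

/-- Preimages are the fixed points of the contraction `z ↦ y - h X(z)`. -/
theorem surjective_shift (hX : LipschitzWith K X) (hh : 0 ≤ h) (hK : h.toNNReal * K < 1) :
    Function.Surjective (shift X h) := by
  intro y
  have h1 : ContractingWith (h.toNNReal * K) fun z => y - h • X z := by
    refine ⟨hK, ?_⟩
    simpa using (LipschitzWith.const y).sub (lipschitzWith_smul_field hX hh)
  refine ⟨h1.fixedPoint, ?_⟩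
  have h2 := h1.fixedPoint_isFixedPt
  have h3 : y - h • X h1.fixedPoint = h1.fixedPoint := h2
  rw [shift]
  nth_rewrite 1 [← h3]
  abel

/-- Lebesgue measure is a multiple of the Hausdorff measure, whose behaviour under Lipschitz maps is
known. -/
theorem exists_volume_eq_smul_hausdorffMeasure (N : ℕ) :
    ∃ c : ℝ≥0, (volume : Measure (E N)) = c • Measure.hausdorffMeasure (N : ℝ) :=
  ⟨_, Measure.isAddLeftInvariant_eq_smul _ _⟩

theorem volume_preimage_shift_le (hX : LipschitzWith K X) (hh : 0 ≤ h)
    (hK : h.toNNReal * K < 1) (s : Set (E N)) :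
    volume (shift X h ⁻¹' s) ≤ (((1 - h.toNNReal * K)⁻¹ : ℝ≥0) : ℝ≥0∞) ^ N * volume s := by
  obtain ⟨c, hc⟩ := exists_volume_eq_smul_hausdorffMeasure N
  have h1 := (antilipschitzWith_shift hX hh hK).hausdorffMeasure_preimage_le
    (d := (N : ℝ)) N.cast_nonneg s
  rw [ENNReal.rpow_natCast] at h1
  rw [hc, Measure.smul_apply, Measure.smul_apply, mul_smul_comm]
  gcongr

theorem volume_le_preimage_shift (hX : LipschitzWith K X) (hh : 0 ≤ h)
    (hK : h.toNNReal * K < 1) (s : Set (E N)) :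
    volume s ≤ ((1 + h.toNNReal * K : ℝ≥0) : ℝ≥0∞) ^ N * volume (shift X h ⁻¹' s) := by
  obtain ⟨c, hc⟩ := exists_volume_eq_smul_hausdorffMeasure N
  have h1 := (lipschitzWith_shift hX hh).hausdorffMeasure_image_le
    (d := (N : ℝ)) N.cast_nonneg (shift X h ⁻¹' s)
  rw [ENNReal.rpow_natCast, image_preimage_eq _ (surjective_shift hX hh hK)] at h1
  rw [hc, Measure.smul_apply, Measure.smul_apply, mul_smul_comm]
  gcongr

/-- By convexity, `(1 + h a)^n` lies below its chord over `0 ≤ h ≤ 1`. -/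
theorem one_add_mul_pow_le {a h : ℝ} (ha : 0 ≤ a) (hh : 0 ≤ h) (hh1 : h ≤ 1) (n : ℕ) :
    (1 + h * a) ^ n ≤ 1 + h * ((1 + a) ^ n - 1) := by
  induction n with
  | zero => simp
  | succ n ih =>
    have h1 : 1 ≤ (1 + a) ^ n := one_le_pow₀ (by linarith)
    calc (1 + h * a) ^ (n + 1) = (1 + h * a) ^ n * (1 + h * a) := pow_succ _ _
      _ ≤ (1 + h * ((1 + a) ^ n - 1)) * (1 + h * a) := by gcongr
      _ = 1 + h * (((1 + a) ^ n - 1) + a) + h * h * (((1 + a) ^ n - 1) * a) := by ring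
      _ ≤ 1 + h * (((1 + a) ^ n - 1) + a) + h * 1 * (((1 + a) ^ n - 1) * a) := by
        have h2 : 0 ≤ ((1 + a) ^ n - 1) * a := mul_nonneg (by linarith) ha
        gcongr
      _ = _ := by ring

/-- A perturbation of the identity of size `h` changes integrals by a factor `1 + O(h)`. The
condition `h K ≤ 1 / 2` bounds the Lipschitz constant `(1 - h K)⁻¹` of the inverse by
`1 + 2 h K`. -/
theorem exists_integral_comp_shift_bounds (N : ℕ) (K : ℝ≥0) :
    ∃ C : ℝ, 0 < C ∧ ∀ (X : E N → E N) (h : ℝ), LipschitzWith K X → 0 ≤ h → h ≤ 1 →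
      h * K ≤ 1 / 2 → ∀ F : E N → ℝ, Continuous F → HasCompactSupport F → (∀ x, 0 ≤ F x) →
        ∫ z, F (shift X h z) ≤ (1 + C * h) * ∫ x, F x ∧
          (1 - C * h) * ∫ x, F x ≤ ∫ z, F (shift X h z) := by
  refine ⟨(1 + 2 * K) ^ N, by positivity, fun X h hX hh hh1 hhK F hF hFs hF0 => ?_⟩
  have hK : h.toNNReal * K < 1 := by
    rw [← NNReal.coe_lt_coe]
    push_cast
    rw [Real.coe_toNNReal h hh]
    linarith
  have hcont : Continuous (shift X h) := (lipschitzWith_shift hX hh).continuous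
  have hmeas := hcont.measurable
  have hFi : Integrable F := hF.integrable_of_hasCompactSupport hFs
  have hmap : ∫ z, F (shift X h z) = ∫ x, F x ∂(volume.map (shift X h)) :=
    (integral_map hmeas.aemeasurable hF.aestronglyMeasurable).symm
  have hle1 : volume.map (shift X h) ≤
      ((((1 - h.toNNReal * K)⁻¹ : ℝ≥0) : ℝ≥0∞) ^ N) • (volume : Measure (E N)) := by
    refine Measure.le_iff.2 fun s hs => ?_
    rw [Measure.map_apply hmeas hs]
    exact volume_preimage_shift_le hX hh hK s
  have hle2 : (volume : Measure (E N)) ≤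
      (((1 + h.toNNReal * K : ℝ≥0) : ℝ≥0∞) ^ N) • volume.map (shift X h) := by
    refine Measure.le_iff.2 fun s hs => ?_
    rw [Measure.smul_apply, Measure.map_apply hmeas hs]
    exact volume_le_preimage_shift hX hh hK s
  have hne : ∀ r : ℝ≥0, (r : ℝ≥0∞) ^ N ≠ ∞ := fun r => ENNReal.pow_ne_top ENNReal.coe_ne_top
  have hFmap : Integrable F (volume.map (shift X h)) :=
    (hFi.smul_measure (hne _)).mono_measure hle1
  have hI0 : 0 ≤ ∫ x, F x := integral_nonneg hF0
  have hI1 : 0 ≤ ∫ z, F (shift X h z) := integral_nonneg fun _ => hF0 _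
  have hupper : ∀ a : ℝ, 0 ≤ a → a ≤ 2 * K → (1 + h * a) ^ N ≤ 1 + (1 + 2 * K) ^ N * h := by
    intro a ha ha2
    refine (one_add_mul_pow_le ha hh hh1 N).trans ?_
    have : (1 + a) ^ N ≤ (1 + 2 * K) ^ N := by gcongr
    nlinarith
  constructor
  · have h1 := integral_mono_measure hle1 (Filter.Eventually.of_forall hF0)
      (hFi.smul_measure (hne _))
    rw [integral_smul_measure, ← hmap, smul_eq_mul, ENNReal.toReal_pow, ENNReal.coe_toReal] at h1
    refine h1.trans (mul_le_mul_of_nonneg_right ?_ hI0)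
    refine le_trans ?_ (hupper (2 * K) (by positivity) le_rfl)
    gcongr
    rw [NNReal.coe_inv, NNReal.coe_sub hK.le]
    push_cast
    rw [Real.coe_toNNReal h hh]
    have hK0 : (0 : ℝ) ≤ K := K.2
    have hhK0 : 0 ≤ h * K := mul_nonneg hh hK0
    rw [inv_le_iff_one_le_mul₀ (by linarith)]
    nlinarith
  · have h1 := integral_mono_measure hle2 (Filter.Eventually.of_forall hF0)
      (hFmap.smul_measure (hne _))
    rw [integral_smul_measure, ← hmap, smul_eq_mul, ENNReal.toReal_pow, ENNReal.coe_toReal] at h1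
    push_cast at h1
    rw [Real.coe_toNNReal h hh] at h1
    have hK0 : (0 : ℝ) ≤ K := K.2
    have h2 := hupper K hK0 (by linarith)
    set C := (1 + 2 * (K : ℝ)) ^ N with hC
    have hC0 : 0 ≤ C := by positivity
    have h3 : ∫ x, F x ≤ (1 + C * h) * ∫ z, F (shift X h z) :=
      h1.trans (mul_le_mul_of_nonneg_right h2 hI1)
    rcases le_or_gt (C * h) 1 with h4 | h4
    · calc (1 - C * h) * ∫ x, F x ≤ (1 - C * h) * ((1 + C * h) * ∫ z, F (shift X h z)) := by
            gcongr
        _ = (1 - (C * h) ^ 2) * ∫ z, F (shift X h z) := by ring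
        _ ≤ 1 * ∫ z, F (shift X h z) := by
            gcongr
            nlinarith [sq_nonneg (C * h)]
        _ = _ := one_mul _
    · exact (mul_nonpos_of_nonpos_of_nonneg (by linarith) hI0).trans hI1

end Shift

/-! ### Pointwise bounds for the transplanted densities -/

section Algebra

variable {N : ℕ} {h B : ℝ}

theorem sq_add_mul_le (hh : 0 ≤ h) (hh1 : h ≤ 1) (a r : ℝ) :
    (a + h * r) ^ 2 ≤ (1 + h) * a ^ 2 + 2 * h * r ^ 2 := by
  nlinarith [mul_nonneg hh (sq_nonneg (a - r)),
    mul_nonneg (mul_nonneg hh (sub_nonneg.2 hh1)) (sq_nonneg r)]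

theorem le_sq_add_mul (hh : 0 ≤ h) (a r : ℝ) :
    (1 - h) * a ^ 2 - h * r ^ 2 ≤ (a + h * r) ^ 2 := by
  nlinarith [mul_nonneg hh (sq_nonneg (a + r)), mul_nonneg (mul_nonneg hh hh) (sq_nonneg r)]

theorem sq_sum_mul_le (x v : Fin N → ℝ) (hx : ∀ j, |x j| ≤ B) :
    (∑ j, x j * v j) ^ 2 ≤ N * B ^ 2 * ∑ j, v j ^ 2 := by
  refine (Finset.sum_mul_sq_le_sq_mul_sq _ _ _).trans
    (mul_le_mul_of_nonneg_right ?_ (sum_sq_nonneg v))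
  calc ∑ j, x j ^ 2 ≤ ∑ _j : Fin N, B ^ 2 :=
        Finset.sum_le_sum fun j _ => sq_le_sq' (abs_le.1 (hx j)).1 (abs_le.1 (hx j)).2
    _ = N * B ^ 2 := by simp

theorem sum_sq_add_mul_le (hh : 0 ≤ h) (hh1 : h ≤ 1) (x : Fin N → Fin N → ℝ)
    (hx : ∀ i j, |x i j| ≤ B) (v : Fin N → ℝ) :
    ∑ i, (v i + h * ∑ j, x i j * v j) ^ 2 ≤ (1 + h * (1 + 2 * N ^ 2 * B ^ 2)) * ∑ i, v i ^ 2 := by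
  calc ∑ i, (v i + h * ∑ j, x i j * v j) ^ 2
      ≤ ∑ i, ((1 + h) * v i ^ 2 + 2 * h * (N * B ^ 2 * ∑ j, v j ^ 2)) := by
        refine Finset.sum_le_sum fun i _ => (sq_add_mul_le hh hh1 _ _).trans ?_
        gcongr
        exact sq_sum_mul_le _ _ (hx i)
    _ = _ := by
        rw [Finset.sum_add_distrib, ← Finset.mul_sum, Finset.sum_const, Finset.card_univ,
          Fintype.card_fin, nsmul_eq_mul]
        ring

theorem le_sum_sq_add_mul (hh : 0 ≤ h) (x : Fin N → Fin N → ℝ)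
    (hx : ∀ i j, |x i j| ≤ B) (v : Fin N → ℝ) :
    (1 - h * (1 + N ^ 2 * B ^ 2)) * ∑ i, v i ^ 2 ≤ ∑ i, (v i + h * ∑ j, x i j * v j) ^ 2 := by
  calc (1 - h * (1 + N ^ 2 * B ^ 2)) * ∑ i, v i ^ 2
      = ∑ i, ((1 - h) * v i ^ 2 - h * (N * B ^ 2 * ∑ j, v j ^ 2)) := by
        rw [Finset.sum_sub_distrib, ← Finset.mul_sum, Finset.sum_const, Finset.card_univ,
          Fintype.card_fin, nsmul_eq_mul]
        ring
    _ ≤ _ := by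
        refine Finset.sum_le_sum fun i _ => le_trans ?_ (le_sq_add_mul hh _ _)
        gcongr
        exact sq_sum_mul_le _ _ (hx i)

/-- The first-order remainder of the derivative `∂_k` of the transplanted `β_i`, where `b` and `g`
are the values of `β` and `∇β`, and `x`, `y` those of the first and second derivatives of the
vector field. -/
def remainder (h : ℝ) (x : Fin N → Fin N → ℝ) (y : Fin N → Fin N → Fin N → ℝ) (b : Fin N → ℝ)
    (g : Fin N → Fin N → ℝ) (i k : Fin N) : ℝ :=
  ∑ l, x k l * g i l + ∑ j, y k i j * b j + ∑ j, x i j * g j k +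
    h * ∑ j, x i j * ∑ l, x k l * g j l

theorem sq_remainder_le (hh : 0 ≤ h) (hh1 : h ≤ 1) {x : Fin N → Fin N → ℝ}
    (hx : ∀ i j, |x i j| ≤ B) {y : Fin N → Fin N → Fin N → ℝ} (hy : ∀ i j k, |y i j k| ≤ B)
    (b : Fin N → ℝ) (g : Fin N → Fin N → ℝ) (i k : Fin N) :
    remainder h x y b g i k ^ 2 ≤
      4 * (3 * (N * B ^ 2) + (N * B ^ 2) ^ 2) * (∑ j, b j ^ 2 + ∑ j, ∑ l, g j l ^ 2) := by
  set P := (N : ℝ) * B ^ 2 with hP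
  have hP0 : 0 ≤ P := by positivity
  set G := ∑ j, ∑ l, g j l ^ 2 with hG
  set b2 := ∑ j, b j ^ 2 with hb2
  have hG0 : 0 ≤ G := sum_sum_sq_nonneg g
  have hb0 : 0 ≤ b2 := sum_sq_nonneg b
  have h1 : (∑ l, x k l * g i l) ^ 2 ≤ P * G := by
    refine (sq_sum_mul_le _ _ (hx k)).trans (mul_le_mul_of_nonneg_left ?_ hP0)
    exact Finset.single_le_sum (f := fun i => ∑ l, g i l ^ 2) (fun i _ => sum_sq_nonneg (g i))
      (Finset.mem_univ i)
  have h2 : (∑ j, y k i j * b j) ^ 2 ≤ P * b2 := sq_sum_mul_le _ _ (hy k i)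
  have h3 : (∑ j, x i j * g j k) ^ 2 ≤ P * G := by
    refine (sq_sum_mul_le _ _ (hx i)).trans (mul_le_mul_of_nonneg_left ?_ hP0)
    exact Finset.sum_le_sum fun j _ => sq_le_sum_sq (g j) k
  have h4 : (h * ∑ j, x i j * ∑ l, x k l * g j l) ^ 2 ≤ P ^ 2 * G := by
    have h5 : (∑ j, x i j * ∑ l, x k l * g j l) ^ 2 ≤ P * (P * G) := by
      refine (sq_sum_mul_le _ _ (hx i)).trans (mul_le_mul_of_nonneg_left ?_ hP0)
      rw [hG, Finset.mul_sum]
      exact Finset.sum_le_sum fun j _ => sq_sum_mul_le _ _ (hx k)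
    have h6 : h ^ 2 ≤ 1 := pow_le_one₀ hh hh1
    rw [mul_pow]
    calc _ ≤ 1 * (P * (P * G)) := by gcongr
      _ = _ := by ring
  have h7 : ∀ p q r s : ℝ, (p + q + r + s) ^ 2 ≤ 4 * (p ^ 2 + q ^ 2 + r ^ 2 + s ^ 2) := by
    intro p q r s
    nlinarith [sq_nonneg (p - q), sq_nonneg (p - r), sq_nonneg (p - s), sq_nonneg (q - r),
      sq_nonneg (q - s), sq_nonneg (r - s)]
  refine (h7 _ _ _ _).trans ?_
  nlinarith [mul_nonneg hP0 hG0, mul_nonneg hP0 hb0, mul_nonneg (sq_nonneg P) hb0]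

/-- The energy density with coefficients `m`, `l`, `κ`, as a function of the values `g` and `s` of
`∇β` and `∇w - β`. -/
def density (m l κ : ℝ) (g : Fin N → Fin N → ℝ) (s : Fin N → ℝ) : ℝ :=
  m * ∑ i, ∑ j, g i j ^ 2 + l * (∑ i, g i i) ^ 2 + κ * ∑ i, s i ^ 2

theorem density_nonneg {m l κ : ℝ} (hm : 0 ≤ m) (hl : 0 ≤ l) (hκ : 0 ≤ κ)
    (g : Fin N → Fin N → ℝ) (s : Fin N → ℝ) : 0 ≤ density m l κ g s := by
  have h1 := sum_sum_sq_nonneg g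
  have h2 := sum_sq_nonneg s
  unfold density
  positivity

theorem density_remainder_le {m l κ : ℝ} (hm : 0 < m) (hl : 0 < l) (hκ : 0 ≤ κ) (hh : 0 ≤ h)
    (hh1 : h ≤ 1) {P A : ℝ} (hP : 0 ≤ P) (hA : 1 ≤ A) {g r : Fin N → Fin N → ℝ}
    {s s' : Fin N → ℝ} {b : ℝ} (hb : 0 ≤ b)
    (hr : ∀ i k, r i k ^ 2 ≤ P * (b + ∑ j, ∑ l, g j l ^ 2))
    (hs : ∑ i, s' i ^ 2 ≤ (1 + h * A) * ∑ i, s i ^ 2) :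
    density m l κ (fun i k => g i k + h * r i k) s' ≤
      (1 + (A + 2 * N ^ 2 * P * (m + l) / m + 2 * N ^ 2 * P * (m + l)) * h) * density m l κ g s +
        (A + 2 * N ^ 2 * P * (m + l) / m + 2 * N ^ 2 * P * (m + l)) * h * b := by
  have hG0 : 0 ≤ ∑ j, ∑ l, g j l ^ 2 := sum_sum_sq_nonneg g
  have hS0 : 0 ≤ ∑ i, s i ^ 2 := sum_sq_nonneg s
  have hD0 : 0 ≤ (∑ i, g i i) ^ 2 := sq_nonneg _
  have h1 : ∑ i, ∑ k, (g i k + h * r i k) ^ 2 ≤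
      (1 + h) * (∑ j, ∑ l, g j l ^ 2) + 2 * h * (N ^ 2 * P * (b + ∑ j, ∑ l, g j l ^ 2)) := by
    calc ∑ i, ∑ k, (g i k + h * r i k) ^ 2
        ≤ ∑ i, ∑ k, ((1 + h) * g i k ^ 2 + 2 * h * (P * (b + ∑ j, ∑ l, g j l ^ 2))) :=
          Finset.sum_le_sum fun i _ => Finset.sum_le_sum fun k _ =>
            (sq_add_mul_le hh hh1 _ _).trans
              (add_le_add le_rfl (mul_le_mul_of_nonneg_left (hr i k) (by positivity)))
      _ = _ := by
          simp only [Finset.sum_add_distrib, ← Finset.mul_sum, Finset.sum_const, Finset.card_univ,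
            Fintype.card_fin, nsmul_eq_mul]
          ring
  have h2 : (∑ i, (g i i + h * r i i)) ^ 2 ≤
      (1 + h) * (∑ i, g i i) ^ 2 + 2 * h * (N ^ 2 * P * (b + ∑ j, ∑ l, g j l ^ 2)) := by
    rw [Finset.sum_add_distrib, ← Finset.mul_sum]
    refine (sq_add_mul_le hh hh1 _ _).trans
      (add_le_add le_rfl (mul_le_mul_of_nonneg_left ?_ (by positivity)))
    calc (∑ i, r i i) ^ 2 ≤ N * ∑ i, r i i ^ 2 := by
          simpa using sq_sum_le_card_mul_sum_sq (s := Finset.univ) (f := fun i : Fin N => r i i)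
      _ ≤ N * ∑ _i : Fin N, P * (b + ∑ j, ∑ l, g j l ^ 2) :=
          mul_le_mul_of_nonneg_left (Finset.sum_le_sum fun i _ => hr i i) (by positivity)
      _ = _ := by
          rw [Finset.sum_const, Finset.card_univ, Fintype.card_fin, nsmul_eq_mul]
          ring
  simp only [density]
  generalize ∑ i, ∑ k, (g i k + h * r i k) ^ 2 = G' at *
  generalize (∑ i, (g i i + h * r i i)) ^ 2 = D' at *
  generalize ∑ i, s' i ^ 2 = S' at *
  generalize ∑ j, ∑ l, g j l ^ 2 = G at *
  generalize (∑ i, g i i) ^ 2 = D at *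
  generalize ∑ i, s i ^ 2 = S at *
  obtain ⟨T, hT⟩ : ∃ T, T = 2 * (N : ℝ) ^ 2 * P * (m + l) := ⟨_, rfl⟩
  have hT0 : 0 ≤ T := by rw [hT]; positivity
  have e1 := mul_le_mul_of_nonneg_left h1 hm.le
  have e2 := mul_le_mul_of_nonneg_left h2 hl.le
  have e3 := mul_le_mul_of_nonneg_left hs hκ
  have e4 : m * (2 * h * (N ^ 2 * P * (b + G))) + l * (2 * h * (N ^ 2 * P * (b + G))) =
      h * (T * G) + h * (T * b) := by rw [hT]; ring
  have hlD : 0 ≤ l * D := by positivity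
  have hκS : 0 ≤ κ * S := by positivity
  have hmG : 0 ≤ m * G := by positivity
  have e5 : h * (T * G) ≤ h * (T / m * (m * G + l * D + κ * S)) := by
    have h5 : T * G = T / m * (m * G) := by field_simp
    rw [h5]
    gcongr
    linarith
  have e6 : h * (m * G + l * D) ≤ h * A * (m * G + l * D) := by
    have : 0 ≤ (A - 1) * (h * (m * G + l * D)) :=
      mul_nonneg (by linarith) (by positivity)
    linarith
  have e7 : 0 ≤ T * h * (m * G + l * D + κ * S) := by positivity
  have e8 : 0 ≤ (A + T / m) * h * b := by positivity
  rw [← hT]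
  linarith

/-- The energy density of a transplanted state is at most `1 + O(h)` times the original one, up to
`O(h) |β|²`. -/
theorem exists_density_le (N : ℕ) (B : ℝ) {m l : ℝ} (hm : 0 < m) (hl : 0 < l) :
    ∃ A : ℝ, 0 < A ∧ ∀ (κ h : ℝ), 0 ≤ κ → 0 ≤ h → h ≤ 1 → ∀ (x : Fin N → Fin N → ℝ)
      (y : Fin N → Fin N → Fin N → ℝ), (∀ i j, |x i j| ≤ B) → (∀ i j k, |y i j k| ≤ B) →
      ∀ (b : Fin N → ℝ) (g : Fin N → Fin N → ℝ) (s : Fin N → ℝ),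
        density m l κ (fun i k => g i k + h * remainder h x y b g i k)
            (fun i => s i + h * ∑ j, x i j * s j) ≤
          (1 + A * h) * density m l κ g s + A * h * ∑ j, b j ^ 2 :=
  ⟨_, by positivity, fun _ _ hκ hh hh1 x _ hx hy b g s =>
    density_remainder_le hm hl hκ hh hh1
      (P := 4 * (3 * ((N : ℝ) * B ^ 2) + (N * B ^ 2) ^ 2)) (A := 1 + 2 * N ^ 2 * B ^ 2)
      (by positivity) (le_add_of_nonneg_right (by positivity)) (sum_sq_nonneg b)
      (fun i k => sq_remainder_le hh hh1 hx hy b g i k) (sum_sq_add_mul_le hh hh1 x hx s)⟩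

end Algebra

/-! ### Transplantation of test functions -/

section Transplant

open scoped NNReal ContDiff

variable {N : ℕ}

/-- `X` is a smooth vector field, Lipschitz with constant `K`, which is bounded by `B` together
with its first and second derivatives. -/
structure IsBoundedField (X : E N → E N) (B : ℝ) (K : ℝ≥0) : Prop where
  contDiff : ContDiff ℝ ∞ X
  lipschitz : LipschitzWith K X
  partialD_le : ∀ i j z, |partialD i (fun z => X z j) z| ≤ B
  partialD_partialD_le : ∀ k i j z, |partialD k (partialD i fun z => X z j) z| ≤ B

theorem contDiff_coord {X : E N → E N} (hX : ContDiff ℝ ∞ X) (j : Fin N) :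
    ContDiff ℝ ∞ fun z => X z j :=
  (EuclideanSpace.proj j : E N →L[ℝ] ℝ).contDiff.comp hX

theorem contDiff_shift {X : E N → E N} (hX : ContDiff ℝ ∞ X) (h : ℝ) :
    ContDiff ℝ ∞ (shift X h) :=
  contDiff_id.add (hX.const_smul h)

/-- The chain rule for the composition with `z ↦ z + h X(z)`. -/
theorem partialD_comp_shift {X : E N → E N} (hX : ContDiff ℝ ∞ X) (h : ℝ) {φ : E N → ℝ}
    (hφ : ContDiff ℝ 1 φ) (k : Fin N) (z : E N) :
    partialD k (fun z => φ (shift X h z)) z = partialD k φ (shift X h z) +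
      h * ∑ j, partialD k (fun z => X z j) z * partialD j φ (shift X h z) := by
  have hXd : HasFDerivAt X (fderiv ℝ X z) z := (hX.differentiable (by simp) z).hasFDerivAt
  have h1 : HasFDerivAt (shift X h) (ContinuousLinearMap.id ℝ (E N) + h • fderiv ℝ X z) z :=
    (hasFDerivAt_id z).add (hXd.const_smul h)
  have h2 := ((hφ.differentiable one_ne_zero (shift X h z)).hasFDerivAt).comp z h1
  have h3 : ∀ j, partialD k (fun z => X z j) z = (fderiv ℝ X z (EuclideanSpace.single k 1)) j := by
    intro j
    have h4 : HasFDerivAt (fun z => X z j)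
        ((EuclideanSpace.proj j : E N →L[ℝ] ℝ).comp (fderiv ℝ X z)) z :=
      (EuclideanSpace.proj j : E N →L[ℝ] ℝ).hasFDerivAt.comp z hXd
    rw [partialD, h4.fderiv]
    rfl
  have h5 : partialD k (fun z => φ (shift X h z)) z =
      fderiv ℝ φ (shift X h z) (EuclideanSpace.single k 1 +
        h • fderiv ℝ X z (EuclideanSpace.single k 1)) := by
    have h6 : (fun z => φ (shift X h z)) = φ ∘ shift X h := rfl
    rw [partialD, h6, h2.fderiv]
    rfl
  simp only [h3]
  rw [h5, map_add, map_smul, fderiv_apply_eq_sum_partialD _ (fderiv ℝ X z _)]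
  rfl

/-- The transplanted covector field `(DΨ)ᵀ (β ∘ Ψ)`, where `Ψ(z) = z + h X(z)`. With this choice
the transplantation commutes with taking gradients. -/
def pullCovector (X : E N → E N) (h : ℝ) (β : Fin N → E N → ℝ) (i : Fin N) (z : E N) : ℝ :=
  β i (shift X h z) + h * ∑ j, partialD i (fun z => X z j) z * β j (shift X h z)

theorem contDiff_pullCovector {X : E N → E N} (hX : ContDiff ℝ ∞ X) (h : ℝ)
    {β : Fin N → E N → ℝ} (hβ : ∀ i, ContDiff ℝ ∞ (β i)) (i : Fin N) :
    ContDiff ℝ ∞ (pullCovector X h β i) := by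
  have h1 : ∀ j, ContDiff ℝ ∞ fun z => β j (shift X h z) := fun j =>
    (hβ j).comp (contDiff_shift hX h)
  have h2 : ∀ j, ContDiff ℝ ∞ (partialD i fun z => X z j) := fun j =>
    contDiff_partialD (contDiff_coord hX j) (by simp) i
  exact (h1 i).add (contDiff_const.mul (ContDiff.sum fun j _ => (h2 j).mul (h1 j)))

theorem partialD_pullCovector {X : E N → E N} (hX : ContDiff ℝ ∞ X) (h : ℝ)
    {β : Fin N → E N → ℝ} (hβ : ∀ i, ContDiff ℝ ∞ (β i)) (i k : Fin N) (z : E N) :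
    partialD k (pullCovector X h β i) z = partialD k (β i) (shift X h z) +
      h * remainder h (fun i j => partialD i (fun z => X z j) z)
        (fun k i j => partialD k (partialD i fun z => X z j) z) (fun j => β j (shift X h z))
        (fun i j => partialD j (β i) (shift X h z)) i k := by
  have h1 : ∀ j, ContDiff ℝ ∞ fun z => β j (shift X h z) := fun j =>
    (hβ j).comp (contDiff_shift hX h)
  have h2 : ∀ j, ContDiff ℝ ∞ (partialD i fun z => X z j) := fun j =>
    contDiff_partialD (contDiff_coord hX j) (by simp) i
  have hle : (1 : ℕ∞ω) ≤ ((⊤ : ℕ∞) : ℕ∞ω) := by exact_mod_cast le_top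
  have h3 : ∀ j, ContDiff ℝ ∞ fun z => partialD i (fun z => X z j) z * β j (shift X h z) :=
    fun j => (h2 j).mul (h1 j)
  have hd : ∀ {f : E N → ℝ}, ContDiff ℝ ∞ f → DifferentiableAt ℝ f z := fun hf =>
    hf.differentiable (by simp) z
  have h4 : partialD k (pullCovector X h β i) z = partialD k (fun z => β i (shift X h z)) z +
      h * ∑ j, partialD k (fun z => partialD i (fun z => X z j) z * β j (shift X h z)) z := by
    have h5 : HasFDerivAt (pullCovector X h β i) (fderiv ℝ (fun z => β i (shift X h z)) z +
        h • ∑ j, fderiv ℝ (fun z => partialD i (fun z => X z j) z * β j (shift X h z)) z) z :=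
      (hd (h1 i)).hasFDerivAt.add
        ((HasFDerivAt.fun_sum fun j _ => (hd (h3 j)).hasFDerivAt).const_mul h)
    rw [partialD, h5.fderiv]
    simp [partialD]
  rw [h4, partialD_comp_shift hX h ((hβ i).of_le hle)]
  have h6 : ∀ j, partialD k (fun z => partialD i (fun z => X z j) z * β j (shift X h z)) z =
      partialD k (partialD i fun z => X z j) z * β j (shift X h z) +
        partialD i (fun z => X z j) z * (partialD k (β j) (shift X h z) +
          h * ∑ l, partialD k (fun z => X z l) z * partialD l (β j) (shift X h z)) := by
    intro j
    rw [partialD_mul ((h2 j).of_le hle) ((h1 j).of_le hle),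
      partialD_comp_shift hX h ((hβ j).of_le hle)]
  simp only [h6, remainder, Finset.sum_add_distrib, mul_add, Finset.mul_sum]
  simp only [mul_left_comm _ h]
  ring

end Transplant

/-! ### States made of test functions -/

section TestStates

variable {N : ℕ} {Ω : Opens (E N)}

/-- The state whose components are given by test functions. -/
def testState (β : Fin N → 𝓓(Ω, ℝ)) (w : 𝓓(Ω, ℝ)) : State Ω :=
  (fun i => testPair (β i), testPair w)

theorem testPair_add (φ ψ : 𝓓(Ω, ℝ)) : testPair (φ + ψ) = testPair φ + testPair ψ := by
  refine Prod.ext ?_ (funext fun i => ?_)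
  · exact MemLp.toLp_add (memLp_testFunction φ) (memLp_testFunction ψ)
  · refine Eq.trans ?_ (MemLp.toLp_add (memLp_partialD φ i) (memLp_partialD ψ i))
    exact MemLp.toLp_congr (memLp_partialD (φ + ψ) i) _
      (Filter.Eventually.of_forall fun x => partialD_add i φ ψ x)

theorem testPair_smul (c : ℝ) (φ : 𝓓(Ω, ℝ)) : testPair (c • φ) = c • testPair φ := by
  refine Prod.ext ?_ (funext fun i => ?_)
  · exact MemLp.toLp_const_smul c (memLp_testFunction φ)
  · refine Eq.trans ?_ (MemLp.toLp_const_smul c (memLp_partialD φ i))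
    exact MemLp.toLp_congr (memLp_partialD (c • φ) i) _
      (Filter.Eventually.of_forall fun x => partialD_smul i c φ x)

theorem testState_add (β η : Fin N → 𝓓(Ω, ℝ)) (w v : 𝓓(Ω, ℝ)) :
    testState (β + η) (w + v) = testState β w + testState η v :=
  Prod.ext (funext fun i => testPair_add (β i) (η i)) (testPair_add w v)

theorem testState_smul (c : ℝ) (β : Fin N → 𝓓(Ω, ℝ)) (w : 𝓓(Ω, ℝ)) :
    testState (c • β) (c • w) = c • testState β w :=
  Prod.ext (funext fun i => testPair_smul c (β i)) (testPair_smul c w)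

theorem testState_mem (β : Fin N → 𝓓(Ω, ℝ)) (w : 𝓓(Ω, ℝ)) : testState β w ∈ energySpace Ω :=
  mem_energySpace.2 ⟨fun i => testPair_mem_H10 (β i), testPair_mem_H10 w⟩

/-- The states made of test functions are dense in the energy space. -/
theorem mem_closure_range_testState {U : State Ω} (hU : U ∈ energySpace Ω) :
    U ∈ closure (range fun p : (Fin N → 𝓓(Ω, ℝ)) × 𝓓(Ω, ℝ) => testState p.1 p.2) := by
  obtain ⟨h1, h2⟩ := mem_energySpace.1 hU
  have h3 : U ∈ closure ((univ.pi fun _ => range testPair) ×ˢ range (testPair (Ω := Ω))) := by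
    rw [closure_prod_eq, closure_pi_set]
    exact ⟨fun i _ => mem_closure_range_testPair (h1 i), mem_closure_range_testPair h2⟩
  refine closure_mono ?_ h3
  rintro ⟨b, v⟩ ⟨hb, w, hw⟩
  choose β hβ using fun i => hb i (mem_univ i)
  exact ⟨(β, w), Prod.ext (funext hβ) hw⟩

theorem norm_sq_eq_integral_of_ae_eq {u : L2 Ω} {f : E N → ℝ}
    (hu : u =ᵐ[volume.restrict (Ω : Set (E N))] f) (h0 : ∀ x, x ∉ (Ω : Set (E N)) → f x = 0) :
    ‖u‖ ^ 2 = ∫ x, f x ^ 2 := by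
  rw [← real_inner_self_eq_norm_sq, inner_L2_eq_integral,
    ← setIntegral_eq_integral_of_forall_compl_eq_zero (s := (Ω : Set (E N)))
      (f := fun x => f x ^ 2) (fun x hx => by rw [h0 x hx]; simp)]
  refine integral_congr_ae ?_
  filter_upwards [hu] with x hx
  rw [hx, sq]

theorem integrable_testFunction_sq (φ : 𝓓(Ω, ℝ)) : Integrable fun x => φ x ^ 2 :=
  integrable_sq_of_hasCompactSupport φ.contDiff.continuous φ.hasCompactSupport

theorem continuous_partialD_testFunction (φ : 𝓓(Ω, ℝ)) (i : Fin N) :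
    Continuous (partialD i φ) :=
  continuous_partialD (contDiff_testFunction φ 1) i

theorem formM_testState (t : ℝ) (β : Fin N → 𝓓(Ω, ℝ)) (w : 𝓓(Ω, ℝ)) :
    formM t (testState β w) (testState β w) = ∫ x, (w x ^ 2 + t ^ 2 / 12 * ∑ i, β i x ^ 2) := by
  have h1 : ‖defl (testState β w)‖ ^ 2 = ∫ x, w x ^ 2 := norm_testPair_fst_sq w
  have h2 : ∀ i, ‖rot (testState β w) i‖ ^ 2 = ∫ x, β i x ^ 2 := fun i => norm_testPair_fst_sq (β i)
  rw [formM_self, h1, integral_add (integrable_testFunction_sq w)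
    ((integrable_finsetSum _ fun i _ => integrable_testFunction_sq (β i)).const_mul _),
    integral_const_mul, integral_finsetSum _ fun i _ => integrable_testFunction_sq (β i)]
  simp only [h2]

/-- The density of the energy of a state made of test functions. -/
def energyDensity (m l κ : ℝ) (β : Fin N → 𝓓(Ω, ℝ)) (w : 𝓓(Ω, ℝ)) (x : E N) : ℝ :=
  density m l κ (fun i j => partialD j (β i) x) (fun i => partialD i w x - β i x)

theorem continuous_energyDensity (m l κ : ℝ) (β : Fin N → 𝓓(Ω, ℝ)) (w : 𝓓(Ω, ℝ)) :
    Continuous (energyDensity m l κ β w) := by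
  have h1 := fun i j => continuous_partialD_testFunction (β i) j
  have h2 := fun i => continuous_partialD_testFunction w i
  have h3 := fun i => (β i).contDiff.continuous
  unfold energyDensity density
  fun_prop

theorem hasCompactSupport_energyDensity (m l κ : ℝ) (β : Fin N → 𝓓(Ω, ℝ)) (w : 𝓓(Ω, ℝ)) :
    HasCompactSupport (energyDensity m l κ β w) := by
  refine HasCompactSupport.intro (K := (⋃ i, tsupport (β i)) ∪ tsupport w)
    ((isCompact_iUnion fun i => (β i).hasCompactSupport).union w.hasCompactSupport) fun x hx => ?_
  rw [mem_union, mem_iUnion, not_or, not_exists] at hx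
  have h1 : ∀ i j, partialD j (β i) x = 0 := fun i j =>
    partialD_eq_zero_of_notMem_tsupport (hx.1 i) j
  have h2 : ∀ i, partialD i w x = 0 := fun i => partialD_eq_zero_of_notMem_tsupport hx.2 i
  have h3 : ∀ i, β i x = 0 := fun i => image_eq_zero_of_notMem_tsupport (hx.1 i)
  simp [energyDensity, density, h1, h2, h3]

theorem formQ_testState (lam mu k t : ℝ) (β : Fin N → 𝓓(Ω, ℝ)) (w : 𝓓(Ω, ℝ)) :
    formQ lam mu k t (testState β w) (testState β w) =
      ∫ x, energyDensity (mu / 12) ((mu + lam) / 12) (mu * k / t ^ 2) β w x := by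
  have h1 : ∀ i j, ‖dRot (testState β w) i j‖ ^ 2 = ∫ x, partialD j (β i) x ^ 2 := fun i j =>
    norm_testPair_snd_sq (β i) j
  have h2 : ‖divRot (testState β w)‖ ^ 2 = ∫ x, (∑ i, partialD i (β i) x) ^ 2 := by
    refine norm_sq_eq_integral_of_ae_eq ?_ fun x hx =>
      Finset.sum_eq_zero fun i _ => partialD_testFunction_eq_zero (β i) i hx
    refine (Lp.coeFn_fun_finsetSum _ _).trans ?_
    have h : ∀ᵐ x ∂(volume.restrict (Ω : Set (E N))), ∀ i,
        dRot (testState β w) i i x = partialD i (β i) x :=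
      ae_all_iff.2 fun i => (memLp_partialD (β i) i).coeFn_toLp
    filter_upwards [h] with x hx
    exact Finset.sum_congr rfl fun i _ => hx i
  have h3 : ∀ i, ‖dDefl (testState β w) i - rot (testState β w) i‖ ^ 2 =
      ∫ x, (partialD i w x - β i x) ^ 2 := by
    intro i
    refine norm_sq_eq_integral_of_ae_eq ?_ fun x hx => by
      rw [partialD_testFunction_eq_zero w i hx, testFunction_eq_zero (β i) hx, sub_zero]
    filter_upwards [Lp.coeFn_sub (dDefl (testState β w) i) (rot (testState β w) i),
      (memLp_partialD w i).coeFn_toLp, (memLp_testFunction (β i)).coeFn_toLp] with x hx h4 h5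
    rw [hx, Pi.sub_apply]
    exact congrArg₂ _ h4 h5
  have hg : ∀ i j, Integrable fun x => partialD j (β i) x ^ 2 := fun i j =>
    integrable_sq_of_hasCompactSupport (continuous_partialD_testFunction (β i) j)
      (hasCompactSupport_partialD (β i).hasCompactSupport j)
  have hd : Integrable fun x => (∑ i, partialD i (β i) x) ^ 2 := by
    refine integrable_sq_of_hasCompactSupport
      (continuous_finsetSum _ fun i _ => continuous_partialD_testFunction (β i) i) ?_
    refine HasCompactSupport.intro (K := ⋃ i, tsupport (β i))
      (isCompact_iUnion fun i => (β i).hasCompactSupport) fun x hx => ?_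
    rw [mem_iUnion, not_exists] at hx
    exact Finset.sum_eq_zero fun i _ => partialD_eq_zero_of_notMem_tsupport (hx i) i
  have hs : ∀ i, Integrable fun x => (partialD i w x - β i x) ^ 2 := fun i =>
    integrable_sq_of_hasCompactSupport
      ((continuous_partialD_testFunction w i).sub (β i).contDiff.continuous)
      ((hasCompactSupport_partialD w.hasCompactSupport i).sub (β i).hasCompactSupport)
  rw [formQ_self]
  simp only [h1, h2, h3, energyDensity, density]
  have i1 : Integrable fun x => mu / 12 * ∑ i, ∑ j, partialD j (β i) x ^ 2 :=
    (integrable_finsetSum _ fun i _ => integrable_finsetSum _ fun j _ => hg i j).const_mul _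
  have i2 : Integrable fun x => (mu + lam) / 12 * (∑ i, partialD i (β i) x) ^ 2 := hd.const_mul _
  have i3 : Integrable fun x => mu * k / t ^ 2 * ∑ i, (partialD i w x - β i x) ^ 2 :=
    (integrable_finsetSum _ fun i _ => hs i).const_mul _
  have i12 : Integrable fun x => mu / 12 * ∑ i, ∑ j, partialD j (β i) x ^ 2 +
      (mu + lam) / 12 * (∑ i, partialD i (β i) x) ^ 2 := i1.add i2
  rw [integral_add i12 i3, integral_add i1 i2, integral_const_mul, integral_const_mul,
    integral_const_mul,
    integral_finsetSum _ fun i _ => integrable_finsetSum _ fun j _ => hg i j,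
    integral_finsetSum _ fun i _ => hs i]
  simp only [fun i => integral_finsetSum Finset.univ fun j _ => hg i j]

end TestStates

/-! ### Transplantation of states -/

section PullBack

open scoped NNReal ContDiff

theorem isClosedEmbedding_shift {N : ℕ} {X : E N → E N} {K : ℝ≥0} {h : ℝ} (hX : LipschitzWith K X)
    (hh : 0 ≤ h) (hK : h * K ≤ 1 / 2) : Topology.IsClosedEmbedding (shift X h) := by
  have hK : h.toNNReal * K < 1 := by
    rw [← NNReal.coe_lt_coe]
    push_cast
    rw [Real.coe_toNNReal h hh]
    linarith
  exact (antilipschitzWith_shift hX hh hK).isClosedEmbedding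
    (lipschitzWith_shift hX hh).uniformContinuous

theorem exists_testFunction_eq {N : ℕ} {Ω : Opens (E N)} {f : E N → ℝ} (hf : ContDiff ℝ ∞ f)
    {S : Set (E N)} (hS : IsCompact S) (hSΩ : S ⊆ (Ω : Set (E N))) (h0 : ∀ x, x ∉ S → f x = 0) :
    ∃ φ : 𝓓(Ω, ℝ), ⇑φ = f :=
  ⟨⟨f, hf, HasCompactSupport.intro hS h0,
    (closure_minimal (Function.support_subset_iff'.2 h0) hS.isClosed).trans hSΩ⟩, rfl⟩

variable {d : ℕ}

/-- Test functions on `Ω₁` are transplanted to `Ω₂` if `z ↦ z + h X(z)` maps no point outside `Ω₂`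
into `Ω₁`. -/
theorem exists_pullBack {N : ℕ} {Ω₁ Ω₂ : Opens (E N)} {X : E N → E N} {B h : ℝ} {K : ℝ≥0}
    (hX : IsBoundedField X B K) (hh : 0 ≤ h) (hK : h * K ≤ 1 / 2)
    (hmaps : ∀ z, shift X h z ∈ Ω₁ → z ∈ Ω₂) (β : Fin N → 𝓓(Ω₁, ℝ)) (w : 𝓓(Ω₁, ℝ)) :
    ∃ (β' : Fin N → 𝓓(Ω₂, ℝ)) (w' : 𝓓(Ω₂, ℝ)),
      (∀ i, ⇑(β' i) = pullCovector X h (fun j => β j) i) ∧ ⇑w' = fun z => w (shift X h z) := by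
  have hemb := isClosedEmbedding_shift hX.lipschitz hh hK
  have h1 : ∀ i, ∃ φ : 𝓓(Ω₂, ℝ), ⇑φ = pullCovector X h (fun j => β j) i := by
    intro i
    refine exists_testFunction_eq (contDiff_pullCovector hX.contDiff h
      (fun j => (β j).contDiff) i)
      (hemb.isCompact_preimage (isCompact_iUnion fun j => (β j).hasCompactSupport))
      (fun z hz => ?_) fun z hz => ?_
    · obtain ⟨j, hj⟩ := mem_iUnion.1 hz
      exact hmaps z ((β j).tsupport_subset hj)
    · have h0 : ∀ j, β j (shift X h z) = 0 := fun j =>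
        image_eq_zero_of_notMem_tsupport fun hj => hz (mem_iUnion.2 ⟨j, hj⟩)
      simp [pullCovector, h0]
  choose β' hβ' using h1
  obtain ⟨w', hw'⟩ : ∃ φ : 𝓓(Ω₂, ℝ), ⇑φ = fun z => w (shift X h z) :=
    exists_testFunction_eq (w.contDiff.comp (contDiff_shift hX.contDiff h))
      (hemb.isCompact_preimage w.hasCompactSupport)
      (fun z hz => hmaps z (w.tsupport_subset hz))
      fun z hz => image_eq_zero_of_notMem_tsupport (f := w) hz
  exact ⟨β', w', hβ', hw'⟩

/-- The Poincaré inequality bounds the `L²`-norm of `β` by the energy, uniformly in `k` and `t`. -/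
theorem integral_sum_sq_le {Ω : Opens (E (d + 1))} {R : ℝ}
    (hR : (Ω : Set (E (d + 1))) ⊆ Metric.closedBall 0 R) {m l κ : ℝ} (hm : 0 < m) (hl : 0 ≤ l)
    (hκ : 0 ≤ κ) (β : Fin (d + 1) → 𝓓(Ω, ℝ)) (w : 𝓓(Ω, ℝ)) :
    ∫ x, ∑ i, β i x ^ 2 ≤ 4 * R ^ 2 / m * ∫ x, energyDensity m l κ β w x := by
  have hg : ∀ i j, Integrable fun x => partialD j (β i) x ^ 2 := fun i j =>
    integrable_sq_of_hasCompactSupport (continuous_partialD_testFunction (β i) j)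
      (hasCompactSupport_partialD (β i).hasCompactSupport j)
  rw [integral_finsetSum _ fun i _ => integrable_testFunction_sq (β i)]
  calc ∑ i, ∫ x, β i x ^ 2 ≤ ∑ i, 4 * R ^ 2 * ∫ x, partialD 0 (β i) x ^ 2 :=
        Finset.sum_le_sum fun i _ => integral_sq_le_integral_sq_partialD
          (contDiff_testFunction (β i) 1) (β i).hasCompactSupport 0 fun x hx =>
            (PiLp.norm_apply_le x 0).trans (norm_le_of_testFunction_ne_zero hR (β i) hx)
    _ = 4 * R ^ 2 / m * ∫ x, m * ∑ i, partialD 0 (β i) x ^ 2 := by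
        rw [integral_const_mul, integral_finsetSum _ fun i _ => hg i 0, ← Finset.mul_sum]
        field_simp
    _ ≤ _ := by
        refine mul_le_mul_of_nonneg_left (integral_mono
          ((integrable_finsetSum _ fun i _ => hg i 0).const_mul m)
          ((continuous_energyDensity m l κ β w).integrable_of_hasCompactSupport
            (hasCompactSupport_energyDensity m l κ β w)) fun x => ?_) (by positivity)
        have h1 : ∑ i, partialD 0 (β i) x ^ 2 ≤ ∑ i, ∑ j, partialD j (β i) x ^ 2 :=
          Finset.sum_le_sum fun i _ => sq_le_sum_sq (fun j => partialD j (β i) x) 0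
        have h2 := sum_sq_nonneg fun i => partialD i w x - β i x
        have h3 := mul_le_mul_of_nonneg_left h1 hm.le
        have h4 := mul_nonneg hl (sq_nonneg (∑ i, partialD i (β i) x))
        have h5 := mul_nonneg hκ h2
        simp only [energyDensity, density]
        linarith

/-- Transplantation by a perturbation of the identity of size `h` changes the energy and the
`ℒ²_t`-norm by factors `1 + O(h)`, uniformly in `k` and `t`. -/
theorem exists_form_pullBack_bounds (R B : ℝ) (K : ℝ≥0) {lam mu : ℝ} (hlam : 0 < lam)
    (hmu : 0 < mu) :
    ∃ C : ℝ, 0 < C ∧ ∀ (Ω₁ Ω₂ : Opens (E (d + 1))) (X : E (d + 1) → E (d + 1)) (h k t : ℝ),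
      (Ω₁ : Set (E (d + 1))) ⊆ Metric.closedBall 0 R → IsBoundedField X B K → 0 ≤ h → h ≤ 1 →
      h * K ≤ 1 / 2 → 0 < k → 0 < t → ∀ (β : Fin (d + 1) → 𝓓(Ω₁, ℝ)) (w : 𝓓(Ω₁, ℝ))
        (β' : Fin (d + 1) → 𝓓(Ω₂, ℝ)) (w' : 𝓓(Ω₂, ℝ)),
        (∀ i, ⇑(β' i) = pullCovector X h (fun j => β j) i) → (⇑w' = fun z => w (shift X h z)) →
        formQ lam mu k t (testState β' w') (testState β' w') ≤
            (1 + C * h) * formQ lam mu k t (testState β w) (testState β w) ∧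
          (1 - C * h) * formM t (testState β w) (testState β w) ≤
            formM t (testState β' w') (testState β' w') := by
  -- `A` comes from the pointwise bound of the density, `C₀` from the change of variables, `P` from
  -- the Poincaré inequality, and `a` from `|DΨᵀ b|² ≥ (1 - a h) |b|²`.
  obtain ⟨m, hm⟩ : ∃ m, m = mu / 12 := ⟨_, rfl⟩
  obtain ⟨l, hl⟩ : ∃ l, l = (mu + lam) / 12 := ⟨_, rfl⟩
  have hm0 : 0 < m := by rw [hm]; positivity
  have hl0 : 0 < l := by rw [hl]; positivity
  obtain ⟨A, hA, hden⟩ := exists_density_le (d + 1) B hm0 hl0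
  obtain ⟨C₀, hC₀, hint⟩ := exists_integral_comp_shift_bounds (d + 1) K
  obtain ⟨P, hP⟩ : ∃ P, P = 4 * R ^ 2 / m := ⟨_, rfl⟩
  have hP0 : 0 ≤ P := by rw [hP]; positivity
  obtain ⟨a, ha⟩ : ∃ a : ℝ, a = 1 + ((d + 1 : ℕ) : ℝ) ^ 2 * B ^ 2 := ⟨_, rfl⟩
  have ha0 : 0 < a := by rw [ha]; positivity
  refine ⟨(A + C₀ + A * C₀ + A * (1 + C₀) * P) + (a + C₀), by positivity,
    fun Ω₁ Ω₂ X h k t hR hX hh hh1 hhK hk ht β w β' w' hβ' hw' => ?_⟩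
  have hemb := isClosedEmbedding_shift hX.lipschitz hh hhK
  have hXx : ∀ z i j, |partialD i (fun z => X z j) z| ≤ B := fun z i j => hX.partialD_le i j z
  constructor
  · obtain ⟨κ, hκ⟩ : ∃ κ, κ = mu * k / t ^ 2 := ⟨_, rfl⟩
    have hκ0 : 0 ≤ κ := by rw [hκ]; positivity
    rw [formQ_testState, formQ_testState, ← hm, ← hl, ← hκ]
    have hb : Continuous fun x => ∑ j, β j x ^ 2 :=
      continuous_finsetSum _ fun j _ => (β j).contDiff.continuous.pow 2
    have hbs : HasCompactSupport fun x => ∑ j, β j x ^ 2 := by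
      refine HasCompactSupport.intro (K := ⋃ i, tsupport (β i))
        (isCompact_iUnion fun i => (β i).hasCompactSupport) fun x hx => ?_
      rw [mem_iUnion, not_exists] at hx
      exact Finset.sum_eq_zero fun i _ => by
        rw [image_eq_zero_of_notMem_tsupport (hx i)]
        simp
    have hDc := continuous_energyDensity m l κ β w
    have hDs := hasCompactSupport_energyDensity m l κ β w
    have hpt : ∀ z, energyDensity m l κ β' w' z ≤
        (1 + A * h) * energyDensity m l κ β w (shift X h z) +
          A * h * ∑ j, β j (shift X h z) ^ 2 := by
      intro z
      have h1 := hden κ h hκ0 hh hh1 (fun i j => partialD i (fun z => X z j) z)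
        (fun k i j => partialD k (partialD i fun z => X z j) z) (hXx z)
        (fun k i j => hX.partialD_partialD_le k i j z) (fun j => β j (shift X h z))
        (fun i j => partialD j (β i) (shift X h z))
        (fun i => partialD i w (shift X h z) - β i (shift X h z))
      refine le_trans (le_of_eq ?_) h1
      have e1 : ∀ i k, partialD k (β' i) z = partialD k (β i) (shift X h z) +
          h * remainder h (fun i j => partialD i (fun z => X z j) z)
            (fun k i j => partialD k (partialD i fun z => X z j) z) (fun j => β j (shift X h z))
            (fun i j => partialD j (β i) (shift X h z)) i k := fun i k => by
        rw [hβ' i, partialD_pullCovector hX.contDiff h (fun j => (β j).contDiff) i k z]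
      have e2 : ∀ i, partialD i w' z - β' i z =
          (partialD i w (shift X h z) - β i (shift X h z)) +
            h * ∑ j, partialD i (fun z => X z j) z *
              (partialD j w (shift X h z) - β j (shift X h z)) := fun i => by
        rw [hβ' i, hw', partialD_comp_shift hX.contDiff h (contDiff_testFunction w 1)]
        simp only [pullCovector, mul_sub, Finset.sum_sub_distrib]
        ring
      simp only [energyDensity, e1, e2]
    have hi1 : Integrable fun z => energyDensity m l κ β w (shift X h z) :=
      (hDc.comp hemb.continuous).integrable_of_hasCompactSupport
        (hDs.comp_isClosedEmbedding hemb)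
    have hi2 : Integrable fun z => ∑ j, β j (shift X h z) ^ 2 :=
      (hb.comp hemb.continuous).integrable_of_hasCompactSupport
        (hbs.comp_isClosedEmbedding hemb)
    have h1 : ∫ z, energyDensity m l κ β' w' z ≤
        (1 + A * h) * (∫ z, energyDensity m l κ β w (shift X h z)) +
          A * h * ∫ z, ∑ j, β j (shift X h z) ^ 2 := by
      have h2 := integral_mono
        ((continuous_energyDensity m l κ β' w').integrable_of_hasCompactSupport
          (hasCompactSupport_energyDensity m l κ β' w'))
        ((hi1.const_mul (1 + A * h)).add (hi2.const_mul (A * h))) hpt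
      refine h2.trans (le_of_eq ?_)
      rw [← integral_const_mul, ← integral_const_mul]
      exact integral_add (hi1.const_mul (1 + A * h)) (hi2.const_mul (A * h))
    have h2 := (hint X h hX.lipschitz hh hh1 hhK _ hDc hDs
      fun x => density_nonneg hm0.le hl0.le hκ0 _ _).1
    have h3 := (hint X h hX.lipschitz hh hh1 hhK _ hb hbs fun x => sum_sq_nonneg _).1
    have h4 := integral_sum_sq_le hR hm0 hl0.le hκ0 β w
    rw [← hP] at h4
    have hD0 : 0 ≤ ∫ x, energyDensity m l κ β w x :=
      integral_nonneg fun x => density_nonneg hm0.le hl0.le hκ0 _ _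
    have hb0 : 0 ≤ ∫ x, ∑ j, β j x ^ 2 := integral_nonneg fun x => sum_sq_nonneg _
    generalize (∫ x, energyDensity m l κ β w x) = D at *
    generalize (∫ x, energyDensity m l κ β w (shift X h x)) = D' at *
    generalize (∫ x, ∑ j, β j (shift X h x) ^ 2) = b' at *
    generalize (∫ x, ∑ j, β j x ^ 2) = b at *
    have hC0h : 1 + C₀ * h ≤ 1 + C₀ := by nlinarith
    calc _ ≤ (1 + A * h) * D' + A * h * b' := h1
      _ ≤ (1 + A * h) * ((1 + C₀ * h) * D) + A * h * ((1 + C₀) * (P * D)) := by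
          have e1 : b' ≤ (1 + C₀) * (P * D) :=
            h3.trans (mul_le_mul hC0h h4 hb0 (by positivity))
          gcongr
      _ = (1 + (A + C₀ + A * C₀ * h + A * (1 + C₀) * P) * h) * D := by ring
      _ ≤ _ := by
          refine mul_le_mul_of_nonneg_right ?_ hD0
          have : A * C₀ * h ≤ A * C₀ := mul_le_of_le_one_right (by positivity) hh1
          have : 0 ≤ (a + C₀) * h := by positivity
          nlinarith
  · have hFc : Continuous fun x => w x ^ 2 + t ^ 2 / 12 * ∑ j, β j x ^ 2 :=
      (w.contDiff.continuous.pow 2).add (continuous_const.mul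
        (continuous_finsetSum _ fun j _ => (β j).contDiff.continuous.pow 2))
    have hFs : HasCompactSupport fun x => w x ^ 2 + t ^ 2 / 12 * ∑ j, β j x ^ 2 := by
      refine HasCompactSupport.intro (K := (⋃ i, tsupport (β i)) ∪ tsupport w)
        ((isCompact_iUnion fun i => (β i).hasCompactSupport).union w.hasCompactSupport)
        fun x hx => ?_
      rw [mem_union, mem_iUnion, not_or, not_exists] at hx
      have h3 : ∀ i, β i x = 0 := fun i => image_eq_zero_of_notMem_tsupport (hx.1 i)
      have h4 : w x = 0 := image_eq_zero_of_notMem_tsupport hx.2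
      simp [h3, h4]
    have hF0 : ∀ x, 0 ≤ w x ^ 2 + t ^ 2 / 12 * ∑ j, β j x ^ 2 := fun x => by
      have := sum_sq_nonneg fun j => β j x
      positivity
    have hF0' : ∀ x, 0 ≤ w' x ^ 2 + t ^ 2 / 12 * ∑ j, β' j x ^ 2 := fun x => by
      have := sum_sq_nonneg fun j => β' j x
      positivity
    have hF' : Integrable fun x => w' x ^ 2 + t ^ 2 / 12 * ∑ j, β' j x ^ 2 :=
      (integrable_testFunction_sq w').add
        ((integrable_finsetSum _ fun i _ => integrable_testFunction_sq (β' i)).const_mul _)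
    have hpt : ∀ z, (1 - h * a) * (w (shift X h z) ^ 2 +
        t ^ 2 / 12 * ∑ j, β j (shift X h z) ^ 2) ≤ w' z ^ 2 + t ^ 2 / 12 * ∑ j, β' j z ^ 2 := by
      intro z
      have h1 := le_sum_sq_add_mul hh (fun i j => partialD i (fun z => X z j) z) (hXx z)
        fun j => β j (shift X h z)
      have h2 : ∑ j, β' j z ^ 2 = ∑ i, (β i (shift X h z) +
          h * ∑ j, partialD i (fun z => X z j) z * β j (shift X h z)) ^ 2 :=
        Finset.sum_congr rfl fun i _ => by rw [hβ' i, pullCovector]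
      have h3 : 0 ≤ t ^ 2 / 12 := by positivity
      have h4 : 0 ≤ h * a * w (shift X h z) ^ 2 := by positivity
      rw [← h2, ← ha] at h1
      have h5 := mul_le_mul_of_nonneg_left h1 h3
      rw [hw']
      linarith
    have h1 := integral_mono (((hFc.comp hemb.continuous).integrable_of_hasCompactSupport
      (hFs.comp_isClosedEmbedding hemb)).const_mul (1 - h * a)) hF' hpt
    rw [integral_const_mul] at h1
    have h2 := (hint X h hX.lipschitz hh hh1 hhK _ hFc hFs hF0).2
    rw [formM_testState, formM_testState]
    have hI : 0 ≤ ∫ x, (w x ^ 2 + t ^ 2 / 12 * ∑ j, β j x ^ 2) := integral_nonneg hF0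
    have hI' : 0 ≤ ∫ x, (w' x ^ 2 + t ^ 2 / 12 * ∑ j, β' j x ^ 2) := integral_nonneg hF0'
    have h3 : 0 ≤ (A + C₀ + A * C₀ + A * (1 + C₀) * P) * h := by positivity
    have h5 : 0 ≤ a * C₀ * h ^ 2 := by positivity
    rcases le_or_gt (h * a) 1 with h4 | h4
    · refine le_trans ?_ h1
      refine le_trans ?_ (mul_le_mul_of_nonneg_left h2 (sub_nonneg.2 h4))
      rw [← mul_assoc]
      refine mul_le_mul_of_nonneg_right ?_ hI
      nlinarith
    · refine (mul_nonpos_of_nonpos_of_nonneg ?_ hI).trans hI'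
      have : 0 ≤ C₀ * h := by positivity
      nlinarith

end PullBack

/-! ### Comparison of eigenvalues under transplantation -/

section Comparison

open scoped NNReal ContDiff
open Filter Topology

/-- The graph of the transplantation of test functions from `Ω₁` to `Ω₂`. -/
def pullGraph {N : ℕ} (X : E N → E N) (h : ℝ) (Ω₁ Ω₂ : Opens (E N)) :
    Submodule ℝ (State Ω₁ × State Ω₂) where
  carrier := {p | ∃ (β : Fin N → 𝓓(Ω₁, ℝ)) (w : 𝓓(Ω₁, ℝ)) (β' : Fin N → 𝓓(Ω₂, ℝ)) (w' : 𝓓(Ω₂, ℝ)),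
    p = (testState β w, testState β' w') ∧ (∀ i, ⇑(β' i) = pullCovector X h (fun j => β j) i) ∧
      ⇑w' = fun z => w (shift X h z)}
  zero_mem' := by
    refine ⟨0, 0, 0, 0, ?_, fun i => ?_, rfl⟩
    · have h0 : ∀ Ω : Opens (E N), testState (0 : Fin N → 𝓓(Ω, ℝ)) 0 = 0 := fun Ω => by
        simpa using testState_smul 0 (0 : Fin N → 𝓓(Ω, ℝ)) 0
      rw [h0, h0]
      rfl
    · ext z
      simp [pullCovector]
  add_mem' := by
    rintro _ _ ⟨β, w, β', w', rfl, h1, h2⟩ ⟨η, v, η', v', rfl, h3, h4⟩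
    refine ⟨β + η, w + v, β' + η', w' + v', ?_, fun i => ?_, ?_⟩
    · rw [testState_add, testState_add]
      rfl
    · ext z
      simp only [Pi.add_apply, FunLike.coe_add, h1, h3, pullCovector, mul_add,
        Finset.sum_add_distrib]
      ring
    · rw [FunLike.coe_add, h2, h4]
      rfl
  smul_mem' := by
    rintro c _ ⟨β, w, β', w', rfl, h1, h2⟩
    refine ⟨c • β, c • w, c • β', c • w', ?_, fun i => ?_, ?_⟩
    · rw [testState_smul, testState_smul]
      rfl
    · ext z
      simp only [Pi.smul_apply, FunLike.coe_smul, h1, pullCovector, smul_eq_mul, mul_add,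
        Finset.mul_sum]
      congr 1
      exact Finset.sum_congr rfl fun j _ => by ring
    · rw [FunLike.coe_smul, h2]
      rfl

variable {d n : ℕ} {Ω₁ Ω₂ : Opens (E (d + 1))} {R lam mu k t γ δ : ℝ}

/-- A relation between test states that controls the energy extends to the energy spaces, and so
carries trial spaces over. -/
theorem hasTrialSpace_of_graph (hR₁ : (Ω₁ : Set (E (d + 1))) ⊆ Metric.closedBall 0 R)
    (hR₂ : (Ω₂ : Set (E (d + 1))) ⊆ Metric.closedBall 0 R) (hlam : 0 < lam) (hmu : 0 < mu)
    (hk : 0 < k) (ht : 0 < t) (T : Submodule ℝ (State Ω₁ × State Ω₂))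
    (hT : ∀ p ∈ T, p.2 ∈ energySpace Ω₂ ∧
      formQ lam mu k t p.2 p.2 ≤ (1 + δ) * formQ lam mu k t p.1 p.1 ∧
        (1 - δ) * formM t p.1 p.1 ≤ formM t p.2 p.2)
    (hT' : ∀ β w, ∃ v, (testState β w, v) ∈ T) (hδ : 0 ≤ δ) (hδ1 : δ < 1) (hγ : 0 ≤ γ)
    (h : HasTrialSpace lam mu k t Ω₁ n γ) :
    HasTrialSpace lam mu k t Ω₂ n ((1 + δ) / (1 - δ) * γ) := by
  obtain ⟨C, hC, hCQ⟩ := exists_sobolevSq_le_formQ hR₂ hlam hmu hk ht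
  have hQ0 : formQ lam mu k t (0 : State Ω₁) 0 = 0 := by
    simpa using formQ_smul lam mu k t 0 (0 : State Ω₁) 0
  have hM0 : formM t (0 : State Ω₂) 0 = 0 := by
    simpa using formM_smul t 0 (0 : State Ω₂) 0
  have hclos : ∀ p ∈ T.topologicalClosure, p.2 ∈ energySpace Ω₂ ∧
      formQ lam mu k t p.2 p.2 ≤ (1 + δ) * formQ lam mu k t p.1 p.1 ∧
        (1 - δ) * formM t p.1 p.1 ≤ formM t p.2 p.2 := by
    intro p hp
    have hcl : IsClosed {p : State Ω₁ × State Ω₂ | p.2 ∈ energySpace Ω₂ ∧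
        formQ lam mu k t p.2 p.2 ≤ (1 + δ) * formQ lam mu k t p.1 p.1 ∧
          (1 - δ) * formM t p.1 p.1 ≤ formM t p.2 p.2} := by
      have h1 := (continuous_formQ_self (Ω := Ω₁) lam mu k t).comp
        (continuous_fst (Y := State Ω₂))
      have h2 := (continuous_formQ_self (Ω := Ω₂) lam mu k t).comp
        (continuous_snd (X := State Ω₁))
      have h3 := (continuous_formM_self (Ω := Ω₁) t).comp (continuous_fst (Y := State Ω₂))
      have h4 := (continuous_formM_self (Ω := Ω₂) t).comp (continuous_snd (X := State Ω₁))
      have h5 := isClosed_le h2 ((continuous_const (y := 1 + δ)).mul h1)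
      have h6 := isClosed_le ((continuous_const (y := 1 - δ)).mul h3) h4
      exact (isClosed_energySpace.preimage continuous_snd).inter (h5.inter h6)
    exact closure_minimal hT hcl hp
  -- The images of a Cauchy sequence of test states form a Cauchy sequence.
  have hlift : ∀ U ∈ energySpace Ω₁, ∃ V, (U, V) ∈ T.topologicalClosure := by
    intro U hU
    obtain ⟨u, hu, hlim⟩ := mem_closure_iff_seq_limit.1 (mem_closure_range_testState hU)
    have hv : ∀ m, ∃ v, (u m, v) ∈ T := fun m => by
      obtain ⟨⟨β, w⟩, hβ⟩ := hu m
      rw [← hβ]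
      exact hT' β w
    choose v hv using hv
    have hcauchy : CauchySeq v := by
      rw [cauchySeq_iff_tendsto_dist_atTop_0]
      have h1 : Tendsto (fun p : ℕ × ℕ => u p.1 - u p.2) atTop (𝓝 0) := by
        rw [tendsto_zero_iff_norm_tendsto_zero]
        simpa only [dist_eq_norm] using cauchySeq_iff_tendsto_dist_atTop_0.1 hlim.cauchySeq
      have h2 : Tendsto (fun p : ℕ × ℕ => Real.sqrt (C * ((1 + δ) *
          formQ lam mu k t (u p.1 - u p.2) (u p.1 - u p.2)))) atTop (𝓝 0) := by
        have h3 := ((continuous_formQ_self lam mu k t).tendsto (0 : State Ω₁)).comp h1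
        rw [hQ0] at h3
        have h4 := ((h3.const_mul (1 + δ)).const_mul C).sqrt
        simpa using h4
      refine squeeze_zero (fun _ => dist_nonneg) (fun p => ?_) h2
      have h3 := hT _ (T.sub_mem (hv p.1) (hv p.2))
      rw [dist_eq_norm]
      refine Real.le_sqrt_of_sq_le ((norm_sq_le_sobolevSq _).trans ((hCQ _ h3.1).trans ?_))
      exact mul_le_mul_of_nonneg_left h3.2.1 hC.le
    obtain ⟨V, hV⟩ := cauchySeq_tendsto_of_complete hcauchy
    exact ⟨V, mem_closure_of_tendsto (hlim.prodMk_nhds hV) (Eventually.of_forall hv)⟩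
  obtain ⟨L, hL, hLV, hLQ⟩ := h
  choose V hV using fun i => hlift _ (hLV (Pi.single i 1))
  have hmem : ∀ c, (L c, Fintype.linearCombination ℝ V c) ∈ T.topologicalClosure := by
    intro c
    have h1 := Submodule.sum_mem _ fun i (_ : i ∈ Finset.univ) => Submodule.smul_mem _ (c i) (hV i)
    convert h1 using 1
    refine Prod.ext ?_ ?_
    · rw [Prod.fst_sum]
      change L c = _
      nth_rewrite 1 [← Finset.univ_sum_single c]
      rw [map_sum]
      refine Finset.sum_congr rfl fun i _ => ?_
      rw [Prod.smul_fst, ← map_smul]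
      congr 1
      ext j
      simp [Pi.single_apply]
    · rw [Prod.snd_sum, Fintype.linearCombination_apply]
      rfl
  refine ⟨Fintype.linearCombination ℝ V, ?_, fun c => (hclos _ (hmem c)).1, fun c => ?_⟩
  · rw [injective_iff_map_eq_zero]
    intro c hc
    have h1 := (hclos _ (hmem c)).2.2
    simp only [hc, hM0] at h1
    have h2 : formM t (L c) (L c) ≤ 0 := by
      by_contra! h3
      exact absurd h1 (not_le.2 (mul_pos (by linarith) h3))
    have h4 := eq_zero_of_formQ_self_nonpos hR₁ hlam hmu hk ht (hLV c)
      ((hLQ c).trans (mul_nonpos_of_nonneg_of_nonpos hγ h2))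
    exact hL (h4.trans (map_zero L).symm)
  · have h1 := hclos _ (hmem c)
    calc _ ≤ (1 + δ) * formQ lam mu k t (L c) (L c) := h1.2.1
      _ ≤ (1 + δ) * (γ * formM t (L c) (L c)) :=
          mul_le_mul_of_nonneg_left (hLQ c) (by linarith)
      _ = (1 + δ) / (1 - δ) * γ * ((1 - δ) * formM t (L c) (L c)) := by
          have : 1 - δ ≠ 0 := by linarith
          field_simp
      _ ≤ _ := mul_le_mul_of_nonneg_left h1.2.2
          (mul_nonneg (div_nonneg (by linarith) (by linarith)) hγ)

/-- If `z ↦ z + h X(z)` maps no point outside `Ω₂` into `Ω₁`, then the eigenvalues on `Ω₂` exceed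
those on `Ω₁` by at most a relative amount `O(h)`. -/
theorem exists_eigenvalue_le (R B : ℝ) (K : ℝ≥0) {lam mu : ℝ} (hlam : 0 < lam) (hmu : 0 < mu) :
    ∃ C : ℝ, 0 < C ∧ ∀ (Ω₁ Ω₂ : Opens (E (d + 1))) (X : E (d + 1) → E (d + 1)) (h k t : ℝ) (n : ℕ),
      (Ω₁ : Set (E (d + 1))) ⊆ Metric.closedBall 0 R →
      (Ω₂ : Set (E (d + 1))) ⊆ Metric.closedBall 0 R → (Ω₁ : Set (E (d + 1))).Nonempty →
      IsBoundedField X B K → 0 ≤ h → C * h ≤ 1 → 0 < k → 0 < t → 1 ≤ n →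
      (∀ z, shift X h z ∈ Ω₁ → z ∈ Ω₂) →
      eigenvalue lam mu k t Ω₂ n ≤ (1 + C * h) * eigenvalue lam mu k t Ω₁ n := by
  obtain ⟨C, hC, hform⟩ := exists_form_pullBack_bounds (d := d) R B K hlam hmu
  -- The constant ensures that `h ≤ 1`, `h K ≤ 1 / 2` and `C h ≤ 1 / 4`, and that it dominates
  -- `(1 + C h) / (1 - C h)`.
  refine ⟨4 * C + 1 + 2 * K, by positivity,
    fun Ω₁ Ω₂ X h k t n hR₁ hR₂ hne hX hh hCh hk ht hn hmaps => ?_⟩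
  have hK0 : (0 : ℝ) ≤ K := K.2
  have p1 : 0 ≤ C * h := by positivity
  have p2 : 0 ≤ h * K := by positivity
  have p3 : (4 * C + 1 + 2 * K) * h = 4 * (C * h) + h + 2 * (h * K) := by ring
  have hh1 : h ≤ 1 := by linarith
  have hhK : h * K ≤ 1 / 2 := by linarith
  have hδ : C * h ≤ 1 / 4 := by linarith
  have hγ0 := eigenvalue_nonneg hR₁ hlam hmu hk ht hn
  have hT : ∀ γ, eigenvalue lam mu k t Ω₁ n < γ →
      eigenvalue lam mu k t Ω₂ n ≤ (1 + C * h) / (1 - C * h) * γ := by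
    intro γ hγ
    refine eigenvalue_le_of_hasTrialSpace hR₂ hlam hmu hk ht hn
      (hasTrialSpace_of_graph hR₁ hR₂ hlam hmu hk ht (pullGraph X h Ω₁ Ω₂) ?_ ?_ p1
        (by linarith) (hγ0.trans hγ.le)
        (hasTrialSpace_of_eigenvalue_lt hR₁ hne hlam hmu hk ht hγ))
    · rintro _ ⟨β, w, β', w', rfl, h1, h2⟩
      exact ⟨testState_mem β' w',
        hform Ω₁ Ω₂ X h k t hR₁ hX hh hh1 hhK hk ht β w β' w' h1 h2⟩
    · intro β w
      obtain ⟨β', w', h1, h2⟩ := exists_pullBack hX hh hhK hmaps β w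
      exact ⟨testState β' w', β, w, β', w', rfl, h1, h2⟩
  have hle : eigenvalue lam mu k t Ω₂ n ≤
      (1 + C * h) / (1 - C * h) * eigenvalue lam mu k t Ω₁ n := by
    have hpos : 0 < (1 + C * h) / (1 - C * h) := div_pos (by linarith) (by linarith)
    rw [mul_comm, ← div_le_iff₀ hpos]
    refine le_of_forall_gt_imp_ge_of_dense fun γ hγ => ?_
    rw [div_le_iff₀ hpos, mul_comm]
    exact hT γ hγ
  refine hle.trans (mul_le_mul_of_nonneg_right ?_ hγ0)
  rw [div_le_iff₀ (by linarith)]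
  nlinarith

end Comparison

/-! ### Geometry of the atlas class -/

section Geometry

open scoped NNReal ContDiff

theorem isOpen_openBox {N : ℕ} (a b : Fin N → ℝ) : IsOpen (openBox a b) := by
  have h : openBox a b = ⋂ i, {x : E N | a i < x i ∧ x i < b i} := by
    ext x
    simp [openBox]
  rw [h]
  refine isOpen_iInter_of_finite fun i => ?_
  have hi : Continuous fun x : E N => x i := by fun_prop
  exact (isOpen_lt continuous_const hi).inter (isOpen_lt hi continuous_const)

theorem isBounded_openBox {N : ℕ} (a b : Fin N → ℝ) : Bornology.IsBounded (openBox a b) := by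
  refine ((isCompact_Icc (a := a) (b := b)).image
    (PiLp.continuous_toLp 2 fun _ : Fin N => ℝ)).isBounded.subset fun x hx => ?_
  exact ⟨x.ofLp, ⟨fun i => (hx i).1.le, fun i => (hx i).2.le⟩, rfl⟩

theorem IsCuboid.isOpen {N : ℕ} {V : Set (E N)} (hV : IsCuboid V) : IsOpen V := by
  obtain ⟨e, a, b, -, rfl⟩ := hV
  exact e.toHomeomorph.isOpenMap _ (isOpen_openBox a b)

theorem IsCuboid.isBounded {N : ℕ} {V : Set (E N)} (hV : IsCuboid V) : Bornology.IsBounded V := by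
  obtain ⟨e, a, b, -, rfl⟩ := hV
  exact e.isometry.lipschitz.isBounded_image (isBounded_openBox a b)

theorem closedBall_subset_of_mem_innerNhd {N : ℕ} {V : Set (E N)} (hV : IsOpen V) {δ : ℝ}
    {x : E N} (hx : x ∈ innerNhd δ V) : Metric.closedBall x δ ⊆ V := by
  rcases lt_or_ge δ 0 with hδ | hδ
  · rw [Metric.closedBall_eq_empty.2 hδ]
    exact empty_subset V
  refine (convex_closedBall x δ).isPreconnected.subset_left_of_subset_union hV
    isClosed_closure.isOpen_compl (disjoint_compl_right.mono_left subset_closure) ?_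
    ⟨x, Metric.mem_closedBall_self hδ, hx.1⟩
  intro y hy
  by_contra h
  rw [mem_union, not_or, notMem_compl_iff] at h
  have hy' : y ∈ frontier V := by
    rw [hV.frontier_eq]
    exact ⟨h.2, h.1⟩
  have h1 := hx.2.trans_le (Metric.infEDist_le_edist_of_mem hy')
  rw [edist_comm, edist_dist] at h1
  exact absurd (ENNReal.ofReal_le_ofReal (Metric.mem_closedBall.1 hy)) (not_le.2 h1)

theorem mem_innerNhd_of_closedBall_subset {N : ℕ} {V : Set (E N)} (hV : IsOpen V) {δ : ℝ}
    (hδ : 0 ≤ δ) {x : E N} (hx : Metric.closedBall x δ ⊆ V) : x ∈ innerNhd δ V := by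
  refine ⟨hx (Metric.mem_closedBall_self hδ), ?_⟩
  rcases (frontier V).eq_empty_or_nonempty with h | h
  · rw [h, Metric.infEDist_empty]
    exact ENNReal.ofReal_lt_top
  · obtain ⟨y, hy, hxy⟩ := isClosed_frontier.exists_infDist_eq_dist h x
    rw [ENNReal.ofReal_lt_iff_lt_toReal hδ (Metric.infEDist_ne_top h)]
    change δ < Metric.infDist x (frontier V)
    rw [hxy]
    by_contra! h1
    have h2 : y ∈ V := hx (by rwa [Metric.mem_closedBall, dist_comm])
    rw [hV.frontier_eq] at hy
    exact hy.2 h2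

/-- A smooth compactly supported vector field is bounded in all the required senses. -/
theorem exists_isBoundedField {N : ℕ} {X : E N → E N} (hX : ContDiff ℝ ∞ X)
    (hXs : HasCompactSupport X) : ∃ (B : ℝ) (K : ℝ≥0), IsBoundedField X B K := by
  obtain ⟨K, hK⟩ := ContDiff.lipschitzWith_of_hasCompactSupport hXs hX (by simp)
  have h1 : ∀ j, HasCompactSupport fun z => X z j := fun j =>
    hXs.comp_left (g := fun x : E N => x j) rfl
  have h2 : ∀ i j, ContDiff ℝ ∞ (partialD i fun z => X z j) := fun i j =>
    contDiff_partialD (contDiff_coord hX j) (by simp) i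
  have h3 : ∀ k i j, Continuous (partialD k (partialD i fun z => X z j)) := fun k i j =>
    continuous_partialD ((h2 i j).of_le (by exact_mod_cast le_top)) k
  choose b hb using fun p : Fin N × Fin N =>
    (hasCompactSupport_partialD (h1 p.2) p.1).exists_bound_of_continuous (h2 p.1 p.2).continuous
  choose c hc using fun p : Fin N × Fin N × Fin N =>
    (hasCompactSupport_partialD (hasCompactSupport_partialD (h1 p.2.2) p.2.1)
      p.1).exists_bound_of_continuous (h3 p.1 p.2.1 p.2.2)
  obtain ⟨B₁, hB₁⟩ := Finite.exists_le b
  obtain ⟨B₂, hB₂⟩ := Finite.exists_le c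
  exact ⟨max B₁ B₂, K, hX, hK,
    fun i j z => (hb (i, j) z).trans ((hB₁ _).trans (le_max_left _ _)),
    fun k i j z => (hc (k, i, j) z).trans ((hB₂ _).trans (le_max_right _ _))⟩

/-- A smooth function that is `1` well inside `V`, and whose support stays away from the boundary
of `V`. -/
theorem exists_bump {N : ℕ} (V : Set (E N)) {ρ : ℝ} (hρ : 0 < ρ) :
    ∃ ψ : E N → ℝ, ContDiff ℝ ∞ ψ ∧ (∀ x, 0 ≤ ψ x ∧ ψ x ≤ 1) ∧
      (∀ x, Metric.closedBall x (ρ / 2) ⊆ V → ψ x = 1) ∧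
      ∀ x, ψ x ≠ 0 → Metric.closedBall x (ρ / 4) ⊆ V := by
  have hs : IsClosed {x : E N | Metric.infEDist x Vᶜ ≤ ENNReal.ofReal (ρ / 4)} :=
    isClosed_le Metric.continuous_infEDist continuous_const
  have ht : IsClosed {x : E N | ENNReal.ofReal (ρ / 2) ≤ Metric.infEDist x Vᶜ} :=
    isClosed_le continuous_const Metric.continuous_infEDist
  have hd : Disjoint {x : E N | Metric.infEDist x Vᶜ ≤ ENNReal.ofReal (ρ / 4)}
      {x : E N | ENNReal.ofReal (ρ / 2) ≤ Metric.infEDist x Vᶜ} := by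
    rw [disjoint_left]
    intro x h1 h2
    have h3 : ENNReal.ofReal (ρ / 2) ≤ ENNReal.ofReal (ρ / 4) := le_trans h2 h1
    rw [ENNReal.ofReal_le_ofReal_iff (by positivity)] at h3
    linarith
  obtain ⟨f, hf0, hf1, hf⟩ := exists_contMDiffMap_zero_one_of_isClosed (n := (⊤ : ℕ∞))
    (modelWithCornersSelf ℝ (E N)) hs ht hd
  refine ⟨f, contMDiff_iff_contDiff.1 f.contMDiff, hf, fun x hx => hf1 ?_, fun x hx y hy => ?_⟩
  · refine Metric.le_infEDist.2 fun y hy => ?_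
    rw [edist_dist]
    refine ENNReal.ofReal_le_ofReal ?_
    by_contra! h
    exact hy (hx (by rw [Metric.mem_closedBall, dist_comm]; exact h.le))
  · by_contra hyV
    refine hx (hf0 ((Metric.infEDist_le_edist_of_mem hyV).trans ?_))
    rw [edist_dist, dist_comm]
    exact ENNReal.ofReal_le_ofReal hy

end Geometry

section Stability

open scoped NNReal

variable {d : ℕ}

theorem dist_xbar_le (x y : E (d + 1)) : dist (xbar x) (xbar y) ≤ ‖x - y‖ := by
  rw [dist_eq_norm]
  refine le_of_sq_le_sq ?_ (norm_nonneg _)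
  rw [EuclideanSpace.real_norm_sq_eq, EuclideanSpace.real_norm_sq_eq, Fin.sum_univ_castSucc]
  exact le_add_of_nonneg_right (sq_nonneg _)

/-- The unit vector that the linear part of the `j`-th isometry, which is affine by the Mazur-Ulam
theorem, maps to the last coordinate vector. -/
def Atlas.up (A : Atlas d) (j : Fin A.s) : E (d + 1) :=
  (A.r j).toRealAffineIsometryEquiv.linearIsometryEquiv.symm
    (EuclideanSpace.single (Fin.last d) 1)

theorem Atlas.norm_up (A : Atlas d) (j : Fin A.s) : ‖A.up j‖ = 1 := by
  simp [Atlas.up]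

theorem Atlas.r_sub_smul_up (A : Atlas d) (j : Fin A.s) (x : E (d + 1)) (τ : ℝ) :
    A.r j (x - τ • A.up j) = A.r j x - τ • EuclideanSpace.single (Fin.last d) 1 := by
  have h1 := (A.r j).toRealAffineIsometryEquiv.map_vadd x (-(τ • A.up j))
  rw [IsometryEquiv.coeFn_toRealAffineIsometryEquiv] at h1
  simp only [vadd_eq_add] at h1
  rw [sub_eq_neg_add, h1, map_neg, map_smul, Atlas.up, LinearIsometryEquiv.apply_symm_apply]
  abel

/-- Points of `Ω ∩ V_j` may be moved by `v` and then down by at least `M ω(|v|) + |v|`, as long as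
they stay in `V_j`. -/
theorem Atlas.Describes.add_sub_mem {A : Atlas d} {Ω : Opens (E (d + 1))}
    {a b : Fin A.s → Fin (d + 1) → ℝ} {g : Fin A.s → E d → ℝ} (hΩ : A.Describes Ω a b g)
    {ω : ℝ → ℝ} (hω : IsModulus ω) {M : ℝ} (hM : 0 < M) {j : Fin A.s}
    (hg : ∀ x ∈ closure (openBox (fun i : Fin d => a j i.castSucc) (fun i => b j i.castSucc)),
      ∀ y ∈ closure (openBox (fun i : Fin d => a j i.castSucc) (fun i => b j i.castSucc)),
        |g j x - g j y| ≤ M * ω (dist x y))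
    {x v : E (d + 1)} {τ ε : ℝ} (hx : x ∈ Ω) (hxV : x ∈ A.V j) (hv : ‖v‖ ≤ ε)
    (hτ : M * ω ε + ε ≤ τ) (hV : x + v - τ • A.up j ∈ A.V j) : x + v - τ • A.up j ∈ Ω := by
  have hbox : ∀ y ∈ A.V j, xbar (A.r j y) ∈ openBox (fun i : Fin d => a j i.castSucc)
      (fun i => b j i.castSucc) := fun y hy i => by
    have h1 : A.r j y ∈ openBox (a j) (b j) := hΩ.image_V j ▸ mem_image_of_mem _ hy
    exact h1 i.castSucc
  have hxr : A.r j x ∈ A.r j '' ((Ω : Set (E (d + 1))) ∩ A.V j) := mem_image_of_mem _ ⟨hx, hxV⟩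
  rw [hΩ.image_inter j] at hxr
  have hyr : A.r j (x + v - τ • A.up j) ∈ openBox (a j) (b j) :=
    hΩ.image_V j ▸ mem_image_of_mem _ hV
  have hbar : xbar (A.r j (x + v - τ • A.up j)) = xbar (A.r j (x + v)) := by
    rw [A.r_sub_smul_up]
    ext i
    simp [xbar]
  have hnorm : ‖A.r j (x + v) - A.r j x‖ = ‖v‖ := by
    rw [← dist_eq_norm, (A.r j).dist_eq, dist_eq_norm, add_sub_cancel_left]
  have hdist : dist (xbar (A.r j (x + v - τ • A.up j))) (xbar (A.r j x)) ≤ ε := by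
    rw [hbar]
    exact (dist_xbar_le _ _).trans (hnorm.le.trans hv)
  have hlast : (A.r j (x + v)) (Fin.last d) ≤ (A.r j x) (Fin.last d) + ε := by
    have h1 := (le_abs_self _).trans
      (PiLp.norm_apply_le (A.r j (x + v) - A.r j x) (Fin.last d))
    rw [hnorm, PiLp.sub_apply] at h1
    linarith
  have hlast' : (A.r j (x + v - τ • A.up j)) (Fin.last d) =
      (A.r j (x + v)) (Fin.last d) - τ := by
    rw [A.r_sub_smul_up]
    simp
  have hgx := (abs_le.1 (hg _ (subset_closure (hbox _ hV)) _ (subset_closure (hbox _ hxV)))).1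
  have hωle : ω (dist (xbar (A.r j (x + v - τ • A.up j))) (xbar (A.r j x))) ≤ ω ε :=
    hω.monotoneOn dist_nonneg (dist_nonneg.trans hdist) hdist
  have hωle' := mul_le_mul_of_nonneg_left hωle hM.le
  have hmem : A.r j (x + v - τ • A.up j) ∈ A.r j '' ((Ω : Set (E (d + 1))) ∩ A.V j) := by
    rw [hΩ.image_inter j]
    refine ⟨⟨(hyr _).1, ?_⟩, hbox _ hV⟩
    have h1 := hxr.1.2
    linarith
  obtain ⟨y, hy, hy'⟩ := hmem
  rw [← (A.r j).injective hy']
  exact hy.1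

/-- Every atlas has a smooth vector field, pointing upwards in all charts, against which the sets of
the class are stable: moving a point of `Ω` by `v` and then against the field by an amount
comparable to `ω(|v|)` does not leave `Ω`. -/
theorem Atlas.exists_field (A : Atlas d) :
    ∃ (R B δ : ℝ) (K : ℝ≥0) (X : E (d + 1) → E (d + 1)), 0 < δ ∧ IsBoundedField X B K ∧
      ∀ (ω : ℝ → ℝ) (M : ℝ) (Ω : Opens (E (d + 1))), IsModulus ω → 0 < M →
        Ω ∈ A.omegaClass ω M → (Ω : Set (E (d + 1))) ⊆ Metric.closedBall 0 R ∧
        ∀ ε h : ℝ, ε ≤ δ → h ≤ δ → 0 < ε → M * ω ε + ε ≤ h → ∀ x v z, x ∈ Ω → ‖v‖ ≤ ε →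
          ‖x - shift X h z‖ ≤ ε → x + v - h • X z ∈ Ω := by
  have hρ := A.ρ_pos
  choose ψ hψ hψ01 hψ1 hψV using fun j => exists_bump (A.V j) hρ
  have hbdd : Bornology.IsBounded (⋃ j, A.V j) :=
    (Bornology.isBounded_iUnion).2 fun j => (A.cuboid j).isBounded
  obtain ⟨R, hR⟩ := hbdd.subset_closedBall 0
  obtain ⟨X, hXdef⟩ : ∃ X : E (d + 1) → E (d + 1), X = fun z => ∑ j, ψ j z • A.up j := ⟨_, rfl⟩
  have hX : ContDiff ℝ ((⊤ : ℕ∞) : WithTop ℕ∞) X := by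
    rw [hXdef]
    exact ContDiff.sum fun j _ => (hψ j).smul contDiff_const
  have hXs : HasCompactSupport X := by
    refine HasCompactSupport.intro (isCompact_closedBall (0 : E (d + 1)) R) fun z hz => ?_
    rw [hXdef]
    refine Finset.sum_eq_zero fun j _ => ?_
    have h0 : ψ j z = 0 := by
      by_contra h
      exact hz (hR (mem_iUnion.2 ⟨j, hψV j z h (Metric.mem_closedBall_self (by positivity))⟩))
    rw [h0, zero_smul]
  obtain ⟨B, K, hBK⟩ := exists_isBoundedField hX hXs
  have hs0 : (0 : ℝ) ≤ A.s := Nat.cast_nonneg _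
  refine ⟨R, B, A.ρ / (16 * (1 + A.s)), K, X, by positivity, hBK, ?_⟩
  rintro ω M Ω hω hM ⟨a, b, g, hΩ, hg⟩
  refine ⟨fun x hx => ?_, ?_⟩
  · obtain ⟨j, hj⟩ := mem_iUnion.1 (hΩ.subset_iUnion hx)
    exact hR (mem_iUnion.2 ⟨j, hj.1⟩)
  intro ε h hε hh hε0 hεh x v z hx hv hxz
  have hω0 : 0 ≤ ω ε := hω.map_zero ▸ hω.monotoneOn (mem_Ici.2 le_rfl) hε0.le hε0.le
  have hh0 : 0 ≤ h := by
    have := mul_nonneg hM.le hω0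
    linarith
  rw [le_div_iff₀ (by positivity)] at hε hh
  -- All points met below lie within `ρ / 4` of `z`.
  have hnorm : ∀ S : Finset (Fin A.s), ‖h • ∑ j ∈ S, ψ j z • A.up j‖ ≤ h * A.s := by
    intro S
    rw [norm_smul, Real.norm_of_nonneg hh0]
    refine mul_le_mul_of_nonneg_left ?_ hh0
    calc ‖∑ j ∈ S, ψ j z • A.up j‖ ≤ ∑ j ∈ S, (1 : ℝ) := by
          refine norm_sum_le_of_le _ fun j _ => ?_
          rw [norm_smul, A.norm_up, mul_one, Real.norm_of_nonneg (hψ01 j z).1]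
          exact (hψ01 j z).2
      _ ≤ A.s := by
          rw [Finset.sum_const, nsmul_eq_mul, mul_one]
          exact_mod_cast (Finset.card_le_univ S).trans_eq (Fintype.card_fin _)
  have hxz' : ‖x - z‖ ≤ ε + h * A.s := by
    have h1 : x - z = (x - shift X h z) + h • ∑ j, ψ j z • A.up j := by
      rw [shift, hXdef]
      abel
    rw [h1]
    exact (norm_add_le _ _).trans (add_le_add hxz (hnorm _))
  have hnear : ∀ S : Finset (Fin A.s), dist (x + v - h • ∑ j ∈ S, ψ j z • A.up j) z ≤ A.ρ / 4 := by
    intro S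
    have h1 : x + v - h • ∑ j ∈ S, ψ j z • A.up j - z =
        (x - z) + v - h • ∑ j ∈ S, ψ j z • A.up j := by abel
    rw [dist_eq_norm, h1]
    have h2 := (norm_sub_le ((x - z) + v) (h • ∑ j ∈ S, ψ j z • A.up j)).trans
      (add_le_add (norm_add_le (x - z) v) (hnorm S))
    have h3 : 0 ≤ ε * A.s := by positivity
    linarith
  have hxz4 : ‖x - z‖ ≤ A.ρ / 4 := by
    have h3 : 0 ≤ ε * A.s := by positivity
    linarith
  -- In a chart that contains a large ball around `x` the field has full strength.
  obtain ⟨j₀, hj₀⟩ := mem_iUnion.1 (hΩ.subset_iUnion hx)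
  have hball := closedBall_subset_of_mem_innerNhd (A.cuboid j₀).isOpen hj₀
  have hψ₀ : ψ j₀ z = 1 := by
    refine hψ1 j₀ z (Subset.trans (fun y hy => ?_) hball)
    rw [Metric.mem_closedBall] at hy ⊢
    have h1 := dist_triangle y z x
    rw [dist_comm z x, dist_eq_norm x z] at h1
    linarith
  have hV : ∀ j, ψ j z ≠ 0 → ∀ S : Finset (Fin A.s),
      x + v - h • ∑ j ∈ S, ψ j z • A.up j ∈ A.V j := fun j hj S => hψV j z hj (hnear S)
  have hmain : ∀ S : Finset (Fin A.s),
      x + v - h • ∑ j ∈ insert j₀ S, ψ j z • A.up j ∈ Ω := by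
    intro S
    induction S using Finset.induction_on with
    | empty =>
      have h1 := hV j₀ (by rw [hψ₀]; exact one_ne_zero) {j₀}
      rw [Finset.sum_singleton, hψ₀, one_smul] at h1
      rw [insert_empty_eq, Finset.sum_singleton, hψ₀, one_smul]
      exact hΩ.add_sub_mem hω hM (hg j₀) hx hj₀.1 hv hεh h1
    | insert j S hjS ih =>
      by_cases hj : j ∈ insert j₀ S
      · rwa [Finset.insert_comm, Finset.insert_eq_of_mem hj]
      rw [Finset.insert_comm, Finset.sum_insert hj]
      by_cases hj0 : ψ j z = 0
      · rwa [hj0, zero_smul, zero_add]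
      have e1 : x + v - h • (ψ j z • A.up j + ∑ i ∈ insert j₀ S, ψ i z • A.up i) =
          (x + v - h • ∑ i ∈ insert j₀ S, ψ i z • A.up i) + 0 - (h * ψ j z) • A.up j := by
        rw [smul_add, smul_smul]
        abel
      have h1 := hV j hj0 (insert j (insert j₀ S))
      rw [Finset.sum_insert hj, e1] at h1
      rw [e1]
      refine hΩ.add_sub_mem hω hM (hg j) ih (hV j hj0 _) (ε := 0) (by simp) ?_ h1
      rw [hω.map_zero, mul_zero, add_zero]
      exact mul_nonneg hh0 (hψ01 j z).1
  have h1 := hmain Finset.univ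
  rw [Finset.insert_eq_of_mem (Finset.mem_univ j₀)] at h1
  rw [hXdef]
  exact h1

/-- The eigenvalues of nonempty sets `Ω₁`, `Ω₂` of the class with `(Ω₁)_ε ⊆ Ω₂ ⊆ (Ω₁)^ε` differ by
at most a factor `1 + O(ω(ε))`. -/
theorem exists_eigenvalue_comparison (A : Atlas d) {ω : ℝ → ℝ} (hω : IsModulus ω)
    {M lam mu : ℝ} (hM : 0 < M) (hlam : 0 < lam) (hmu : 0 < mu) :
    ∃ c R : ℝ, 0 < c ∧ (∀ Ω ∈ A.omegaClass ω M, (Ω : Set (E (d + 1))) ⊆ Metric.closedBall 0 R) ∧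
      ∀ (k t : ℝ) (n : ℕ) (ε : ℝ) (Ω₁ Ω₂ : Opens (E (d + 1))),
        0 < k → 0 < t → 1 ≤ n → 0 < ε → ε < c⁻¹ →
        Ω₁ ∈ A.omegaClass ω M → Ω₂ ∈ A.omegaClass ω M → (Ω₁ : Set (E (d + 1))).Nonempty →
        (Ω₂ : Set (E (d + 1))).Nonempty →
        innerNhd ε (Ω₁ : Set (E (d + 1))) ⊆ Ω₂ →
        (Ω₂ : Set (E (d + 1))) ⊆ Metric.thickening ε Ω₁ →
        eigenvalue lam mu k t Ω₂ n ≤ (1 + c * ω ε) * eigenvalue lam mu k t Ω₁ n ∧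
          eigenvalue lam mu k t Ω₁ n ≤ (1 + c * ω ε) * eigenvalue lam mu k t Ω₂ n := by
  obtain ⟨R, B, δ, K, X, hδ, hX, hfield⟩ := A.exists_field
  obtain ⟨C, hC, heig⟩ := exists_eigenvalue_le (d := d) R B K hlam hmu
  obtain ⟨κ, hκ, hκω⟩ := hω.linear_le
  obtain ⟨m, hm⟩ : ∃ m, m = M + 1 / κ := ⟨_, rfl⟩
  have hm0 : 0 < m := by rw [hm]; positivity
  -- The size `h = m ω(ε)` of the perturbation is small for small `ε`.
  obtain ⟨η, hη, hηω⟩ : ∃ η > 0, ∀ ε, 0 < ε → ε < η → m * ω ε ≤ δ ∧ C * (m * ω ε) ≤ 1 := by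
    have h1 := Metric.continuousWithinAt_iff.1 (hω.continuousOn 0 (mem_Ici.2 le_rfl))
      (min (δ / m) (1 / (C * m))) (by positivity)
    obtain ⟨η, hη, h2⟩ := h1
    refine ⟨η, hη, fun ε hε hεη => ?_⟩
    have h3 := h2 (mem_Ici.2 hε.le) (by rwa [Real.dist_eq, sub_zero, abs_of_pos hε])
    rw [hω.map_zero, Real.dist_eq, sub_zero] at h3
    have h4 := (le_abs_self _).trans (h3.le.trans (min_le_left _ _))
    have h5 := (le_abs_self _).trans (h3.le.trans (min_le_right _ _))
    rw [le_div_iff₀ hm0] at h4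
    rw [le_div_iff₀ (by positivity)] at h5
    constructor <;> linarith
  refine ⟨C * m + 1 + 1 / δ + 1 / η, R, by positivity,
    fun Ω hΩ => (hfield ω M Ω hω hM hΩ).1, ?_⟩
  intro k t n ε Ω₁ Ω₂ hk ht hn hε hεc h₁ h₂ hne₁ hne₂ hin hout
  have hlt : ∀ a, 0 < a → a ≤ C * m + 1 + 1 / δ + 1 / η → ε < a⁻¹ := fun a ha hac =>
    hεc.trans_le (inv_anti₀ ha hac)
  have p1 : 0 < C * m := by positivity
  have p2 : 0 < 1 / δ := by positivity
  have p3 : 0 < 1 / η := by positivity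
  have hε1 : ε < 1 := by simpa using hlt 1 one_pos (by linarith)
  have hεδ : ε < δ := by simpa using hlt (1 / δ) p2 (by linarith)
  have hεη : ε < η := by simpa using hlt (1 / η) p3 (by linarith)
  have hω0 : 0 ≤ ω ε := hω.map_zero ▸ hω.monotoneOn (mem_Ici.2 le_rfl) hε.le hε.le
  obtain ⟨hh, hCh⟩ := hηω ε hε hεη
  have hh0 : 0 ≤ m * ω ε := by positivity
  have hεh : M * ω ε + ε ≤ m * ω ε := by
    have h1 := hκω ε ⟨hε.le, hε1.le⟩
    have h2 : ε ≤ 1 / κ * ω ε := by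
      rw [one_div, ← div_eq_inv_mul, le_div_iff₀ hκ]
      linarith
    rw [hm, add_mul]
    linarith
  obtain ⟨hR₁, hf₁⟩ := hfield ω M Ω₁ hω hM h₁
  obtain ⟨hR₂, -⟩ := hfield ω M Ω₂ hω hM h₂
  have hf := hf₁ ε (m * ω ε) hεδ.le hh hε hεh
  have hmaps₁ : ∀ z, shift X (m * ω ε) z ∈ Ω₁ → z ∈ Ω₂ := by
    intro z hz
    refine hin (mem_innerNhd_of_closedBall_subset Ω₁.isOpen hε.le fun y hy => ?_)
    -- `y = Ψ(z) + (y - z) - h X(z)`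
    have h1 := hf _ (y - z) z hz (by rwa [← dist_eq_norm]) (by simpa using hε.le)
    have h2 : shift X (m * ω ε) z + (y - z) - (m * ω ε) • X z = y := by
      rw [shift]
      abel
    rwa [h2] at h1
  have hmaps₂ : ∀ z, shift X (m * ω ε) z ∈ Ω₂ → z ∈ Ω₁ := by
    intro z hz
    obtain ⟨x, hx, hxz⟩ := Metric.mem_thickening_iff.1 (hout hz)
    rw [dist_eq_norm] at hxz
    -- `z = x + (Ψ(z) - x) - h X(z)`
    have h1 := hf x (shift X (m * ω ε) z - x) z hx hxz.le (by rw [norm_sub_rev]; exact hxz.le)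
    have h2 : x + (shift X (m * ω ε) z - x) - (m * ω ε) • X z = z := by
      rw [shift]
      abel
    rwa [h2] at h1
  have hle : 1 + C * (m * ω ε) ≤ 1 + (C * m + 1 + 1 / δ + 1 / η) * ω ε := by
    have : 0 ≤ (1 + 1 / δ + 1 / η) * ω ε := by positivity
    linarith
  exact ⟨(heig Ω₁ Ω₂ X _ k t n hR₁ hR₂ hne₁ hX hh0 hCh hk ht hn hmaps₁).trans
      (mul_le_mul_of_nonneg_right hle (eigenvalue_nonneg hR₁ hlam hmu hk ht hn)),
    (heig Ω₂ Ω₁ X _ k t n hR₂ hR₁ hne₂ hX hh0 hCh hk ht hn hmaps₂).trans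
      (mul_le_mul_of_nonneg_right hle (eigenvalue_nonneg hR₂ hlam hmu hk ht hn))⟩

/-- The sets of the class are nonempty if the atlas has a chart, and empty otherwise. -/
theorem Atlas.omegaClass_nonempty_or_eq_bot (A : Atlas d) {ω : ℝ → ℝ} {M : ℝ} :
    (∀ Ω ∈ A.omegaClass ω M, (Ω : Set (E (d + 1))).Nonempty) ∨ ∀ Ω ∈ A.omegaClass ω M, Ω = ⊥ := by
  rcases isEmpty_or_nonempty (Fin A.s) with h | ⟨⟨j⟩⟩
  · right
    rintro Ω ⟨a, b, g, hΩ, -⟩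
    have h1 := hΩ.subset_iUnion
    rw [iUnion_of_empty] at h1
    exact Opens.ext (subset_empty_iff.1 h1)
  · left
    rintro Ω ⟨a, b, g, hΩ, -⟩
    exact (hΩ.inner_inter_nonempty j).mono inter_subset_right

end Stability

end ReissnerMindlin

end

theorem mainTheorem3 (d : ℕ) (A : ReissnerMindlin.Atlas d) (ω : ℝ → ℝ)
    (hω : ReissnerMindlin.IsModulus ω) (M lam mu : ℝ) (hM : 0 < M) (hlam : 0 < lam)
    (hmu : 0 < mu) :
    ∃ c : ℝ, 0 < c ∧
      ∀ (k t : ℝ) (n : ℕ) (ε : ℝ) (Ω₁ Ω₂ : TopologicalSpace.Opens (ReissnerMindlin.E (d + 1))),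
        0 < k → 0 < t → 1 ≤ n → 0 < ε → ε < c⁻¹ →
        Ω₁ ∈ A.omegaClass ω M → Ω₂ ∈ A.omegaClass ω M →
        ((ReissnerMindlin.innerNhd ε (Ω₁ : Set (ReissnerMindlin.E (d + 1))) ⊆ Ω₂ ∧
            (Ω₂ : Set (ReissnerMindlin.E (d + 1))) ⊆ Metric.thickening ε Ω₁) ∨
          (ReissnerMindlin.innerNhd ε (Ω₂ : Set (ReissnerMindlin.E (d + 1))) ⊆ Ω₁ ∧
            (Ω₁ : Set (ReissnerMindlin.E (d + 1))) ⊆ Metric.thickening ε Ω₂)) →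
        |ReissnerMindlin.eigenvalue lam mu k t Ω₁ n - ReissnerMindlin.eigenvalue lam mu k t Ω₂ n| ≤
          c * max (ReissnerMindlin.eigenvalue lam mu k t Ω₁ n)
              (ReissnerMindlin.eigenvalue lam mu k t Ω₂ n) * ω ε := by
  obtain ⟨c, R, hc, hR, hcomp⟩ :=
    ReissnerMindlin.exists_eigenvalue_comparison A hω hM hlam hmu
  refine ⟨c, hc, fun k t n ε Ω₁ Ω₂ hk ht hn hε hεc h₁ h₂ h => ?_⟩
  have hω0 : 0 ≤ ω ε := hω.map_zero ▸ hω.monotoneOn (mem_Ici.2 le_rfl) hε.le hε.le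
  have hγ₁ := ReissnerMindlin.eigenvalue_nonneg (hR Ω₁ h₁) hlam hmu hk ht hn
  rcases A.omegaClass_nonempty_or_eq_bot (ω := ω) (M := M) with hne | hbot
  · have key : ReissnerMindlin.eigenvalue lam mu k t Ω₂ n ≤
          (1 + c * ω ε) * ReissnerMindlin.eigenvalue lam mu k t Ω₁ n ∧
        ReissnerMindlin.eigenvalue lam mu k t Ω₁ n ≤
          (1 + c * ω ε) * ReissnerMindlin.eigenvalue lam mu k t Ω₂ n := by
      rcases h with ⟨hin, hout⟩ | ⟨hin, hout⟩
      · exact hcomp k t n ε Ω₁ Ω₂ hk ht hn hε hεc h₁ h₂ (hne _ h₁) (hne _ h₂) hin hout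
      · exact (hcomp k t n ε Ω₂ Ω₁ hk ht hn hε hεc h₂ h₁ (hne _ h₂) (hne _ h₁) hin hout).symm
    obtain ⟨key₁, key₂⟩ := key
    have hcω : 0 ≤ c * ω ε := mul_nonneg hc.le hω0
    have h3 := mul_le_mul_of_nonneg_left (le_max_left (ReissnerMindlin.eigenvalue lam mu k t Ω₁ n)
      (ReissnerMindlin.eigenvalue lam mu k t Ω₂ n)) hcω
    have h4 := mul_le_mul_of_nonneg_left (le_max_right (ReissnerMindlin.eigenvalue lam mu k t Ω₁ n)
      (ReissnerMindlin.eigenvalue lam mu k t Ω₂ n)) hcω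
    rw [abs_le]
    constructor <;> linarith
  -- An atlas without charts describes only the empty set.
  · rw [hbot Ω₁ h₁, hbot Ω₂ h₂, sub_self, abs_zero, max_self]
    rw [hbot Ω₁ h₁] at hγ₁
    exact mul_nonneg (mul_nonneg hc.le hγ₁) hω0
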